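/- Let $\upsilon,\tau,\mathscr R,\gamma,L,K>0$, $\kappa\in(0,1)$ and $t\in\mathbb R$. There is a constant $a_*$, depending only on $(\upsilon,\tau,\mathscr R,\gamma,\kappa,L,K,t)$, such that the following holds for all integers $n\ge 1$, $p\ge 0$ with $p/n\le\gamma$. Let $y=X\beta+\varepsilon$ with $\beta\in\mathbb R^p$ deterministic, $X\in\mathbb R^{n\times p}$ a random matrix with i.i.d. $N(0,\Sigma)$ rows $x_1,\dots,x_n$, where $\Sigma$ is symmetric with all eigenvalues in $[\kappa,1/\kappa]$, and $\varepsilon$ a random vector that is independent of $X$ and has a density with respect to the Lebesgue measure on $\mathbb R^n$. Let $\rho:\mathbb R\to\mathbb R$ be convex and continuously differentiable with $L$-Lipschitz derivative $\psi=\rho'$ such that $K^2\le\psi'(x)+\psi(x)^2$ for almost every $x\in\mathbb R$, and let $g:\mathbb R^p\to\mathbb R$ be such that $b\mapsto g(b)-\tau\|b\|_2^2/2$ is convex. Let $$\hat\beta=\operatorname*{argmin}_{b\in\mathbb R^p}\ \frac1n\sum_{i=1}^n\rho(y_i-x_i^\top b)+g(b)$$ and assume $\mathbb E[\|\Sigma^{1/2}(\hat\beta-\beta)\|_2^2]\le\mathscr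 R$. Write $\boldsymbol\psi=(\psi(y_i-x_i^\top\hat\beta))_{i=1}^n$, let $[\nabla_y\boldsymbol\psi]^\top$ be the Jacobian of the map $y\mapsto\boldsymbol\psi$ for fixed $X$ (it exists almost surely), and for $j\in\{1,\dots,p\}$ put $\Omega_{jj}=e_j^\top\Sigma^{-1}e_j$, $z_j=X\Sigma^{-1}\Omega_{jj}^{-1}e_j$, $$\xi_j=\|\boldsymbol\psi\|_2^{-1}\bigl[\boldsymbol\psi^\top z_j-n^{-1}\|z_j\|_2^2(\beta_j-\hat\beta_j)\operatorname{tr}(\nabla_y\boldsymbol\psi)\bigr],\qquad \xi'_j=\|\boldsymbol\psi\|_2^{-1}\bigl[\boldsymbol\psi^\top z_j-\Omega_{jj}^{-1}(\beta_j-\hat\beta_j)\operatorname{tr}(\nabla_y\boldsymbol\psi)\bigr].$$ Then, with $\Phi$ the standard normal distribution function, at most $a_*$ coordinates $j\in\{1,\dots,p\}$ satisfy $|\mathbb P(\Omega_{jj}^{1/2}\xi_j\le t)-\Phi(t)|>\upsilon$, and at most $a_*$ coordinates $j$ satisfy $|\mathbb P(\Omega_{jj}^{1/2}\xi'_j\le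 t)-\Phi(t)|>\upsilon$. -/

import Mathlib

open MeasureTheory ProbabilityTheory
open scoped Matrix

namespace RobustM

/-- The conditions on the loss: `ρ` is convex and continuously differentiable, `ψ = ρ'` is
`L`-Lipschitz, and `K² ≤ ψ'(x) + ψ(x)²` for Lebesgue-almost every `x`. -/
structure IsRobustLoss (ρ : ℝ → ℝ) (L K : ℝ) : Prop where
  convex : ConvexOn ℝ Set.univ ρ
  contDiff : ContDiff ℝ 1 ρ
  lipschitz : ∀ x y : ℝ, |deriv ρ x - deriv ρ y| ≤ L * |x - y|
  lower : ∀ᵐ x : ℝ, K ^ 2 ≤ deriv (deriv ρ) x + deriv ρ x ^ 2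

/-- The penalty is `τ`-strongly convex: `b ↦ g b - τ ‖b‖² / 2` is convex. -/
def IsStronglyConvexPenalty {p : ℕ} (g : EuclideanSpace ℝ (Fin p) → ℝ) (τ : ℝ) : Prop :=
  ConvexOn ℝ Set.univ (fun b => g b - τ * ‖b‖ ^ 2 / 2)

/-- The conditions on the design and the noise: `Sigma` is symmetric with all eigenvalues in
`[κ, 1/κ]`; the rows of the random matrix `X` are i.i.d. `N(0, Sigma)`; the noise vector `ε` is
independent of `X` and has a density with respect to Lebesgue measure on `ℝⁿ`. -/
structure IsGaussianDesign {S : Type*} [MeasurableSpace S] (P : Measure S) {n p : ℕ}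
    (X : S → Matrix (Fin n) (Fin p) ℝ) (ε : S → EuclideanSpace ℝ (Fin n))
    (Sigma : Matrix (Fin p) (Fin p) ℝ) (κ : ℝ) : Prop where
  symm : Sigma.IsSymm
  eigenvalues : spectrum ℝ Sigma ⊆ Set.Icc κ (1 / κ)
  rows_law : ∀ i : Fin n, HasLaw (fun ω => WithLp.toLp 2 (X ω i)) (multivariateGaussian 0 Sigma) P
  rows_indep : iIndepFun (fun (i : Fin n) (ω : S) => WithLp.toLp 2 (X ω i)) P
  noise_indep : IndepFun ε (fun ω (i : Fin n) (j : Fin p) => X ω i j) P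
  noise_density : HasPDF ε P volume

/-- The response `y = X β + ε` of the linear model. -/
noncomputable def response {n p : ℕ} (X : Matrix (Fin n) (Fin p) ℝ)
    (β : EuclideanSpace ℝ (Fin p)) (ε : EuclideanSpace ℝ (Fin n)) : EuclideanSpace ℝ (Fin n) :=
  WithLp.toLp 2 (X *ᵥ β.ofLp) + ε

/-- The objective `b ↦ (1/n) ∑ i, ρ (y i - x iᵀ b) + g b`. -/
noncomputable def objective {n p : ℕ} (ρ : ℝ → ℝ) (g : EuclideanSpace ℝ (Fin p) → ℝ)
    (X : Matrix (Fin n) (Fin p) ℝ) (y : EuclideanSpace ℝ (Fin n))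
    (b : EuclideanSpace ℝ (Fin p)) : ℝ :=
  1 / (n : ℝ) * ∑ i, ρ (y i - (X *ᵥ b.ofLp) i) + g b

/-- The penalized M-estimator: the minimizer of the objective (it exists and is unique when `ρ` is
convex and `g` is strongly convex). -/
noncomputable def estimator {n p : ℕ} (ρ : ℝ → ℝ) (g : EuclideanSpace ℝ (Fin p) → ℝ)
    (X : Matrix (Fin n) (Fin p) ℝ) (y : EuclideanSpace ℝ (Fin n)) : EuclideanSpace ℝ (Fin p) :=
  Classical.epsilon fun b => ∀ b' : EuclideanSpace ℝ (Fin p),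
    objective ρ g X y b ≤ objective ρ g X y b'

/-- The vector `(ψ (y i - x iᵀ b))_i` at the estimator `b`, with `ψ = ρ'`, as a function of
`(X, y)`. -/
noncomputable def psi {n p : ℕ} (ρ : ℝ → ℝ) (g : EuclideanSpace ℝ (Fin p) → ℝ)
    (X : Matrix (Fin n) (Fin p) ℝ) (y : EuclideanSpace ℝ (Fin n)) : EuclideanSpace ℝ (Fin n) :=
  WithLp.toLp 2 fun i => deriv ρ (y i - (X *ᵥ (estimator ρ g X y).ofLp) i)

/-- The gradient of `y ↦ psi ρ g X y` for fixed `X`, that is, the transpose of its Jacobian: the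
entry `(l, i)` is the partial derivative of the `i`-th component with respect to `y l`. -/
noncomputable def gradPsi {n p : ℕ} (ρ : ℝ → ℝ) (g : EuclideanSpace ℝ (Fin p) → ℝ)
    (X : Matrix (Fin n) (Fin p) ℝ) (y : EuclideanSpace ℝ (Fin n)) : Matrix (Fin n) (Fin n) ℝ :=
  Matrix.of fun l i => (fderiv ℝ (psi ρ g X) y (EuclideanSpace.single l 1)) i

/-- The diagonal entry `e_jᵀ Sigma⁻¹ e_j` of the precision matrix. -/
noncomputable def omega {p : ℕ} (Sigma : Matrix (Fin p) (Fin p) ℝ) (j : Fin p) : ℝ :=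
  Sigma⁻¹ j j

/-- The vector `z_j = X Sigma⁻¹ omega_j⁻¹ e_j`. -/
noncomputable def zvec {n p : ℕ} (X : Matrix (Fin n) (Fin p) ℝ)
    (Sigma : Matrix (Fin p) (Fin p) ℝ) (j : Fin p) : EuclideanSpace ℝ (Fin n) :=
  WithLp.toLp 2 (X *ᵥ (Sigma⁻¹ *ᵥ ((omega Sigma j)⁻¹ • Pi.single j (1 : ℝ))))

/-- The pivot `ξ_j = ‖ψ‖⁻¹ (ψᵀ z_j - n⁻¹ ‖z_j‖² (β_j - b_j) tr ∇_y ψ)`, with `b` the estimator. -/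
noncomputable def xi {n p : ℕ} (ρ : ℝ → ℝ) (g : EuclideanSpace ℝ (Fin p) → ℝ)
    (Sigma : Matrix (Fin p) (Fin p) ℝ) (β : EuclideanSpace ℝ (Fin p))
    (X : Matrix (Fin n) (Fin p) ℝ) (y : EuclideanSpace ℝ (Fin n)) (j : Fin p) : ℝ :=
  ‖psi ρ g X y‖⁻¹ *
    (inner ℝ (psi ρ g X y) (zvec X Sigma j)
      - (n : ℝ)⁻¹ * ‖zvec X Sigma j‖ ^ 2 * (β j - estimator ρ g X y j) *
        (gradPsi ρ g X y).trace)

/-- The pivot `ξ'_j = ‖ψ‖⁻¹ (ψᵀ z_j - omega_j⁻¹ (β_j - b_j) tr ∇_y ψ)`, with `b` the estimator. -/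
noncomputable def xiPrime {n p : ℕ} (ρ : ℝ → ℝ) (g : EuclideanSpace ℝ (Fin p) → ℝ)
    (Sigma : Matrix (Fin p) (Fin p) ℝ) (β : EuclideanSpace ℝ (Fin p))
    (X : Matrix (Fin n) (Fin p) ℝ) (y : EuclideanSpace ℝ (Fin n)) (j : Fin p) : ℝ :=
  ‖psi ρ g X y‖⁻¹ *
    (inner ℝ (psi ρ g X y) (zvec X Sigma j)
      - (omega Sigma j)⁻¹ * (β j - estimator ρ g X y j) * (gradPsi ρ g X y).trace)

/-- The squared error `‖Sigma^(1/2) h‖² = hᵀ Sigma h` with `h = b - β`, `b` the estimator. -/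
noncomputable def squaredError {n p : ℕ} (ρ : ℝ → ℝ) (g : EuclideanSpace ℝ (Fin p) → ℝ)
    (Sigma : Matrix (Fin p) (Fin p) ℝ) (β : EuclideanSpace ℝ (Fin p))
    (X : Matrix (Fin n) (Fin p) ℝ) (y : EuclideanSpace ℝ (Fin n)) : ℝ :=
  (estimator ρ g X y - β).ofLp ⬝ᵥ (Sigma *ᵥ (estimator ρ g X y - β).ofLp)

/-- The standard normal cumulative distribution function. -/
noncomputable def stdNormalCDF (t : ℝ) : ℝ := cdf (gaussianReal 0 1) t

/-- The coordinates `j` with `|P(√(omega_j) V_j ≤ t) - Φ(t)| > υ`, for random variables `V_j`. -/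
def exceptionalSet {S : Type*} [MeasurableSpace S] (P : Measure S) {p : ℕ}
    (Sigma : Matrix (Fin p) (Fin p) ℝ) (V : Fin p → S → ℝ) (υ t : ℝ) : Set (Fin p) :=
  {j | υ < |P.real {ω | √(omega Sigma j) * V j ω ≤ t} - stdNormalCDF t|}

end RobustM

/-! Fix j and put c = Ω_jj^(-1/2). In law, X = A + c w e_jᵀ, where w = Ω_jj^(1/2) z_j is standard
normal in ℝⁿ and independent of (A, ε). The argument is conditional on (A, ε): the scores form a
random field ψ(w), and the pivot is close to a normalized Gaussian divergence of that field.

Normal approximation. For a vector field f let δf = ⟨f, w⟩ - div f and m = E f. Integration by parts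
gives E (δf)² = E ‖f‖² + E tr((∇f)²) and E δf ⟨w, m⟩ = ‖m‖². With the Poincaré inequality, E (δf -
⟨w, m⟩)² and E ‖f - m‖² are both bounded by a multiple of E ‖∇f‖_F²
(`gaussian_poincare_of_lipschitz`). If this energy is small and ‖f‖ is bounded below, then δf / ‖f‖
is close to ⟨w, m/‖m‖⟩, which is exactly N(0,1) (`normal_approximation`). The field used is ψ /
√(‖ψ‖² + s), cut off far from the origin.

Derivatives. Strong convexity of the penalty and cocoercivity of the scores show that the derivative
of ψ at (w, ε) in the direction (v, v') is at most L ‖v' - a v‖ + q |⟨v, ψ⟩|, with a = c (b_j -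
β_j), b the estimator, and q = c √(L/(nτ)) (`fderiv_pertPsi_bound`). Along (v, a v) only a rank one
term survives, so div_w ψ = -a tr ∇_y ψ + O(q ‖ψ‖): the correction in ξ'_j is the divergence. In ξ_j
it carries an extra factor ‖w‖²/n = 1 + O(n^(-1/2)). The same bound shows that ‖∇f‖_F² is at most a
multiple of V_j + q², up to the cutoff, where V_j = n (b_j - β_j)² / (‖ψ‖² + s).

Counting. The sum of the V_j is n ‖b - β‖² / (‖ψ‖² + s). If its mean is at most C, at most C/θ₀
coordinates have E V_j ≥ θ₀, and the others satisfy the normal approximation once n ≥ n₀. For n < n₀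
there are at most γ n₀ coordinates in all.

The level s (`exists_regularization`). It must satisfy P(‖ψ‖² < s) ≤ η while C depends on the fixed
parameters only. Compare b with b₀ = argmin g and put h₀ = b₀ - β. Since n τ ‖b - b₀‖ ≤ ‖X‖ ‖ψ‖, the
part of the energy due to b - b₀ is at most a multiple of ‖X‖²/n, which is bounded in mean. The
remaining part is n ‖h₀‖²/s. The scores at b₀ are at most (1 + L ‖X‖²/(nτ)) ‖ψ‖, and given ε the
residuals at b₀ are independent Gaussians of standard deviation t = ‖Sigma^(1/2) h₀‖. Because ψ' +
ψ² ≥ K², a score is small only on a short interval, so ‖ψ‖² is rarely below a multiple of n min(1,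
t²). This order is taken for s: it controls n ‖h₀‖²/s when t is small, and the hypothesis on the
squared error takes over when t is large. If h₀ = 0 there is no bias term, and the density of the
noise provides some positive s. -/

namespace RobustM

open Real Filter Topology ContinuousLinearMap
open scoped RealInnerProductSpace NNReal

set_option linter.unusedSectionVars false

/-! ### Gaussian density and integration by parts -/

section Gaussian

variable {E : Type*} [NormedAddCommGroup E] [InnerProductSpace ℝ E] [FiniteDimensional ℝ E]
  [MeasurableSpace E] [BorelSpace E]

/-- The density of the standard Gaussian measure. -/
noncomputable def gaussDensity (E : Type*) [NormedAddCommGroup E] [InnerProductSpace ℝ E] (x : E) :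
    ℝ :=
  (2 * π) ^ (-(Module.finrank ℝ E : ℝ) / 2) * rexp (-‖x‖ ^ 2 / 2)

lemma gaussDensity_pos (x : E) : 0 < gaussDensity E x := by
  unfold gaussDensity; positivity

lemma contDiff_gaussDensity : ContDiff ℝ 1 (gaussDensity E) := by
  unfold gaussDensity
  exact contDiff_const.mul (Real.contDiff_exp.comp (((contDiff_norm_sq ℝ).neg).div_const _))

lemma hasFDerivAt_gaussDensity (x : E) :
    HasFDerivAt (gaussDensity E) (-(gaussDensity E x) • innerSL ℝ x) x := by
  unfold gaussDensity
  have h1 : HasFDerivAt (fun x : E => -‖x‖ ^ 2 / 2) (-innerSL ℝ x) x := by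
    have := ((hasStrictFDerivAt_norm_sq x).hasFDerivAt.neg).mul_const (2 : ℝ)⁻¹
    convert! this using 1
    ext v; simp
  have h2 := (h1.exp).const_mul ((2 * π) ^ (-(Module.finrank ℝ E : ℝ) / 2))
  convert! h2 using 1
  ext v; simp; ring

lemma fderiv_gaussDensity (x : E) :
    fderiv ℝ (gaussDensity E) x = -(gaussDensity E x) • innerSL ℝ x :=
  (hasFDerivAt_gaussDensity x).fderiv

lemma integral_cexp_mul_gaussDensity (t : E) :
    ∫ x : E, Complex.exp (⟪x, t⟫ * Complex.I) * (gaussDensity E x : ℂ)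
      = Complex.exp (-‖t‖ ^ 2 / 2) := by
  have h := GaussianFourier.integral_cexp_neg_mul_sq_norm_add (V := E) (b := 1 / 2)
    (by norm_num) Complex.I t
  have e : ∀ x : E, Complex.exp (⟪x, t⟫ * Complex.I) * (gaussDensity E x : ℂ) =
      ((2 * π : ℝ) ^ (-(Module.finrank ℝ E : ℝ) / 2) : ℝ) *
      Complex.exp (-(1 / 2) * ‖x‖ ^ 2 + Complex.I * ⟪t, x⟫) := by
    intro x
    rw [gaussDensity, Complex.exp_add]
    push_cast
    rw [real_inner_comm x t]
    ring_nf
  simp_rw [e]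
  rw [integral_const_mul, h, ← mul_assoc]
  have h3 : (((2 * π : ℝ) ^ (-(Module.finrank ℝ E : ℝ) / 2) : ℝ) : ℂ) *
      (π / (1 / 2 : ℂ)) ^ (Module.finrank ℝ E / 2 : ℂ) = 1 := by
    have : (π / (1 / 2 : ℂ)) ^ (Module.finrank ℝ E / 2 : ℂ) =
        (((2 * π : ℝ) ^ ((Module.finrank ℝ E : ℝ) / 2) : ℝ) : ℂ) := by
      rw [Complex.ofReal_cpow (by positivity)]
      push_cast
      congr 1
      ring
    rw [this, ← Complex.ofReal_mul, ← Real.rpow_add (by positivity)]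
    simp [neg_div]
  rw [h3, one_mul]
  congr 1
  simp
  ring

lemma integrable_gaussDensity : Integrable (gaussDensity E) := by
  have h := GaussianFourier.integrable_cexp_neg_mul_sq_norm_add (V := E) (b := 1 / 2)
    (by norm_num) 0 0
  have h2 := (h.norm).const_mul ((2 * π) ^ (-(Module.finrank ℝ E : ℝ) / 2))
  refine h2.congr (ae_of_all _ fun x => ?_)
  simp only [gaussDensity, Complex.norm_exp]
  congr 2
  simp
  norm_cast
  ring

/-- Both measures are finite with the same characteristic function. The density form makes
integration by parts for Lebesgue measure available under the Gaussian. -/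
lemma stdGaussian_eq_withDensity :
    stdGaussian E = volume.withDensity (fun x : E => ENNReal.ofReal (gaussDensity E x)) := by
  have hm : Measurable (gaussDensity E) := contDiff_gaussDensity.continuous.measurable
  have : IsFiniteMeasure (volume.withDensity (fun x : E => ENNReal.ofReal (gaussDensity E x))) :=
    isFiniteMeasure_withDensity_ofReal integrable_gaussDensity.2
  apply Measure.ext_of_charFun
  ext t
  rw [charFun_stdGaussian, charFun_apply]
  rw [integral_withDensity_eq_integral_toReal_smul hm.ennreal_ofReal (by simp)]
  rw [← integral_cexp_mul_gaussDensity]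
  congr 1
  ext x
  rw [ENNReal.toReal_ofReal (gaussDensity_pos x).le, Complex.real_smul, mul_comm]

lemma stdGaussian_absolutelyContinuous : stdGaussian E ≪ (volume : Measure E) := by
  rw [stdGaussian_eq_withDensity]
  exact withDensity_absolutelyContinuous _ _

lemma integral_stdGaussian {F : Type*} [NormedAddCommGroup F] [NormedSpace ℝ F] (f : E → F) :
    ∫ x, f x ∂(stdGaussian E) = ∫ x, gaussDensity E x • f x := by
  have hm : Measurable (gaussDensity E) := contDiff_gaussDensity.continuous.measurable
  rw [stdGaussian_eq_withDensity, integral_withDensity_eq_integral_toReal_smul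
    hm.ennreal_ofReal (by simp)]
  congr 1
  ext x
  rw [ENNReal.toReal_ofReal (gaussDensity_pos x).le]

/-- Stein's identity for a compactly supported function of class `C¹`. -/
lemma integral_stein {u : E → ℝ} (hu : ContDiff ℝ 1 u) (hc : HasCompactSupport u) (v : E) :
    ∫ x, u x * ⟪x, v⟫ ∂(stdGaussian E) = ∫ x, fderiv ℝ u x v ∂(stdGaussian E) := by
  have hφ := (contDiff_gaussDensity (E := E)).continuous
  have hu' : Continuous (fun x => fderiv ℝ u x v) :=
    (hu.continuous_fderiv (by norm_num)).clm_apply continuous_const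
  have hc' : HasCompactSupport (fun x => fderiv ℝ u x v) := hc.fderiv_apply (𝕜 := ℝ) v
  have h := integral_mul_fderiv_eq_neg_fderiv_mul_of_integrable (μ := (volume : Measure E))
    (f := u) (g := gaussDensity E) (v := v)
    ((hu'.mul hφ).integrable_of_hasCompactSupport hc'.mul_right)
    (by
      simp only [fderiv_gaussDensity]
      apply Continuous.integrable_of_hasCompactSupport
      · have := hu.continuous
        simp only [smul_apply, innerSL_apply_apply, smul_eq_mul]
        fun_prop
      · exact hc.mul_right)
    ((hu.continuous.mul hφ).integrable_of_hasCompactSupport hc.mul_right)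
    (fun x _ => hu.differentiable (by norm_num) x)
    (fun x _ => contDiff_gaussDensity.differentiable (by norm_num) x)
  rw [integral_stdGaussian, integral_stdGaussian]
  simp only [fderiv_gaussDensity, smul_apply, innerSL_apply_apply, smul_eq_mul] at h ⊢
  have e1 : ∫ x, gaussDensity E x * (u x * ⟪x, v⟫) = - ∫ x, u x * (-gaussDensity E x * ⟪x, v⟫) := by
    rw [← integral_neg]; congr 1; ext x; ring
  rw [e1, h, neg_neg]
  congr 1; ext x; ring

/-- Stein's identity is used twice: in the direction u for a times the second factor, then in the
direction v for a ∂_u b. The mixed second derivatives of b cancel by symmetry. Compact support of a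
alone makes every integral finite. -/
lemma integral_skorokhod_mul_skorokhod {a b : E → ℝ} (ha : ContDiff ℝ 2 a) (hb : ContDiff ℝ 2 b)
    (hac : HasCompactSupport a) (u v : E) :
    ∫ x, (a x * ⟪x, u⟫ - fderiv ℝ a x u) * (b x * ⟪x, v⟫ - fderiv ℝ b x v) ∂(stdGaussian E)
      = ⟪u, v⟫ * ∫ x, a x * b x ∂(stdGaussian E)
        + ∫ x, fderiv ℝ a x v * fderiv ℝ b x u ∂(stdGaussian E) := by
  have ha1 : ContDiff ℝ 1 a := ha.of_le (by norm_num)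
  have hb1 : ContDiff ℝ 1 b := hb.of_le (by norm_num)
  have hda : ∀ w, ContDiff ℝ 1 (fun x => fderiv ℝ a x w) := fun w =>
    (ha.fderiv_right (m := 1) (by norm_num)).clm_apply contDiff_const
  have hdb : ∀ w, ContDiff ℝ 1 (fun x => fderiv ℝ b x w) := fun w =>
    (hb.fderiv_right (m := 1) (by norm_num)).clm_apply contDiff_const
  have hin : ∀ w : E, ContDiff ℝ 1 (fun x : E => ⟪x, w⟫) := fun w =>
    contDiff_id.inner ℝ contDiff_const
  have dA : ∀ x, DifferentiableAt ℝ a x := fun x => ha1.differentiable (by norm_num) x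
  have dB : ∀ x, DifferentiableAt ℝ b x := fun x => hb1.differentiable (by norm_num) x
  have dI : ∀ (w x : E), DifferentiableAt ℝ (fun x : E => ⟪x, w⟫) x :=
    fun w x => (hin w).differentiable (by norm_num) x
  have dDB : ∀ w x, DifferentiableAt ℝ (fun x => fderiv ℝ b x w) x :=
    fun w x => (hdb w).differentiable (by norm_num) x
  have fI : ∀ w x z : E, fderiv ℝ (fun x : E => ⟪x, w⟫) x z = ⟪z, w⟫ := by
    intro w x z
    rw [fderiv_inner_apply ℝ differentiableAt_fun_id (differentiableAt_const w)]
    simp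
  set G : E → ℝ := fun x => b x * ⟪x, v⟫ - fderiv ℝ b x v with hG
  have hGc : ContDiff ℝ 1 G := (hb1.mul (hin v)).sub (hdb v)
  have fG : ∀ x, fderiv ℝ G x u = fderiv ℝ b x u * ⟪x, v⟫ + b x * ⟪u, v⟫
      - fderiv ℝ (fun x => fderiv ℝ b x v) x u := by
    intro x
    rw [hG, fderiv_fun_sub ((dB x).fun_mul (dI v x)) (dDB v x), fderiv_fun_mul (dB x) (dI v x)]
    simp only [sub_apply, add_apply, smul_apply, smul_eq_mul, fI]
    ring
  have i1 := integral_stein (ha1.mul hGc) hac.mul_right u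
  have i2 := integral_stein (ha1.mul (hdb u)) hac.mul_right v
  have f1 : ∀ x, fderiv ℝ (fun x => a x * G x) x u = fderiv ℝ a x u * G x + a x * fderiv ℝ G x u := by
    intro x
    rw [fderiv_fun_mul (dA x) (hGc.differentiable (by norm_num) x)]
    simp only [add_apply, smul_apply, smul_eq_mul]; ring
  have f2 : ∀ x, fderiv ℝ (fun x => a x * fderiv ℝ b x u) x v
      = fderiv ℝ a x v * fderiv ℝ b x u + a x * fderiv ℝ (fun x => fderiv ℝ b x u) x v := by
    intro x
    rw [fderiv_fun_mul (dA x) (dDB u x)]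
    simp only [add_apply, smul_apply, smul_eq_mul]; ring
  have symm : ∀ x, fderiv ℝ (fun x => fderiv ℝ b x u) x v
      = fderiv ℝ (fun x => fderiv ℝ b x v) x u := by
    intro x
    have h2 : IsSymmSndFDerivAt ℝ b x :=
      hb.contDiffAt.isSymmSndFDerivAt (by simp [minSmoothness_of_isRCLikeNormedField])
    have hd : DifferentiableAt ℝ (fderiv ℝ b) x :=
      (hb.fderiv_right (m := 1) (by norm_num)).differentiable (by norm_num) x
    have : ∀ w z : E, fderiv ℝ (fun x => fderiv ℝ b x w) x z = fderiv ℝ (fderiv ℝ b) x z w := by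
      intro w z
      rw [fderiv_clm_apply hd (differentiableAt_const w)]
      simp
    rw [this, this]
    exact h2 v u
  simp_rw [f1] at i1
  simp_rw [f2] at i2
  have cI : ∀ w : E, Continuous (fun x : E => ⟪x, w⟫) := fun w => (hin w).continuous
  have hca := ha.continuous
  have hcb := hb.continuous
  have cda := fun w => (hda w).continuous
  have cdb := fun w => (hdb w).continuous
  have cddb : ∀ w z, Continuous (fun x => fderiv ℝ (fun x => fderiv ℝ b x w) x z) := fun w z =>
    ((hdb w).continuous_fderiv (by norm_num)).clm_apply continuous_const
  have cG := hGc.continuous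
  have cfG : Continuous (fun x => fderiv ℝ G x u) :=
    (hGc.continuous_fderiv (by norm_num)).clm_apply continuous_const
  have hdac : ∀ w, HasCompactSupport (fun x => fderiv ℝ a x w) := fun w =>
    hac.fderiv_apply (𝕜 := ℝ) w
  have IA : ∀ g : E → ℝ, Continuous g → Integrable (fun x => a x * g x) (stdGaussian E) :=
    fun g hg => (hca.mul hg).integrable_of_hasCompactSupport hac.mul_right
  have ID : ∀ (w : E) (g : E → ℝ), Continuous g →
      Integrable (fun x => fderiv ℝ a x w * g x) (stdGaussian E) :=
    fun w g hg => ((cda w).mul hg).integrable_of_hasCompactSupport (hdac w).mul_right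
  have e0 : ∀ x, (a x * ⟪x, u⟫ - fderiv ℝ a x u) * G x
      = a x * (G x * ⟪x, u⟫) - fderiv ℝ a x u * G x := fun x => by ring
  have e1 : ∀ x, a x * fderiv ℝ G x u = a x * (⟪u, v⟫ * b x) + (a x * (fderiv ℝ b x u * ⟪x, v⟫)
      - a x * fderiv ℝ (fun x => fderiv ℝ b x u) x v) := by
    intro x; rw [fG, symm]; ring
  change ∫ x, (a x * ⟪x, u⟫ - fderiv ℝ a x u) * G x ∂(stdGaussian E) = _
  simp_rw [e0]
  simp_rw [mul_assoc] at i1 i2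
  rw [integral_add (ID u _ cG) (IA _ cfG)] at i1
  rw [integral_add (ID v _ (cdb u)) (IA _ (cddb u v))] at i2
  rw [integral_sub (IA _ (cG.fun_mul (cI u))) (ID u _ cG), i1]
  simp_rw [e1]
  rw [integral_add (IA _ (continuous_const.fun_mul hcb))
    (show Integrable (fun x => a x * (fderiv ℝ b x u * ⟪x, v⟫)
      - a x * fderiv ℝ (fun x => fderiv ℝ b x u) x v) (stdGaussian E) from
      (IA _ ((cdb u).fun_mul (cI v))).sub (IA _ (cddb u v))),
    integral_sub (IA _ ((cdb u).fun_mul (cI v))) (IA _ (cddb u v)), i2]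
  have e2 : ∫ x, a x * (⟪u, v⟫ * b x) ∂(stdGaussian E)
      = ⟪u, v⟫ * ∫ x, a x * b x ∂(stdGaussian E) := by
    rw [← integral_const_mul]; congr 1; ext x; ring
  rw [e2]
  ring

end Gaussian

/-! ### Second moments of the Gaussian divergence -/

section Divergence

variable {ι : Type*} [Fintype ι] [DecidableEq ι]

/-- The squared Frobenius norm of a linear map. -/
noncomputable def frobSq {F : Type*} [NormedAddCommGroup F] [NormedSpace ℝ F]
    (A : EuclideanSpace ℝ ι →L[ℝ] F) : ℝ := ∑ i, ‖A (EuclideanSpace.single i 1)‖ ^ 2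

/-- The trace of an endomorphism of `ℝ^ι`. -/
noncomputable def clmTrace (A : EuclideanSpace ℝ ι →L[ℝ] EuclideanSpace ℝ ι) : ℝ :=
  ∑ i, A (EuclideanSpace.single i 1) i

/-- The Gaussian divergence `⟨f x, x⟩ - div f x`. -/
noncomputable def skorokhod (f : EuclideanSpace ℝ ι → EuclideanSpace ℝ ι)
    (x : EuclideanSpace ℝ ι) : ℝ := ⟪f x, x⟫ - clmTrace (fderiv ℝ f x)

lemma frobSq_nonneg {F : Type*} [NormedAddCommGroup F] [NormedSpace ℝ F]
    (A : EuclideanSpace ℝ ι →L[ℝ] F) : 0 ≤ frobSq A :=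
  Finset.sum_nonneg fun _ _ => sq_nonneg _

lemma continuous_frobSq {F : Type*} [NormedAddCommGroup F] [NormedSpace ℝ F] :
    Continuous (frobSq : (EuclideanSpace ℝ ι →L[ℝ] F) → ℝ) := by
  unfold frobSq; fun_prop

lemma continuous_clmTrace :
    Continuous (clmTrace : (EuclideanSpace ℝ ι →L[ℝ] EuclideanSpace ℝ ι) → ℝ) := by
  unfold clmTrace; fun_prop

lemma integral_inner_sq_stdGaussian (m : EuclideanSpace ℝ ι) :
    ∫ x, ⟪x, m⟫ ^ 2 ∂(stdGaussian (EuclideanSpace ℝ ι)) = ‖m‖ ^ 2 := by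
  have h := variance_dual_stdGaussian (innerSL ℝ m)
  rw [variance_eq_integral (innerSL ℝ m).continuous.aemeasurable,
    integral_strongDual_stdGaussian] at h
  simpa [real_inner_comm] using h

lemma integrable_norm_sq_stdGaussian :
    Integrable (fun x => ‖x‖ ^ 2) (stdGaussian (EuclideanSpace ℝ ι)) :=
  (IsGaussian.memLp_two_id (μ := stdGaussian (EuclideanSpace ℝ ι))).integrable_norm_pow (by norm_num)

lemma integrable_inner_sq_stdGaussian (m : EuclideanSpace ℝ ι) :
    Integrable (fun x => ⟪x, m⟫ ^ 2) (stdGaussian (EuclideanSpace ℝ ι)) := by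
  refine (integrable_norm_sq_stdGaussian.mul_const (‖m‖ ^ 2)).mono'
    (Continuous.aestronglyMeasurable (by fun_prop)) (ae_of_all _ fun x => ?_)
  rw [Real.norm_of_nonneg (sq_nonneg _), ← mul_pow]
  exact sq_le_sq' (by linarith [neg_abs_le ⟪x, m⟫, abs_real_inner_le_norm x m])
    (real_inner_le_norm x m)

lemma integral_norm_sq_clm_stdGaussian {κ : Type*} [Fintype κ]
    (A : EuclideanSpace ℝ ι →L[ℝ] EuclideanSpace ℝ κ) :
    ∫ x, ‖A x‖ ^ 2 ∂(stdGaussian (EuclideanSpace ℝ ι)) = frobSq A := by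
  have e : ∀ k x, A x k = ⟪x, adjoint A (EuclideanSpace.basisFun κ ℝ k)⟫ := by
    intro k x
    rw [ContinuousLinearMap.adjoint_inner_right]; simp
  simp_rw [EuclideanSpace.real_norm_sq_eq, e]
  rw [integral_finsetSum _ (fun k _ => integrable_inner_sq_stdGaussian _)]
  simp_rw [integral_inner_sq_stdGaussian, EuclideanSpace.real_norm_sq_eq]
  rw [Finset.sum_comm, frobSq]
  refine Finset.sum_congr rfl fun i _ => ?_
  rw [EuclideanSpace.real_norm_sq_eq]
  refine Finset.sum_congr rfl fun k _ => ?_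
  rw [e k, EuclideanSpace.inner_single_left]; simp

lemma fderiv_coord {E : Type*} [NormedAddCommGroup E] [NormedSpace ℝ E]
    {f : E → EuclideanSpace ℝ ι} {x : E} (hf : DifferentiableAt ℝ f x) (i : ι) (v : E) :
    fderiv ℝ (fun x => f x i) x v = (fderiv ℝ f x v) i := by
  have := ((EuclideanSpace.proj (𝕜 := ℝ) i).hasFDerivAt.comp x hf.hasFDerivAt).fderiv
  have e : (fun x => f x i) = (EuclideanSpace.proj (𝕜 := ℝ) i) ∘ f := by ext; simp
  rw [e, this]; simp

variable {f : EuclideanSpace ℝ ι → EuclideanSpace ℝ ι}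

lemma contDiff_coord {n : WithTop ℕ∞} (hf : ContDiff ℝ n f) (i : ι) :
    ContDiff ℝ n (fun x => f x i) :=
  (EuclideanSpace.proj (𝕜 := ℝ) i).contDiff.comp hf

lemma hasCompactSupport_coord (hc : HasCompactSupport f) (i : ι) :
    HasCompactSupport (fun x => f x i) :=
  hc.comp_left (g := fun v : EuclideanSpace ℝ ι => v i) (by simp)

lemma skorokhod_eq_sum (hf : Differentiable ℝ f) (x : EuclideanSpace ℝ ι) :
    skorokhod f x = ∑ i, (f x i * ⟪x, EuclideanSpace.single i (1 : ℝ)⟫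
      - fderiv ℝ (fun x => f x i) x (EuclideanSpace.single i 1)) := by
  simp only [fderiv_coord (hf x), Finset.sum_sub_distrib, skorokhod, clmTrace]
  congr 1
  rw [real_inner_comm, PiLp.inner_apply]
  refine Finset.sum_congr rfl fun i _ => ?_
  rw [EuclideanSpace.inner_single_right]; simp

lemma continuous_skorokhod (hf : ContDiff ℝ 1 f) : Continuous (skorokhod f) := by
  have := hf.continuous
  have h2 := continuous_clmTrace.comp (hf.continuous_fderiv (by norm_num))
  unfold skorokhod
  exact (by fun_prop : Continuous fun x => ⟪f x, x⟫).sub h2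

lemma hasCompactSupport_skorokhod (hc : HasCompactSupport f) :
    HasCompactSupport (skorokhod f) := by
  refine HasCompactSupport.intro hc fun x hx => ?_
  have h1 : f x = 0 := image_eq_zero_of_notMem_tsupport hx
  have h2 : fderiv ℝ f x = 0 := by
    by_contra h
    exact hx (support_fderiv_subset ℝ h)
  simp [skorokhod, h1, h2, clmTrace]

/-- Expand over pairs of coordinates and apply the bilinear identity. The factors ⟪e_i, e_k⟫ keep
only the diagonal, which gives ‖f‖²; the other term is tr((∇f)²). -/
lemma integral_skorokhod_sq (hf : ContDiff ℝ 2 f) (hc : HasCompactSupport f) :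
    ∫ x, skorokhod f x ^ 2 ∂(stdGaussian (EuclideanSpace ℝ ι))
      = ∫ x, ‖f x‖ ^ 2 ∂(stdGaussian (EuclideanSpace ℝ ι))
        + ∫ x, ∑ i, ∑ k, fderiv ℝ f x (EuclideanSpace.single k 1) i *
          fderiv ℝ f x (EuclideanSpace.single i 1) k ∂(stdGaussian (EuclideanSpace ℝ ι)) := by
  have hf1 : ContDiff ℝ 1 f := hf.of_le (by norm_num)
  have hd : Differentiable ℝ f := hf1.differentiable (by norm_num)
  have hcf := hf.continuous
  have cfd : ∀ i k, Continuous fun x => fderiv ℝ f x (EuclideanSpace.single i 1) k := by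
    intro i k
    have := hf1.continuous_fderiv (by norm_num)
    fun_prop
  have hcd : ∀ i k, HasCompactSupport fun x => fderiv ℝ f x (EuclideanSpace.single i 1) k :=
    fun i k => (hc.fderiv_apply (𝕜 := ℝ) _).comp_left (g := fun v : EuclideanSpace ℝ ι => v k)
      (by simp)
  have I : ∀ {g : EuclideanSpace ℝ ι → ℝ}, Continuous g → HasCompactSupport g →
      Integrable g (stdGaussian (EuclideanSpace ℝ ι)) :=
    fun hg hc => hg.integrable_of_hasCompactSupport hc
  have key : ∀ i k, _ := fun i k =>
    integral_skorokhod_mul_skorokhod (contDiff_coord hf i) (contDiff_coord hf k)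
      (hasCompactSupport_coord hc i)
      (EuclideanSpace.single i 1) (EuclideanSpace.single k 1)
  simp only [fderiv_coord (hd _)] at key
  have e : ∀ x, skorokhod f x ^ 2 = ∑ i, ∑ k,
      (f x i * ⟪x, EuclideanSpace.single i (1 : ℝ)⟫ - fderiv ℝ f x (EuclideanSpace.single i 1) i) *
      (f x k * ⟪x, EuclideanSpace.single k (1 : ℝ)⟫ - fderiv ℝ f x (EuclideanSpace.single k 1) k) := by
    intro x
    rw [skorokhod_eq_sum hd, sq, Finset.sum_mul_sum]
    simp only [fderiv_coord (hd _)]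
  simp_rw [e]
  have cin : ∀ i : ι, Continuous fun x : EuclideanSpace ℝ ι => ⟪x, EuclideanSpace.single i (1 : ℝ)⟫ :=
    fun i => by fun_prop
  have cG : ∀ i, Continuous fun x => f x i * ⟪x, EuclideanSpace.single i (1 : ℝ)⟫
      - fderiv ℝ f x (EuclideanSpace.single i 1) i := fun i => by
    have := cfd i i; have := cin i; fun_prop
  have sG : ∀ i, HasCompactSupport fun x => f x i * ⟪x, EuclideanSpace.single i (1 : ℝ)⟫
      - fderiv ℝ f x (EuclideanSpace.single i 1) i := fun i =>
    ((hasCompactSupport_coord hc i).mul_right).sub (hcd i i)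
  have i1 : ∀ i k, Integrable (fun x =>
      (f x i * ⟪x, EuclideanSpace.single i (1 : ℝ)⟫ - fderiv ℝ f x (EuclideanSpace.single i 1) i) *
      (f x k * ⟪x, EuclideanSpace.single k (1 : ℝ)⟫ - fderiv ℝ f x (EuclideanSpace.single k 1) k))
      (stdGaussian (EuclideanSpace ℝ ι)) := fun i k =>
    I ((cG i).mul (cG k)) ((sG i).mul_right)
  have i2 : ∀ i k, Integrable (fun x => fderiv ℝ f x (EuclideanSpace.single k 1) i *
          fderiv ℝ f x (EuclideanSpace.single i 1) k) (stdGaussian (EuclideanSpace ℝ ι)) :=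
    fun i k => I ((cfd k i).mul (cfd i k)) ((hcd k i).mul_right)
  have i3 : ∀ i, Integrable (fun x => f x i ^ 2) (stdGaussian (EuclideanSpace ℝ ι)) := fun i =>
    I (by fun_prop) ((hasCompactSupport_coord hc i).comp_left (g := fun t => t ^ 2) (by simp))
  rw [integral_finsetSum _ (fun i _ => integrable_finsetSum _ (fun k _ => i1 i k)),
    integral_finsetSum _ (fun i _ => integrable_finsetSum _ (fun k _ => i2 i k))]
  simp_rw [EuclideanSpace.real_norm_sq_eq]
  rw [integral_finsetSum _ (fun i _ => i3 i), ← Finset.sum_add_distrib]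
  refine Finset.sum_congr rfl fun i _ => ?_
  rw [integral_finsetSum _ (fun k _ => i1 i k), integral_finsetSum _ (fun k _ => i2 i k)]
  simp_rw [key, Finset.sum_add_distrib]
  congr 1
  rw [Finset.sum_eq_single i]
  · simp [sq]
  · intro k _ hk
    simp [EuclideanSpace.inner_single_left, hk.symm]
  · simp

/-- The divergence is adjoint to the gradient, and x ↦ ⟪x, m⟫ has the constant gradient m. -/
lemma integral_skorokhod_mul_inner (hf : ContDiff ℝ 1 f) (hc : HasCompactSupport f)
    (m : EuclideanSpace ℝ ι) :
    ∫ x, skorokhod f x * ⟪x, m⟫ ∂(stdGaussian (EuclideanSpace ℝ ι))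
      = ∫ x, ⟪f x, m⟫ ∂(stdGaussian (EuclideanSpace ℝ ι)) := by
  have hd : Differentiable ℝ f := hf.differentiable (by norm_num)
  have hcf := hf.continuous
  have cfd : ∀ i k, Continuous fun x => fderiv ℝ f x (EuclideanSpace.single i 1) k := by
    intro i k
    have := hf.continuous_fderiv (by norm_num)
    fun_prop
  have hcd : ∀ i k, HasCompactSupport fun x => fderiv ℝ f x (EuclideanSpace.single i 1) k :=
    fun i k => (hc.fderiv_apply (𝕜 := ℝ) _).comp_left (g := fun v : EuclideanSpace ℝ ι => v k)
      (by simp)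
  have I : ∀ {g : EuclideanSpace ℝ ι → ℝ}, Continuous g → HasCompactSupport g →
      Integrable g (stdGaussian (EuclideanSpace ℝ ι)) :=
    fun hg hc => hg.integrable_of_hasCompactSupport hc
  have hin : ContDiff ℝ 1 (fun x : EuclideanSpace ℝ ι => ⟪x, m⟫) := contDiff_id.inner ℝ contDiff_const
  have e : ∀ x, skorokhod f x * ⟪x, m⟫ = ∑ i,
      (f x i * ⟪x, m⟫ * ⟪x, EuclideanSpace.single i (1 : ℝ)⟫
        - fderiv ℝ f x (EuclideanSpace.single i 1) i * ⟪x, m⟫) := by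
    intro x
    rw [skorokhod_eq_sum hd, Finset.sum_mul]
    refine Finset.sum_congr rfl fun i _ => ?_
    rw [fderiv_coord (hd _)]; ring
  have e2 : ∀ x, ⟪f x, m⟫ = ∑ i, f x i * m i := by
    intro x
    rw [PiLp.inner_apply]; simp [mul_comm]
  simp_rw [e, e2]
  have c1 : ∀ i, Continuous fun x => f x i * ⟪x, m⟫ * ⟪x, EuclideanSpace.single i (1 : ℝ)⟫ :=
    fun i => by fun_prop
  have s1 : ∀ i, HasCompactSupport fun x => f x i * ⟪x, m⟫ * ⟪x, EuclideanSpace.single i (1 : ℝ)⟫ :=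
    fun i => (hasCompactSupport_coord hc i).mul_right.mul_right
  have c2 : ∀ i, Continuous fun x => fderiv ℝ f x (EuclideanSpace.single i 1) i * ⟪x, m⟫ :=
    fun i => by have := cfd i i; fun_prop
  have i2 : ∀ i, Integrable (fun x => fderiv ℝ f x (EuclideanSpace.single i 1) i * ⟪x, m⟫)
      (stdGaussian (EuclideanSpace ℝ ι)) := fun i => I (c2 i) (hcd i i).mul_right
  have i3 : ∀ i, Integrable (fun x => f x i * m i) (stdGaussian (EuclideanSpace ℝ ι)) := fun i =>
    I (by fun_prop) (hasCompactSupport_coord hc i).mul_right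
  have i1 : ∀ i, Integrable (fun x => f x i * ⟪x, m⟫ * ⟪x, EuclideanSpace.single i (1 : ℝ)⟫
      - fderiv ℝ f x (EuclideanSpace.single i 1) i * ⟪x, m⟫) (stdGaussian (EuclideanSpace ℝ ι)) :=
    fun i => (I (c1 i) (s1 i)).sub (i2 i)
  rw [integral_finsetSum _ (fun i _ => i1 i),
    integral_finsetSum _ (fun i _ => i3 i)]
  refine Finset.sum_congr rfl fun i _ => ?_
  rw [integral_sub (I (c1 i) (s1 i)) (i2 i),
    integral_stein ((contDiff_coord hf i).mul hin) (hasCompactSupport_coord hc i).mul_right]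
  have e3 : ∀ x, fderiv ℝ (fun x => f x i * ⟪x, m⟫) x (EuclideanSpace.single i 1)
      = fderiv ℝ f x (EuclideanSpace.single i 1) i * ⟪x, m⟫ + f x i * m i := by
    intro x
    rw [fderiv_fun_mul ((contDiff_coord hf i).differentiable (by norm_num) x)
      (hin.differentiable (by norm_num) x)]
    simp only [add_apply, smul_apply, smul_eq_mul]
    rw [fderiv_inner_apply ℝ differentiableAt_fun_id (differentiableAt_const m),
      fderiv_coord (hd _)]
    simp [EuclideanSpace.inner_single_left]; ring
  simp_rw [e3]
  rw [integral_add (i2 i) (i3 i)]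
  ring

end Divergence

set_option linter.style.longLine false

/-- Cauchy–Schwarz, read off from the nonnegative integral of the squared deviation of g from its
average. -/
lemma sq_intervalIntegral_le {T : ℝ} (hT : 0 < T) {g : ℝ → ℝ} (hg : Continuous g) :
    (∫ θ in (0 : ℝ)..T, g θ) ^ 2 ≤ T * ∫ θ in (0 : ℝ)..T, g θ ^ 2 := by
  set A := ∫ θ in (0 : ℝ)..T, g θ with hA
  have h0 : 0 ≤ ∫ θ in (0 : ℝ)..T, (g θ - A / T) ^ 2 :=
    intervalIntegral.integral_nonneg hT.le fun _ _ => sq_nonneg _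
  have e : ∀ θ, (g θ - A / T) ^ 2 = g θ ^ 2 + (-(2 * (A / T)) * g θ + (A / T) ^ 2) :=
    fun θ => by ring
  simp_rw [e] at h0
  rw [intervalIntegral.integral_add (Continuous.intervalIntegrable (by fun_prop) _ _)
      (Continuous.intervalIntegrable (by fun_prop) _ _),
    intervalIntegral.integral_add (Continuous.intervalIntegrable (by fun_prop) _ _)
      (Continuous.intervalIntegrable (by fun_prop) _ _),
    intervalIntegral.integral_const_mul, intervalIntegral.integral_const, ← hA] at h0
  have : -(2 * (A / T)) * A + (T - 0) • (A / T) ^ 2 = - A ^ 2 / T := by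
    rw [smul_eq_mul]; field_simp; ring
  rw [this] at h0
  have h1 : A ^ 2 / T ≤ ∫ θ in (0 : ℝ)..T, g θ ^ 2 := by
    have : -A ^ 2 / T = -(A ^ 2 / T) := by ring
    linarith
  rwa [div_le_iff₀' hT] at h1

/-! ### Variance through an independent copy -/

section Variance

variable {Ω F : Type*} [MeasurableSpace Ω] {μ : Measure Ω} [IsProbabilityMeasure μ]
  [NormedAddCommGroup F] [InnerProductSpace ℝ F] [CompleteSpace F] {f : Ω → F}

lemma integral_norm_sub_sq (If : Integrable f μ) (I2 : Integrable (fun x => ‖f x‖ ^ 2) μ) (a : F) :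
    ∫ x, ‖f x - a‖ ^ 2 ∂μ = ∫ x, ‖f x‖ ^ 2 ∂μ + ((-2) * ⟪a, ∫ x, f x ∂μ⟫ + ‖a‖ ^ 2) := by
  have I1 : Integrable (fun x => (-2) * ⟪a, f x⟫) μ := (If.const_inner a).const_mul _
  have I3 : Integrable (fun x => (-2) * ⟪a, f x⟫ + ‖a‖ ^ 2) μ := I1.add (integrable_const _)
  have e : ∀ x, ‖f x - a‖ ^ 2 = ‖f x‖ ^ 2 + ((-2) * ⟪a, f x⟫ + ‖a‖ ^ 2) := by
    intro x; rw [norm_sub_sq_real, real_inner_comm]; ring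
  simp_rw [e]
  rw [integral_add I2 I3, integral_add I1 (integrable_const _), integral_const_mul,
    integral_inner If]
  simp

lemma integral_norm_sub_mean_sq (If : Integrable f μ) (I2 : Integrable (fun x => ‖f x‖ ^ 2) μ) :
    ∫ x, ‖f x - ∫ z, f z ∂μ‖ ^ 2 ∂μ = ∫ x, ‖f x‖ ^ 2 ∂μ - ‖∫ z, f z ∂μ‖ ^ 2 := by
  rw [integral_norm_sub_sq If I2, real_inner_self_eq_norm_sq]
  ring

lemma integral_integral_norm_sub_sq (If : Integrable f μ)
    (I2 : Integrable (fun x => ‖f x‖ ^ 2) μ) :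
    ∫ x, ∫ y, ‖f y - f x‖ ^ 2 ∂μ ∂μ = 2 * ∫ x, ‖f x - ∫ z, f z ∂μ‖ ^ 2 ∂μ := by
  rw [integral_norm_sub_mean_sq If I2]
  have e : ∀ x, ∫ y, ‖f y - f x‖ ^ 2 ∂μ
      = ∫ y, ‖f y‖ ^ 2 ∂μ + ((-2) * ⟪∫ z, f z ∂μ, f x⟫ + ‖f x‖ ^ 2) := by
    intro x; rw [integral_norm_sub_sq If I2, real_inner_comm]
  simp_rw [e]
  have I1 : Integrable (fun x => (-2) * ⟪∫ z, f z ∂μ, f x⟫) μ := (If.const_inner _).const_mul _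
  have I3 : Integrable (fun x => (-2) * ⟪∫ z, f z ∂μ, f x⟫ + ‖f x‖ ^ 2) μ := I1.add I2
  rw [integral_add (integrable_const _) I3, integral_add I1 I2, integral_const_mul,
    integral_inner If, real_inner_self_eq_norm_sq]
  simp
  ring

end Variance

/-! ### Gaussian Poincaré inequality by rotation -/

section Poincare

variable {ι κ : Type*} [Fintype ι] [DecidableEq ι] [Fintype κ]
  {f : EuclideanSpace ℝ ι → EuclideanSpace ℝ κ}

/-- A quarter turn moves p.1 to p.2, and the velocity of the path is the second component of the
rotated pair. Integrate the derivative of f along it and apply Cauchy–Schwarz in the angle. -/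
lemma norm_sub_sq_le_rotation (hf : ContDiff ℝ 1 f) (p : EuclideanSpace ℝ ι × EuclideanSpace ℝ ι) :
    ‖f p.2 - f p.1‖ ^ 2 ≤ π / 2 * ∫ θ in (0 : ℝ)..(π / 2),
      ‖fderiv ℝ f (ContinuousLinearMap.rotation θ p).1 (ContinuousLinearMap.rotation θ p).2‖ ^ 2 := by
  have hcd := hf.continuous_fderiv (by norm_num)
  have c1 : Continuous fun θ : ℝ => fderiv ℝ f (ContinuousLinearMap.rotation θ p).1 (ContinuousLinearMap.rotation θ p).2 := by
    simp only [ContinuousLinearMap.rotation_apply]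
    exact (hcd.comp (by fun_prop)).clm_apply (by fun_prop)
  have hder : ∀ θ : ℝ, HasDerivAt (fun θ : ℝ => f (ContinuousLinearMap.rotation θ p).1)
      (fderiv ℝ f (ContinuousLinearMap.rotation θ p).1 (ContinuousLinearMap.rotation θ p).2) θ := by
    intro θ
    have h1 : HasDerivAt (fun θ : ℝ => (ContinuousLinearMap.rotation θ p).1) (ContinuousLinearMap.rotation θ p).2 θ := by
      simp only [ContinuousLinearMap.rotation_apply]
      exact ((Real.hasDerivAt_cos θ).smul_const p.1).add ((Real.hasDerivAt_sin θ).smul_const p.2)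
    exact ((hf.differentiable (by norm_num) _).hasFDerivAt).comp_hasDerivAt θ h1
  have h := intervalIntegral.integral_eq_sub_of_hasDerivAt (a := 0) (b := π / 2)
    (fun θ _ => hder θ) (c1.intervalIntegrable _ _)
  have e : f p.2 - f p.1 = ∫ θ in (0 : ℝ)..(π / 2),
      fderiv ℝ f (ContinuousLinearMap.rotation θ p).1 (ContinuousLinearMap.rotation θ p).2 := by
    rw [h]; simp [ContinuousLinearMap.rotation_apply]
  rw [e]
  calc _ ≤ (∫ θ in (0 : ℝ)..(π / 2), ‖fderiv ℝ f (ContinuousLinearMap.rotation θ p).1 (ContinuousLinearMap.rotation θ p).2‖) ^ 2 := by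
        gcongr
        exact intervalIntegral.norm_integral_le_integral_norm (by positivity)
    _ ≤ _ := sq_intervalIntegral_le (by positivity) c1.norm

/-- Every rotated pair is again a pair of independent standard Gaussians, so the inner integral does
not depend on the angle. Integrating the second component turns the squared derivative into the
Frobenius norm. Lower integrals spare an integrability argument on the product with the angles. -/
lemma lintegral_norm_sub_sq_le (hf : ContDiff ℝ 1 f) :
    ∫⁻ p, ENNReal.ofReal (‖f p.2 - f p.1‖ ^ 2)
        ∂((stdGaussian (EuclideanSpace ℝ ι)).prod (stdGaussian (EuclideanSpace ℝ ι)))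
      ≤ ENNReal.ofReal (π ^ 2 / 4) *
        ∫⁻ x, ENNReal.ofReal (frobSq (fderiv ℝ f x)) ∂(stdGaussian (EuclideanSpace ℝ ι)) := by
  set μ := stdGaussian (EuclideanSpace ℝ ι)
  have hcd := hf.continuous_fderiv (by norm_num)
  set F : EuclideanSpace ℝ ι × EuclideanSpace ℝ ι → ENNReal :=
    fun q => ENNReal.ofReal (‖fderiv ℝ f q.1 q.2‖ ^ 2) with hF
  have cF : Measurable F := by
    apply Measurable.ennreal_ofReal
    exact (((hcd.comp continuous_fst).clm_apply continuous_snd).norm.pow 2).measurable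
  have crot : Measurable fun z : (EuclideanSpace ℝ ι × EuclideanSpace ℝ ι) × ℝ =>
      ContinuousLinearMap.rotation z.2 z.1 := by
    simp only [ContinuousLinearMap.rotation_apply]
    exact Continuous.measurable (by fun_prop)
  have step : ∀ p, ENNReal.ofReal (‖f p.2 - f p.1‖ ^ 2) ≤
      ENNReal.ofReal (π / 2) * ∫⁻ θ in Set.Ioc 0 (π / 2), F (ContinuousLinearMap.rotation θ p) := by
    intro p
    have c1 : Continuous fun θ : ℝ => ‖fderiv ℝ f (ContinuousLinearMap.rotation θ p).1 (ContinuousLinearMap.rotation θ p).2‖ ^ 2 := by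
      simp only [ContinuousLinearMap.rotation_apply]
      exact ((hcd.comp (by fun_prop)).clm_apply (by fun_prop)).norm.pow 2
    refine (ENNReal.ofReal_le_ofReal (norm_sub_sq_le_rotation hf p)).trans ?_
    rw [ENNReal.ofReal_mul (by positivity), intervalIntegral.integral_of_le (by positivity),
      ofReal_integral_eq_lintegral_ofReal]
    · exact (c1.intervalIntegrable 0 (π / 2)).1
    · exact ae_of_all _ fun _ => sq_nonneg _
  calc _ ≤ ∫⁻ p, (ENNReal.ofReal (π / 2) *
        ∫⁻ θ in Set.Ioc 0 (π / 2), F (ContinuousLinearMap.rotation θ p)) ∂(μ.prod μ) :=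
        lintegral_mono step
    _ = ENNReal.ofReal (π / 2) * ∫⁻ p, (∫⁻ θ in Set.Ioc 0 (π / 2),
        F (ContinuousLinearMap.rotation θ p)) ∂(μ.prod μ) := by
        rw [lintegral_const_mul]
        exact (cF.comp crot).lintegral_prod_right'
    _ = ENNReal.ofReal (π / 2) * ∫⁻ θ in Set.Ioc 0 (π / 2),
        ∫⁻ p, F (ContinuousLinearMap.rotation θ p) ∂(μ.prod μ) := by
        rw [lintegral_lintegral_swap]
        exact (cF.comp crot).aemeasurable
    _ = ENNReal.ofReal (π / 2) * ∫⁻ θ in Set.Ioc 0 (π / 2), ∫⁻ p, F p ∂(μ.prod μ) := by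
        congr 2
        ext θ
        rw [← lintegral_map cF (ContinuousLinearMap.rotation θ).continuous.measurable,
          IsGaussian.map_rotation_eq_self (by simp [μ])]
    _ = ENNReal.ofReal (π ^ 2 / 4) * ∫⁻ p, F p ∂(μ.prod μ) := by
        rw [lintegral_const, Measure.restrict_apply_univ, Real.volume_Ioc, mul_comm _ (ENNReal.ofReal _),
          ← mul_assoc, ← ENNReal.ofReal_mul (by positivity)]
        congr 2; ring
    _ = _ := by
        rw [lintegral_prod _ cF.aemeasurable]
        congr 2
        ext x
        rw [← integral_norm_sq_clm_stdGaussian, ofReal_integral_eq_lintegral_ofReal]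
        · refine (integrable_norm_sq_stdGaussian.const_mul (‖fderiv ℝ f x‖ ^ 2)).mono'
            (Continuous.aestronglyMeasurable (by fun_prop)) (ae_of_all _ fun y => ?_)
          rw [Real.norm_of_nonneg (sq_nonneg _), ← mul_pow]
          gcongr
          exact (fderiv ℝ f x).le_opNorm y
        · exact ae_of_all _ fun _ => sq_nonneg _

/-- The Gaussian Poincaré inequality, up to the constant, in the smooth compactly supported case. -/
lemma integral_norm_sub_mean_sq_le_of_contDiff (hf : ContDiff ℝ 1 f) (hc : HasCompactSupport f) :
    ∫ x, ‖f x - ∫ z, f z ∂(stdGaussian (EuclideanSpace ℝ ι))‖ ^ 2 ∂(stdGaussian (EuclideanSpace ℝ ι))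
      ≤ 2 * ∫ x, frobSq (fderiv ℝ f x) ∂(stdGaussian (EuclideanSpace ℝ ι)) := by
  have hcd := hf.continuous_fderiv (by norm_num)
  have hcf := hf.continuous
  have If : Integrable f (stdGaussian (EuclideanSpace ℝ ι)) :=
    hf.continuous.integrable_of_hasCompactSupport hc
  obtain ⟨C, hC⟩ := hf.continuous.bounded_above_of_compact_support hc
  have I2 : Integrable (fun x => ‖f x‖ ^ 2) (stdGaussian (EuclideanSpace ℝ ι)) := by
    refine (integrable_const (C ^ 2)).mono' (Continuous.aestronglyMeasurable (by fun_prop))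
      (ae_of_all _ fun p => ?_)
    rw [Real.norm_of_nonneg (sq_nonneg _)]
    gcongr
    exact hC p
  have c3 : Continuous (fun x => frobSq (fderiv ℝ f x)) := continuous_frobSq.comp hcd
  have h3 : HasCompactSupport (fun x => frobSq (fderiv ℝ f x)) :=
    (hc.fderiv (𝕜 := ℝ)).comp_left (g := frobSq) (by simp [frobSq])
  have I3 : Integrable (fun x => frobSq (fderiv ℝ f x)) (stdGaussian (EuclideanSpace ℝ ι)) :=
    c3.integrable_of_hasCompactSupport h3
  have Iprod : Integrable (fun p : EuclideanSpace ℝ ι × EuclideanSpace ℝ ι => ‖f p.2 - f p.1‖ ^ 2)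
      ((stdGaussian (EuclideanSpace ℝ ι)).prod (stdGaussian (EuclideanSpace ℝ ι))) := by
    refine (integrable_const ((2 * C) ^ 2)).mono' (Continuous.aestronglyMeasurable (by fun_prop))
      (ae_of_all _ fun p => ?_)
    rw [Real.norm_of_nonneg (sq_nonneg _)]
    gcongr
    linarith [norm_sub_le (f p.2) (f p.1), hC p.1, hC p.2]
  have h0 : 0 ≤ ∫ x, frobSq (fderiv ℝ f x) ∂(stdGaussian (EuclideanSpace ℝ ι)) :=
    integral_nonneg fun _ => frobSq_nonneg _
  have h := lintegral_norm_sub_sq_le hf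
  rw [← ofReal_integral_eq_lintegral_ofReal Iprod (ae_of_all _ fun _ => sq_nonneg _),
    ← ofReal_integral_eq_lintegral_ofReal I3 (ae_of_all _ fun _ => frobSq_nonneg _),
    ← ENNReal.ofReal_mul (by positivity),
    ENNReal.ofReal_le_ofReal_iff (mul_nonneg (by positivity) h0), integral_prod _ Iprod,
    integral_integral_norm_sub_sq If I2] at h
  -- The independent copy gives twice the variance, so the constant obtained is π²/8; it is rounded
  -- up to 2.
  have hpi : π ^ 2 / 4 ≤ 4 := by nlinarith [Real.pi_pos, Real.pi_lt_four]
  nlinarith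

end Poincare

/-! ### Linear approximation of the Gaussian divergence -/

section Divergence

variable {ι : Type*} [Fintype ι] [DecidableEq ι]
  {f : EuclideanSpace ℝ ι → EuclideanSpace ℝ ι}

lemma sum_mul_transpose_le_frobSq (A : EuclideanSpace ℝ ι →L[ℝ] EuclideanSpace ℝ ι) :
    ∑ i, ∑ k, A (EuclideanSpace.single k 1) i * A (EuclideanSpace.single i 1) k ≤ frobSq A := by
  have h : frobSq A = ∑ i, ∑ k, A (EuclideanSpace.single i 1) k ^ 2 := by
    simp_rw [frobSq, EuclideanSpace.real_norm_sq_eq]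
  have h' : frobSq A = ∑ i, ∑ k, A (EuclideanSpace.single k 1) i ^ 2 := by
    rw [h, Finset.sum_comm]
  have : 2 * ∑ i, ∑ k, A (EuclideanSpace.single k 1) i * A (EuclideanSpace.single i 1) k
      ≤ frobSq A + frobSq A := by
    nth_rw 1 [h]
    rw [h', Finset.mul_sum, ← Finset.sum_add_distrib]
    refine Finset.sum_le_sum fun i _ => ?_
    rw [Finset.mul_sum, ← Finset.sum_add_distrib]
    refine Finset.sum_le_sum fun k _ => ?_
    nlinarith [sq_nonneg (A (EuclideanSpace.single k 1) i - A (EuclideanSpace.single i 1) k)]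
  linarith

/-- The square expands to E ‖f‖² + E tr((∇f)²) - 2 ‖m‖² + ‖m‖². Here E ‖f‖² - ‖m‖² is the variance,
at most twice the energy by Poincaré, and tr((∇f)²) is at most the squared Frobenius norm: 2 + 1 =
3. -/
lemma integral_skorokhod_sub_sq_le_of_contDiff (hf : ContDiff ℝ 2 f) (hc : HasCompactSupport f) :
    ∫ x, (skorokhod f x - ⟪x, ∫ z, f z ∂(stdGaussian (EuclideanSpace ℝ ι))⟫) ^ 2
        ∂(stdGaussian (EuclideanSpace ℝ ι))
      ≤ 3 * ∫ x, frobSq (fderiv ℝ f x) ∂(stdGaussian (EuclideanSpace ℝ ι)) := by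
  have hf1 : ContDiff ℝ 1 f := hf.of_le (by norm_num)
  have hcd := hf1.continuous_fderiv (by norm_num)
  have cS := continuous_skorokhod hf1
  have sS := hasCompactSupport_skorokhod hc
  set m := ∫ z, f z ∂(stdGaussian (EuclideanSpace ℝ ι)) with hm
  have hcf := hf.continuous
  have c00 : Continuous (fun x => ‖f x‖ ^ 2) := by fun_prop
  have s00 : HasCompactSupport (fun x => ‖f x‖ ^ 2) :=
    hc.comp_left (g := fun v : EuclideanSpace ℝ ι => ‖v‖ ^ 2) (by simp)
  have c1 : Continuous (fun x => skorokhod f x ^ 2) := by fun_prop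
  have s1 : HasCompactSupport (fun x => skorokhod f x ^ 2) :=
    sS.comp_left (g := fun t : ℝ => t ^ 2) (by simp)
  have cT : Continuous (fun x => ∑ i, ∑ k, fderiv ℝ f x (EuclideanSpace.single k 1) i *
      fderiv ℝ f x (EuclideanSpace.single i 1) k) := by fun_prop
  have sT : HasCompactSupport (fun x => ∑ i, ∑ k, fderiv ℝ f x (EuclideanSpace.single k 1) i *
      fderiv ℝ f x (EuclideanSpace.single i 1) k) :=
    (hc.fderiv (𝕜 := ℝ)).comp_left
      (g := fun A : EuclideanSpace ℝ ι →L[ℝ] EuclideanSpace ℝ ι =>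
        ∑ i, ∑ k, A (EuclideanSpace.single k 1) i * A (EuclideanSpace.single i 1) k) (by simp)
  have I0 : Integrable f (stdGaussian (EuclideanSpace ℝ ι)) :=
    hf.continuous.integrable_of_hasCompactSupport hc
  have I00 : Integrable (fun x => ‖f x‖ ^ 2) (stdGaussian (EuclideanSpace ℝ ι)) :=
    c00.integrable_of_hasCompactSupport s00
  have I1 : Integrable (fun x => skorokhod f x ^ 2) (stdGaussian (EuclideanSpace ℝ ι)) :=
    c1.integrable_of_hasCompactSupport s1
  have I2 : Integrable (fun x => skorokhod f x * ⟪x, m⟫) (stdGaussian (EuclideanSpace ℝ ι)) := by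
    have : Continuous fun x => skorokhod f x * ⟪x, m⟫ := by fun_prop
    exact this.integrable_of_hasCompactSupport sS.mul_right
  have I2' : Integrable (fun x => (-2) * (skorokhod f x * ⟪x, m⟫))
      (stdGaussian (EuclideanSpace ℝ ι)) := I2.const_mul _
  have I3 := integrable_inner_sq_stdGaussian m
  have I4 : Integrable (fun x => (-2) * (skorokhod f x * ⟪x, m⟫) + ⟪x, m⟫ ^ 2)
      (stdGaussian (EuclideanSpace ℝ ι)) := I2'.add I3
  have cF : Continuous (fun x => frobSq (fderiv ℝ f x)) := continuous_frobSq.comp hcd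
  have sF : HasCompactSupport (fun x => frobSq (fderiv ℝ f x)) :=
    (hc.fderiv (𝕜 := ℝ)).comp_left (g := frobSq) (by simp [frobSq])
  have IF : Integrable (fun x => frobSq (fderiv ℝ f x)) (stdGaussian (EuclideanSpace ℝ ι)) :=
    cF.integrable_of_hasCompactSupport sF
  have e : ∀ x, (skorokhod f x - ⟪x, m⟫) ^ 2
      = skorokhod f x ^ 2 + ((-2) * (skorokhod f x * ⟪x, m⟫) + ⟪x, m⟫ ^ 2) := fun x => by ring
  simp_rw [e]
  rw [integral_add I1 I4, integral_add I2' I3, integral_const_mul,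
    integral_skorokhod_mul_inner hf1 hc, integral_inner_sq_stdGaussian,
    integral_skorokhod_sq hf hc]
  have e2 : ∫ x, ⟪f x, m⟫ ∂(stdGaussian (EuclideanSpace ℝ ι)) = ‖m‖ ^ 2 := by
    simp_rw [real_inner_comm m]
    rw [integral_inner I0, real_inner_self_eq_norm_sq]
  rw [e2]
  have hP := integral_norm_sub_mean_sq_le_of_contDiff hf1 hc
  rw [integral_norm_sub_mean_sq I0 I00, ← hm] at hP
  have hT : ∫ x, ∑ i, ∑ k, fderiv ℝ f x (EuclideanSpace.single k 1) i *
      fderiv ℝ f x (EuclideanSpace.single i 1) k ∂(stdGaussian (EuclideanSpace ℝ ι))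
      ≤ ∫ x, frobSq (fderiv ℝ f x) ∂(stdGaussian (EuclideanSpace ℝ ι)) := by
    exact integral_mono (cT.integrable_of_hasCompactSupport sT) IF
      fun x => sum_mul_transpose_le_frobSq _
  linarith

end Divergence

/-! ### Mollification of Lipschitz fields -/

section Mollify

open scoped Convolution NNReal

variable {E F : Type*} [NormedAddCommGroup E] [InnerProductSpace ℝ E] [FiniteDimensional ℝ E]
  [MeasurableSpace E] [BorelSpace E] [NormedAddCommGroup F] [NormedSpace ℝ F]
  [FiniteDimensional ℝ F] [MeasurableSpace F] [BorelSpace F] {f : E → F} {C : ℝ≥0}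

/-- The derivative is put on f rather than on the bump: by Rademacher f is differentiable almost
everywhere, and the Lipschitz bound dominates the difference quotients. -/
lemma hasFDerivAt_normed_convolution (φ : ContDiffBump (0 : E)) (hf : LipschitzWith C f)
    (x : E) :
    HasFDerivAt (φ.normed volume ⋆[lsmul ℝ ℝ, volume] f)
      ((φ.normed volume ⋆[lsmul ℝ ℝ, volume] (fderiv ℝ f)) x) x := by
  have hφ : Continuous (φ.normed (volume : Measure E)) := φ.continuous_normed
  have sφ : HasCompactSupport (φ.normed (volume : Measure E)) := φ.hasCompactSupport_normed
  have iφ : Integrable (φ.normed (volume : Measure E)) := hφ.integrable_of_hasCompactSupport sφ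
  have hcf := hf.continuous
  have h : (φ.normed volume ⋆[lsmul ℝ ℝ, volume] f)
      = fun x => ∫ t, φ.normed volume t • f (x - t) := by
    ext x; simp [convolution_def]
  have h' : ((φ.normed volume ⋆[lsmul ℝ ℝ, volume] (fderiv ℝ f)) x)
      = ∫ t, φ.normed volume t • fderiv ℝ f (x - t) := by
    simp [convolution_def]
  rw [h, h']
  have hcont : ∀ y, Continuous fun t => φ.normed volume t • f (y - t) := fun y => by fun_prop
  refine (hasFDerivAt_integral_of_dominated_loc_of_lip' (s := Set.univ)
    (F := fun x t => φ.normed volume t • f (x - t))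
    (F' := fun t => φ.normed volume t • fderiv ℝ f (x - t))
    (bound := fun t => φ.normed volume t * C) univ_mem ?_ ?_ ?_ ?_ ?_ ?_).2
  · exact fun y _ => (hcont y).aestronglyMeasurable
  · exact (hcont x).integrable_of_hasCompactSupport sφ.smul_right
  · have hm : Measurable fun t => fderiv ℝ f (x - t) :=
      (measurable_fderiv ℝ f).comp (measurable_const.sub measurable_id)
    exact hφ.aestronglyMeasurable.smul hm.aestronglyMeasurable
  · refine ae_of_all _ fun t y _ => ?_
    rw [← smul_sub, norm_smul, Real.norm_of_nonneg (φ.nonneg_normed t), mul_assoc]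
    gcongr
    · exact φ.nonneg_normed t
    · have := hf.dist_le_mul (y - t) (x - t)
      simpa [dist_eq_norm] using this
  · exact iφ.mul_const _
  · have h1 : ∀ᵐ t : E, DifferentiableAt ℝ f (x - t) :=
      (Measure.measurePreserving_sub_left volume x).quasiMeasurePreserving.ae hf.ae_differentiableAt
    filter_upwards [h1] with t ht
    have := (ht.hasFDerivAt.comp x ((hasFDerivAt_id x).sub_const t)).const_smul
      (φ.normed (volume : Measure E) t)
    simpa [Function.comp_def, Pi.smul_def] using this

lemma norm_normed_convolution_le {G : Type*} [NormedAddCommGroup G] [NormedSpace ℝ G]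
    (φ : ContDiffBump (0 : E)) {g : E → G} {B : ℝ} (hg : ∀ x, ‖g x‖ ≤ B) (x : E) :
    ‖(φ.normed volume ⋆[lsmul ℝ ℝ, volume] g) x‖ ≤ B := by
  have hφ : Continuous (φ.normed (volume : Measure E)) := φ.continuous_normed
  have sφ : HasCompactSupport (φ.normed (volume : Measure E)) := φ.hasCompactSupport_normed
  have iφ : Integrable (φ.normed (volume : Measure E)) := hφ.integrable_of_hasCompactSupport sφ
  rw [convolution_def]
  refine (norm_integral_le_of_norm_le (iφ.mul_const B) (ae_of_all _ fun t => ?_)).trans ?_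
  · rw [lsmul_apply, norm_smul, Real.norm_of_nonneg (φ.nonneg_normed t)]
    gcongr
    · exact φ.nonneg_normed t
    · exact hg _
  · rw [integral_mul_const, φ.integral_normed, one_mul]

/-- Since the derivative of the mollification is the mollification of the derivative, the Lipschitz
bound is inherited and the derivatives converge almost everywhere by Lebesgue differentiation. -/
lemma exists_smooth_approximation (hf : LipschitzWith C f) (hc : HasCompactSupport f) {M : ℝ}
    (hM : ∀ x, ‖f x‖ ≤ M) :
    ∃ g : ℕ → E → F, (∀ k, ContDiff ℝ 2 (g k)) ∧ (∀ k, HasCompactSupport (g k)) ∧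
      (∀ k x, ‖g k x‖ ≤ M) ∧ (∀ k x, ‖fderiv ℝ (g k) x‖ ≤ C) ∧
      (∀ x, Tendsto (fun k => g k x) atTop (𝓝 (f x))) ∧
      (∀ᵐ x, Tendsto (fun k => fderiv ℝ (g k) x) atTop (𝓝 (fderiv ℝ f x))) := by
  let φ : ℕ → ContDiffBump (0 : E) := fun k =>
    { rIn := 1 / ((k : ℝ) + 1), rOut := 2 * (1 / ((k : ℝ) + 1)), rIn_pos := by positivity,
      rIn_lt_rOut := by
        have : (0 : ℝ) < 1 / ((k : ℝ) + 1) := by positivity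
        linarith }
  have hφ : Tendsto (fun k => (φ k).rOut) atTop (𝓝 0) := by
    have := (tendsto_one_div_add_atTop_nhds_zero_nat (𝕜 := ℝ)).const_mul 2
    simpa [φ] using this
  have hLI : LocallyIntegrable f volume := hf.continuous.locallyIntegrable
  have hd : ∀ x, ‖fderiv ℝ f x‖ ≤ C := fun x => norm_fderiv_le_of_lipschitz ℝ hf
  have hLI' : LocallyIntegrable (fderiv ℝ f) (volume : Measure E) := by
    have h1 : LocallyIntegrable (fun _ : E => (C : ℝ)) (volume : Measure E) :=
      locallyIntegrable_const _
    exact h1.mono (measurable_fderiv ℝ f).aestronglyMeasurable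
      (ae_of_all _ fun x => (hd x).trans (le_abs_self _))
  have hfd : ∀ k x, fderiv ℝ ((φ k).normed volume ⋆[lsmul ℝ ℝ, volume] f) x
      = ((φ k).normed volume ⋆[lsmul ℝ ℝ, volume] (fderiv ℝ f)) x :=
    fun k x => (hasFDerivAt_normed_convolution (φ k) hf x).fderiv
  refine ⟨fun k => (φ k).normed volume ⋆[lsmul ℝ ℝ, volume] f, fun k => ?_, fun k => ?_,
    fun k x => norm_normed_convolution_le (φ k) hM x, fun k x => ?_, fun x => ?_, ?_⟩
  · exact (φ k).hasCompactSupport_normed.contDiff_convolution_left _ (φ k).contDiff_normed hLI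
  · exact HasCompactSupport.convolution _ (φ k).hasCompactSupport_normed hc
  · rw [hfd]; exact norm_normed_convolution_le (φ k) hd x
  · exact ContDiffBump.convolution_tendsto_right_of_continuous hφ hf.continuous x
  · simp_rw [hfd]
    exact ContDiffBump.ae_convolution_tendsto_right_of_locallyIntegrable (K := 2) hφ
      (Eventually.of_forall fun k => le_rfl) hLI'

end Mollify

/-! ### The two Gaussian inequalities for Lipschitz fields -/

section Lipschitz

open scoped NNReal

variable {ι : Type*} [Fintype ι] [DecidableEq ι]

lemma abs_clmTrace_le (A : EuclideanSpace ℝ ι →L[ℝ] EuclideanSpace ℝ ι) :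
    |clmTrace A| ≤ Fintype.card ι * ‖A‖ := by
  refine (Finset.abs_sum_le_sum_abs _ _).trans ?_
  rw [← Finset.card_univ, ← nsmul_eq_mul]
  refine Finset.sum_le_card_nsmul _ _ _ fun i _ => ?_
  refine (PiLp.norm_apply_le (A (EuclideanSpace.single i 1)) i).trans ?_
  simpa using A.le_opNorm (EuclideanSpace.single i 1)

lemma frobSq_le {F : Type*} [NormedAddCommGroup F] [NormedSpace ℝ F]
    (A : EuclideanSpace ℝ ι →L[ℝ] F) : frobSq A ≤ Fintype.card ι * ‖A‖ ^ 2 := by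
  rw [frobSq, ← Finset.card_univ, ← nsmul_eq_mul]
  refine Finset.sum_le_card_nsmul _ _ _ fun i _ => ?_
  gcongr
  simpa using A.le_opNorm (EuclideanSpace.single i 1)

variable {f : EuclideanSpace ℝ ι → EuclideanSpace ℝ ι} {C : ℝ≥0}

/-- Both inequalities pass to the limit along the mollifications by dominated convergence. The
Lipschitz case is needed because the estimator is only a Lipschitz function of the data, locally. -/
theorem gaussian_poincare_of_lipschitz (hf : LipschitzWith C f) (hc : HasCompactSupport f) :
    ∫ x, ‖f x - ∫ z, f z ∂(stdGaussian (EuclideanSpace ℝ ι))‖ ^ 2 ∂(stdGaussian (EuclideanSpace ℝ ι))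
      ≤ 2 * ∫ x, frobSq (fderiv ℝ f x) ∂(stdGaussian (EuclideanSpace ℝ ι)) ∧
    ∫ x, (skorokhod f x - ⟪x, ∫ z, f z ∂(stdGaussian (EuclideanSpace ℝ ι))⟫) ^ 2
        ∂(stdGaussian (EuclideanSpace ℝ ι))
      ≤ 3 * ∫ x, frobSq (fderiv ℝ f x) ∂(stdGaussian (EuclideanSpace ℝ ι)) := by
  obtain ⟨M, hM⟩ := hf.continuous.bounded_above_of_compact_support hc
  obtain ⟨g, g2, gc, gM, gC, gt, gdt⟩ := exists_smooth_approximation hf hc hM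
  have gdt' := stdGaussian_absolutelyContinuous.ae_le gdt
  have hM0 : 0 ≤ M := (norm_nonneg _).trans (hM 0)
  have hm : Tendsto (fun k => ∫ z, g k z ∂(stdGaussian (EuclideanSpace ℝ ι))) atTop
      (𝓝 (∫ z, f z ∂(stdGaussian (EuclideanSpace ℝ ι)))) :=
    tendsto_integral_of_dominated_convergence (fun _ => M)
      (fun k => (g2 k).continuous.aestronglyMeasurable) (integrable_const _)
      (fun k => ae_of_all _ (gM k)) (ae_of_all _ gt)
  have hmM : ∀ k, ‖∫ z, g k z ∂(stdGaussian (EuclideanSpace ℝ ι))‖ ≤ M := fun k => by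
    have := norm_integral_le_of_norm_le_const (μ := stdGaussian (EuclideanSpace ℝ ι))
      (ae_of_all _ (gM k))
    simpa using this
  have cfd : ∀ k, Continuous (fderiv ℝ (g k)) := fun k => (g2 k).continuous_fderiv (by norm_num)
  have hF : Tendsto (fun k => ∫ x, frobSq (fderiv ℝ (g k) x) ∂(stdGaussian (EuclideanSpace ℝ ι)))
      atTop (𝓝 (∫ x, frobSq (fderiv ℝ f x) ∂(stdGaussian (EuclideanSpace ℝ ι)))) := by
    refine tendsto_integral_of_dominated_convergence (fun _ => Fintype.card ι * (C : ℝ) ^ 2)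
      (fun k => (continuous_frobSq.comp (cfd k)).aestronglyMeasurable) (integrable_const _)
      (fun k => ae_of_all _ fun x => ?_) ?_
    · rw [Real.norm_of_nonneg (frobSq_nonneg _)]
      refine (frobSq_le _).trans ?_
      gcongr
      exact gC k x
    · filter_upwards [gdt'] with x hx
      exact (continuous_frobSq.tendsto _).comp hx
  constructor
  · refine le_of_tendsto_of_tendsto' ?_ (hF.const_mul 2) fun k =>
      integral_norm_sub_mean_sq_le_of_contDiff ((g2 k).of_le (by norm_num)) (gc k)
    refine tendsto_integral_of_dominated_convergence (fun _ => (2 * M) ^ 2)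
      (fun k => ?_) (integrable_const _) (fun k => ae_of_all _ fun x => ?_) (ae_of_all _ fun x => ?_)
    · have := (g2 k).continuous
      exact Continuous.aestronglyMeasurable (by fun_prop)
    · rw [Real.norm_of_nonneg (sq_nonneg _)]
      gcongr
      exact (norm_sub_le _ _).trans (by linarith [gM k x, hmM k])
    · exact (((gt x).sub hm).norm.pow 2)
  · refine le_of_tendsto_of_tendsto' ?_ (hF.const_mul 3) fun k =>
      integral_skorokhod_sub_sq_le_of_contDiff (g2 k) (gc k)
    refine tendsto_integral_of_dominated_convergence
      -- The difference is at most 2 M ‖x‖ plus the dimension times C; the dominating function is (a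
      -- + b)² ≤ 2 a² + 2 b².
      (fun x => 8 * M ^ 2 * ‖x‖ ^ 2 + 2 * (Fintype.card ι * (C : ℝ)) ^ 2)
      (fun k => ?_) ((integrable_norm_sq_stdGaussian.const_mul _).add (integrable_const _))
      (fun k => ae_of_all _ fun x => ?_) ?_
    · have := continuous_skorokhod ((g2 k).of_le (by norm_num))
      exact Continuous.aestronglyMeasurable (by fun_prop)
    · rw [Real.norm_of_nonneg (sq_nonneg _), ← sq_abs]
      have h1 : |⟪g k x, x⟫| ≤ M * ‖x‖ := (abs_real_inner_le_norm _ _).trans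
        (mul_le_mul_of_nonneg_right (gM k x) (norm_nonneg _))
      have h2 : |clmTrace (fderiv ℝ (g k) x)| ≤ Fintype.card ι * C := (abs_clmTrace_le _).trans
        (mul_le_mul_of_nonneg_left (gC k x) (Nat.cast_nonneg _))
      have h3 : |⟪x, ∫ z, g k z ∂(stdGaussian (EuclideanSpace ℝ ι))⟫| ≤ M * ‖x‖ := by
        refine (abs_real_inner_le_norm _ _).trans ?_
        rw [mul_comm]
        exact mul_le_mul_of_nonneg_right (hmM k) (norm_nonneg _)
      have h4 : |skorokhod (g k) x - ⟪x, ∫ z, g k z ∂(stdGaussian (EuclideanSpace ℝ ι))⟫|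
          ≤ 2 * (M * ‖x‖) + Fintype.card ι * C := by
        rw [skorokhod]
        rw [abs_le] at *
        constructor <;> linarith [h1.1, h1.2, h2.1, h2.2, h3.1, h3.2]
      refine (pow_le_pow_left₀ (abs_nonneg _) h4 2).trans ?_
      nlinarith [sq_nonneg (2 * (M * ‖x‖) - Fintype.card ι * C)]
    · filter_upwards [gdt'] with x hx
      have h1 : Tendsto (fun k => ⟪g k x, x⟫) atTop (𝓝 ⟪f x, x⟫) :=
        (gt x).inner tendsto_const_nhds
      have h2 := (continuous_clmTrace.tendsto (fderiv ℝ f x)).comp hx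
      exact ((h1.sub h2).sub (tendsto_const_nhds.inner hm)).pow 2

end Lipschitz

/-! ### Matrices acting on Euclidean vectors -/

section Act

variable {n p : ℕ}

/-- The action of a matrix on Euclidean vectors. -/
noncomputable def act (X : Matrix (Fin n) (Fin p) ℝ) :
    EuclideanSpace ℝ (Fin p) →L[ℝ] EuclideanSpace ℝ (Fin n) :=
  LinearMap.toContinuousLinearMap
    { toFun := fun b => WithLp.toLp 2 (X *ᵥ b.ofLp)
      map_add' := fun a b => by ext i; simp [Matrix.mulVec_add]
      map_smul' := fun c b => by ext i; simp [Matrix.mulVec_smul] }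

lemma act_apply (X : Matrix (Fin n) (Fin p) ℝ) (b : EuclideanSpace ℝ (Fin p)) :
    act X b = WithLp.toLp 2 (X *ᵥ b.ofLp) := rfl

lemma act_sub_left (X Y : Matrix (Fin n) (Fin p) ℝ) (b : EuclideanSpace ℝ (Fin p)) :
    act (X - Y) b = act X b - act Y b := by
  ext i; simp [act_apply, Matrix.sub_mulVec]

lemma act_add_left (X Y : Matrix (Fin n) (Fin p) ℝ) (b : EuclideanSpace ℝ (Fin p)) :
    act (X + Y) b = act X b + act Y b := by
  ext i; simp [act_apply, Matrix.add_mulVec]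

lemma act_zero_left (b : EuclideanSpace ℝ (Fin p)) :
    act (0 : Matrix (Fin n) (Fin p) ℝ) b = 0 := by
  ext i; simp [act_apply]

lemma inner_act (X : Matrix (Fin n) (Fin p) ℝ) (u : EuclideanSpace ℝ (Fin n))
    (b : EuclideanSpace ℝ (Fin p)) : ⟪u, act X b⟫ = ⟪act Xᵀ u, b⟫ := by
  rw [EuclideanSpace.inner_eq_star_dotProduct, EuclideanSpace.inner_eq_star_dotProduct, act_apply,
    act_apply]
  simp only [star_trivial, Matrix.mulVec_transpose]
  rw [dotProduct_comm, Matrix.dotProduct_mulVec, dotProduct_comm]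

lemma continuous_act : Continuous fun q : Matrix (Fin n) (Fin p) ℝ × EuclideanSpace ℝ (Fin p) =>
    act q.1 q.2 := by
  simp only [act_apply]
  exact (PiLp.continuous_toLp 2 _).comp (continuous_fst.matrix_mulVec
    ((PiLp.continuous_ofLp 2 _).comp continuous_snd))

lemma norm_act_transpose_le (X : Matrix (Fin n) (Fin p) ℝ) (u : EuclideanSpace ℝ (Fin n)) :
    ‖act Xᵀ u‖ ≤ ‖act X‖ * ‖u‖ := by
  by_cases h : ‖act Xᵀ u‖ = 0
  · rw [h]; positivity
  have h0 : 0 < ‖act Xᵀ u‖ := lt_of_le_of_ne (norm_nonneg _) (Ne.symm h)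
  have h1 : ‖act Xᵀ u‖ * ‖act Xᵀ u‖ ≤ ‖act X‖ * ‖u‖ * ‖act Xᵀ u‖ := by
    rw [← real_inner_self_eq_norm_mul_norm, ← inner_act]
    calc _ ≤ ‖u‖ * ‖act X (act Xᵀ u)‖ := real_inner_le_norm _ _
      _ ≤ ‖u‖ * (‖act X‖ * ‖act Xᵀ u‖) := by gcongr; exact (act X).le_opNorm _
      _ = _ := by ring
  exact le_of_mul_le_mul_right h1 h0

end Act

/-! ### Cocoercivity of the scores -/

section Loss

variable {ρ : ℝ → ℝ} {L K : ℝ}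

lemma IsRobustLoss.differentiable (hρ : IsRobustLoss ρ L K) : Differentiable ℝ ρ :=
  hρ.contDiff.differentiable (by norm_num)

lemma IsRobustLoss.monotone_deriv (hρ : IsRobustLoss ρ L K) : Monotone (deriv ρ) := by
  have := hρ.convex.monotoneOn_deriv (fun x _ => hρ.differentiable x)
  exact monotoneOn_univ.1 this

/-- One factor of the square is bounded by L |a - b|; monotonicity of ψ makes the remaining product
nonnegative, so its absolute value can be dropped. -/
lemma IsRobustLoss.sq_deriv_sub_le (hρ : IsRobustLoss ρ L K) (a b : ℝ) :
    (deriv ρ a - deriv ρ b) ^ 2 ≤ L * ((deriv ρ a - deriv ρ b) * (a - b)) := by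
  have h1 := hρ.lipschitz a b
  have h2 : 0 ≤ (deriv ρ a - deriv ρ b) * (a - b) := by
    rcases le_total a b with h | h
    · exact mul_nonneg_of_nonpos_of_nonpos (by linarith [hρ.monotone_deriv h]) (by linarith)
    · exact mul_nonneg (by linarith [hρ.monotone_deriv h]) (by linarith)
  calc (deriv ρ a - deriv ρ b) ^ 2 = |deriv ρ a - deriv ρ b| * |deriv ρ a - deriv ρ b| := by
        rw [← sq_abs, sq]
    _ ≤ L * |a - b| * |deriv ρ a - deriv ρ b| := by gcongr
    _ = L * |(deriv ρ a - deriv ρ b) * (a - b)| := by rw [abs_mul]; ring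
    _ = _ := by rw [abs_of_nonneg h2]

/-- The vector of scores of a vector of residuals. -/
noncomputable def score {n : ℕ} (ρ : ℝ → ℝ) (r : EuclideanSpace ℝ (Fin n)) :
    EuclideanSpace ℝ (Fin n) := WithLp.toLp 2 fun i => deriv ρ (r i)

lemma IsRobustLoss.norm_score_sub_sq_le {n : ℕ} (hρ : IsRobustLoss ρ L K)
    (r s : EuclideanSpace ℝ (Fin n)) :
    ‖score ρ r - score ρ s‖ ^ 2 ≤ L * ⟪score ρ r - score ρ s, r - s⟫ := by
  rw [EuclideanSpace.real_norm_sq_eq, PiLp.inner_apply, Finset.mul_sum]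
  refine Finset.sum_le_sum fun i _ => ?_
  have := hρ.sq_deriv_sub_le (r i) (s i)
  simpa [score, mul_comm, mul_left_comm] using this

lemma IsRobustLoss.norm_score_sub_le {n : ℕ} (hρ : IsRobustLoss ρ L K) (hL : 0 < L)
    (r s : EuclideanSpace ℝ (Fin n)) : ‖score ρ r - score ρ s‖ ≤ L * ‖r - s‖ := by
  by_cases h : ‖score ρ r - score ρ s‖ = 0
  · rw [h]; positivity
  have h0 : 0 < ‖score ρ r - score ρ s‖ := lt_of_le_of_ne (norm_nonneg _) (Ne.symm h)
  have h1 := hρ.norm_score_sub_sq_le r s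
  have h2 := real_inner_le_norm (score ρ r - score ρ s) (r - s)
  have h3 := mul_le_mul_of_nonneg_left h2 hL.le
  refine le_of_mul_le_mul_right (a := ‖score ρ r - score ρ s‖) ?_ h0
  nlinarith

end Loss

/-! ### Strong convexity and existence of minimizers -/

section Existence

variable {p : ℕ} {g : EuclideanSpace ℝ (Fin p) → ℝ} {τ : ℝ}

lemma IsStronglyConvexPenalty.le_segment (hg : IsStronglyConvexPenalty g τ)
    (b d : EuclideanSpace ℝ (Fin p)) {s : ℝ} (hs : 0 ≤ s) (hs1 : s ≤ 1) :
    g (b + s • d) ≤ (1 - s) * g b + s * g (b + d) - τ / 2 * (s * (1 - s)) * ‖d‖ ^ 2 := by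
  have h := hg.2 (Set.mem_univ b) (Set.mem_univ (b + d)) (sub_nonneg.2 hs1) hs (by ring)
  have e : (1 - s) • b + s • (b + d) = b + s • d := by module
  rw [e] at h
  simp only [smul_eq_mul] at h
  have n1 : ‖b + s • d‖ ^ 2 = ‖b‖ ^ 2 + 2 * (s * ⟪b, d⟫) + s ^ 2 * ‖d‖ ^ 2 := by
    rw [norm_add_sq_real, inner_smul_right, norm_smul, mul_pow, Real.norm_eq_abs, sq_abs]
  have n2 : ‖b + d‖ ^ 2 = ‖b‖ ^ 2 + 2 * ⟪b, d⟫ + ‖d‖ ^ 2 := by rw [norm_add_sq_real]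
  rw [n1, n2] at h
  nlinarith

/-- A finite convex function decreases at most linearly in the norm, so the quadratic term makes the
sum coercive; it is continuous in finite dimension. -/
lemma exists_minimizer_of_convexOn {E : Type*} [NormedAddCommGroup E] [NormedSpace ℝ E]
    [FiniteDimensional ℝ E] {q : E → ℝ} (hq : ConvexOn ℝ Set.univ q) (hτ : 0 < τ) :
    ∃ b, ∀ b', q b + τ * ‖b‖ ^ 2 / 2 ≤ q b' + τ * ‖b'‖ ^ 2 / 2 := by
  have : ProperSpace E := FiniteDimensional.proper ℝ E
  have cq : Continuous q := continuousOn_univ.1 (ConvexOn.continuousOn isOpen_univ hq)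
  obtain ⟨M, hM⟩ := (isCompact_closedBall (0 : E) 1).exists_bound_of_continuousOn cq.continuousOn
  have hM0 : 0 ≤ M := (norm_nonneg _).trans (hM 0 (by simp))
  -- Outside the unit ball, convexity on the segment from 0 to b bounds q b from below by the values
  -- at 0 and at b/‖b‖, both controlled by M.
  have low : ∀ b, -(2 * M * ‖b‖ + 2 * M) ≤ q b := by
    intro b
    have h0 := abs_le.1 (hM 0 (by simp))
    rcases le_or_gt ‖b‖ 1 with h | h
    · have := abs_le.1 (hM b (by simpa using h))
      nlinarith [norm_nonneg b]
    · have hb : 0 < ‖b‖ := by linarith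
      have h1 := abs_le.1 (hM (‖b‖⁻¹ • b) (by simp [norm_smul, hb.ne']))
      have h2 := hq.2 (Set.mem_univ (0 : E)) (Set.mem_univ b)
        (sub_nonneg.2 (inv_le_one_of_one_le₀ h.le)) (inv_nonneg.2 hb.le) (by ring)
      simp only [smul_zero, zero_add, smul_eq_mul] at h2
      have h3 : ‖b‖⁻¹ * q b ≥ -(2 * M) := by
        have : 0 < ‖b‖⁻¹ := inv_pos.2 hb
        have h5 : ‖b‖⁻¹ ≤ 1 := inv_le_one_of_one_le₀ h.le
        nlinarith
      have h4 : q b = ‖b‖ * (‖b‖⁻¹ * q b) := by field_simp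
      rw [h4]
      nlinarith
  have hcont : Continuous fun b => q b + τ * ‖b‖ ^ 2 / 2 := by fun_prop
  refine hcont.exists_forall_le ?_
  have t1 : Tendsto (fun t : ℝ => t * (τ / 2 * t + -(2 * M)) + -(2 * M)) atTop atTop := by
    refine tendsto_atTop_add_const_right _ _ (tendsto_id.atTop_mul_atTop₀ ?_)
    exact tendsto_atTop_add_const_right _ _ (tendsto_id.const_mul_atTop (by positivity))
  refine tendsto_atTop_mono (fun b => ?_) (t1.comp (tendsto_norm_cocompact_atTop (E := E)))
  have := low b
  simp only [Function.comp]
  nlinarith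

end Existence

/-! ### Optimality and stability of the estimator -/

section Estimator

variable {n p : ℕ} {ρ : ℝ → ℝ} {L K τ : ℝ} {g : EuclideanSpace ℝ (Fin p) → ℝ}

lemma convexOn_objective_sub (hρ : IsRobustLoss ρ L K) (hg : IsStronglyConvexPenalty g τ)
    (X : Matrix (Fin n) (Fin p) ℝ) (y : EuclideanSpace ℝ (Fin n)) :
    ConvexOn ℝ Set.univ (fun b => objective ρ g X y b - τ * ‖b‖ ^ 2 / 2) := by
  have h1 : ∀ i : Fin n, ConvexOn ℝ Set.univ
      (fun b : EuclideanSpace ℝ (Fin p) => ρ (y i - (X *ᵥ b.ofLp) i)) := by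
    intro i
    refine ⟨convex_univ, fun a _ b _ s t hs ht hst => ?_⟩
    have := hρ.convex.2 (Set.mem_univ (y i - (X *ᵥ a.ofLp) i))
      (Set.mem_univ (y i - (X *ᵥ b.ofLp) i)) hs ht hst
    convert! this using 2
    simp only [WithLp.ofLp_add, WithLp.ofLp_smul, Matrix.mulVec_add,
      Matrix.mulVec_smul, Pi.add_apply, Pi.smul_apply, smul_eq_mul]
    linear_combination (- y i) * hst
  have h2 : ConvexOn ℝ Set.univ (fun b : EuclideanSpace ℝ (Fin p) =>
      ∑ i, ρ (y i - (X *ᵥ b.ofLp) i)) := by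
    refine ⟨convex_univ, fun a ha b hb s t hs ht hst => ?_⟩
    simp only [Finset.smul_sum, ← Finset.sum_add_distrib]
    exact Finset.sum_le_sum fun i _ => (h1 i).2 ha hb hs ht hst
  have h3 := (h2.smul (c := 1 / (n : ℝ)) (by positivity)).add hg
  convert! h3 using 1
  ext b
  simp [objective]
  ring

lemma estimator_le (hρ : IsRobustLoss ρ L K) (hg : IsStronglyConvexPenalty g τ) (hτ : 0 < τ)
    (X : Matrix (Fin n) (Fin p) ℝ) (y : EuclideanSpace ℝ (Fin n))
    (b' : EuclideanSpace ℝ (Fin p)) :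
    objective ρ g X y (estimator ρ g X y) ≤ objective ρ g X y b' := by
  have h : ∃ b, ∀ b', objective ρ g X y b ≤ objective ρ g X y b' := by
    obtain ⟨b, hb⟩ := exists_minimizer_of_convexOn (convexOn_objective_sub hρ hg X y) hτ
    exact ⟨b, fun b' => by simpa using hb b'⟩
  exact Classical.epsilon_spec h b'

lemma psi_eq_score (X : Matrix (Fin n) (Fin p) ℝ) (y : EuclideanSpace ℝ (Fin n)) :
    psi ρ g X y = score ρ (y - act X (estimator ρ g X y)) := rfl

/-- The variational inequality that characterizes the estimator. -/
lemma estimator_variational (hρ : IsRobustLoss ρ L K) (hg : IsStronglyConvexPenalty g τ)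
    (hτ : 0 < τ) (X : Matrix (Fin n) (Fin p) ℝ) (y : EuclideanSpace ℝ (Fin n))
    (b' : EuclideanSpace ℝ (Fin p)) :
    1 / (n : ℝ) * ⟪psi ρ g X y, act X (b' - estimator ρ g X y)⟫
      + τ / 2 * ‖b' - estimator ρ g X y‖ ^ 2 ≤ g b' - g (estimator ρ g X y) := by
  set b := estimator ρ g X y with hb
  set d := b' - b with hd
  -- Only the smooth part is differentiated along the segment. The penalty, possibly nonsmooth, is
  -- bounded by strong convexity, and dividing by s ↓ 0 yields a one-sided first order condition.
  let F : ℝ → ℝ := fun s => 1 / (n : ℝ) * ∑ i, ρ (y i - (X *ᵥ (b + s • d).ofLp) i)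
  have hF : HasDerivAt F (-(1 / (n : ℝ) * ⟪psi ρ g X y, act X d⟫)) 0 := by
    have h1 : ∀ i : Fin n, HasDerivAt (fun s : ℝ => ρ (y i - (X *ᵥ (b + s • d).ofLp) i))
        (-(psi ρ g X y i * act X d i)) 0 := by
      intro i
      have e : ∀ s : ℝ, y i - (X *ᵥ (b + s • d).ofLp) i
          = (y i - (X *ᵥ b.ofLp) i) + s * (-(act X d i)) := by
        intro s
        simp only [WithLp.ofLp_add, WithLp.ofLp_smul, Matrix.mulVec_add,
          Matrix.mulVec_smul, Pi.add_apply, Pi.smul_apply, smul_eq_mul, act_apply]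
        ring
      simp_rw [e]
      have h2 : HasDerivAt (fun s : ℝ => (y i - (X *ᵥ b.ofLp) i) + s * (-(act X d i)))
          (-(act X d i)) 0 := by
        simpa using ((hasDerivAt_id (0 : ℝ)).mul_const (-(act X d i))).const_add
          (y i - (X *ᵥ b.ofLp) i)
      have h3 : HasDerivAt ρ (deriv ρ (y i - (X *ᵥ b.ofLp) i))
          ((y i - (X *ᵥ b.ofLp) i) + (0 : ℝ) * (-(act X d i))) := by
        simpa using (hρ.differentiable (y i - (X *ᵥ b.ofLp) i)).hasDerivAt
      have h4 := h3.comp (0 : ℝ) h2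
      convert! h4 using 1
      simp [psi, hb]
    have h2 := (HasDerivAt.fun_sum (u := Finset.univ) fun i _ => h1 i).const_mul (1 / (n : ℝ))
    convert! h2 using 1
    rw [Finset.sum_neg_distrib, mul_neg, PiLp.inner_apply]
    simp [mul_comm]
  have hs := hF.tendsto_slope_zero_right
  have lim : Tendsto (fun s : ℝ => g b' - g b - τ / 2 * (1 - s) * ‖d‖ ^ 2) (𝓝[>] 0)
      (𝓝 (g b' - g b - τ / 2 * (1 - 0) * ‖d‖ ^ 2)) := by
    apply Tendsto.mono_left _ nhdsWithin_le_nhds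
    exact Continuous.tendsto (by fun_prop) 0
  have key : ∀ᶠ s : ℝ in 𝓝[>] 0, 0 ≤ s⁻¹ • (F (0 + s) - F 0) +
      (g b' - g b - τ / 2 * (1 - s) * ‖d‖ ^ 2) := by
    filter_upwards [Ioc_mem_nhdsGT (zero_lt_one (α := ℝ))] with s hs
    have h1 := estimator_le hρ hg hτ X y (b + s • d)
    rw [← hb] at h1
    have h2 := hg.le_segment b d hs.1.le hs.2
    have e1 : objective ρ g X y b = F 0 + g b := by simp [objective, F]
    have e2 : objective ρ g X y (b + s • d) = F s + g (b + s • d) := rfl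
    have e3 : b + d = b' := by simp [hd]
    rw [e1, e2] at h1
    rw [e3] at h2
    have h3 : 0 ≤ (F s - F 0) + s * (g b' - g b - τ / 2 * (1 - s) * ‖d‖ ^ 2) := by nlinarith
    have h4 := mul_nonneg (inv_nonneg.2 hs.1.le) h3
    rw [mul_add, inv_mul_cancel_left₀ hs.1.ne'] at h4
    simpa using h4
  have := ge_of_tendsto (hs.add lim) key
  linarith

/-- The basic comparison of the estimators for two data sets. -/
lemma estimator_comparison (hρ : IsRobustLoss ρ L K) (hg : IsStronglyConvexPenalty g τ)
    (hτ : 0 < τ) (hn : 0 < n) (X X' : Matrix (Fin n) (Fin p) ℝ) (y y' : EuclideanSpace ℝ (Fin n)) :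
    n * τ * ‖estimator ρ g X y - estimator ρ g X' y'‖ ^ 2
      + ⟪psi ρ g X y - psi ρ g X' y',
          (y - act X (estimator ρ g X y)) - (y' - act X' (estimator ρ g X' y'))⟫
      ≤ ⟪psi ρ g X y - psi ρ g X' y', (y - y') - act (X - X') (estimator ρ g X y)⟫
        + ⟪act (X - X')ᵀ (psi ρ g X y), estimator ρ g X y - estimator ρ g X' y'⟫ := by
  have h1 := estimator_variational hρ hg hτ X y (estimator ρ g X' y')
  have h2 := estimator_variational hρ hg hτ X' y' (estimator ρ g X y)
  set b := estimator ρ g X y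
  set b' := estimator ρ g X' y'
  set u := psi ρ g X y
  set u' := psi ρ g X' y'
  have hn' : (0 : ℝ) < n := by exact_mod_cast hn
  -- In the sum of the two variational inequalities the penalty cancels and the two halves of τ add
  -- up.
  have h3 : 1 / (n : ℝ) * (⟪u, act X (b' - b)⟫ + ⟪u', act X' (b - b')⟫) + τ * ‖b - b'‖ ^ 2 ≤ 0 := by
    rw [norm_sub_rev b' b] at h1
    linarith
  have h4 : ⟪u, act X (b' - b)⟫ + ⟪u', act X' (b - b')⟫ + n * τ * ‖b - b'‖ ^ 2 ≤ 0 := by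
    have := mul_le_mul_of_nonneg_left h3 hn'.le
    rw [mul_zero, mul_add, ← mul_assoc, mul_one_div_cancel hn'.ne'] at this
    linarith
  rw [← inner_act, act_sub_left, act_sub_left, map_sub, map_sub]
  rw [map_sub, map_sub] at h4
  simp only [inner_sub_left, inner_sub_right] at h4 ⊢
  linarith

/-- Cocoercivity bounds the inner product with the difference of the residuals below by ‖Δψ‖²/L;
Young's inequality absorbs half of each square on the left. The right side involves only the
estimator at (X, y), so no prior control at (X', y') is needed. -/
lemma estimator_comparison_norm (hρ : IsRobustLoss ρ L K) (hg : IsStronglyConvexPenalty g τ)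
    (hτ : 0 < τ) (hL : 0 < L) (hn : 0 < n) (X X' : Matrix (Fin n) (Fin p) ℝ)
    (y y' : EuclideanSpace ℝ (Fin n)) :
    n * τ * ‖estimator ρ g X y - estimator ρ g X' y'‖ ^ 2 + ‖psi ρ g X y - psi ρ g X' y'‖ ^ 2 / L
      ≤ L * ‖(y - y') - act (X - X') (estimator ρ g X y)‖ ^ 2
        + ‖act (X - X')ᵀ (psi ρ g X y)‖ ^ 2 / (n * τ) := by
  have h := estimator_comparison hρ hg hτ hn X X' y y'
  have h0 := hρ.norm_score_sub_sq_le (y - act X (estimator ρ g X y))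
    (y' - act X' (estimator ρ g X' y'))
  rw [← psi_eq_score, ← psi_eq_score] at h0
  set d := estimator ρ g X y - estimator ρ g X' y'
  set u := psi ρ g X y - psi ρ g X' y'
  have h1 := real_inner_le_norm u ((y - y') - act (X - X') (estimator ρ g X y))
  have h2 := real_inner_le_norm (act (X - X')ᵀ (psi ρ g X y)) d
  set A := ‖(y - y') - act (X - X') (estimator ρ g X y)‖
  set B := ‖act (X - X')ᵀ (psi ρ g X y)‖
  have hnt : 0 < n * τ := by positivity
  have h0' : ‖u‖ ^ 2 / L ≤ ⟪u, (y - act X (estimator ρ g X y))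
      - (y' - act X' (estimator ρ g X' y'))⟫ := by
    rw [div_le_iff₀ hL]; linarith
  have a1 : 2 * (‖u‖ * A) ≤ ‖u‖ ^ 2 / L + L * A ^ 2 := by
    have e : ‖u‖ ^ 2 / L + L * A ^ 2 - 2 * (‖u‖ * A) = (‖u‖ - L * A) ^ 2 / L := by
      field_simp; ring
    have : 0 ≤ (‖u‖ - L * A) ^ 2 / L := by positivity
    linarith
  have a2 : 2 * (B * ‖d‖) ≤ n * τ * ‖d‖ ^ 2 + B ^ 2 / (n * τ) := by
    have e : n * τ * ‖d‖ ^ 2 + B ^ 2 / (n * τ) - 2 * (B * ‖d‖)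
        = (B - n * τ * ‖d‖) ^ 2 / (n * τ) := by
      field_simp; ring
    have : 0 ≤ (B - n * τ * ‖d‖) ^ 2 / (n * τ) := by positivity
    linarith
  linarith

/-- The first term is the change of the residuals with the estimator frozen; the second is the
change of the gradient of the loss, and it carries a factor n^(-1/2). All derivative bounds for the
scores come from here. -/
lemma norm_psi_sub_le (hρ : IsRobustLoss ρ L K) (hg : IsStronglyConvexPenalty g τ)
    (hτ : 0 < τ) (hL : 0 < L) (hn : 0 < n) (X X' : Matrix (Fin n) (Fin p) ℝ)
    (y y' : EuclideanSpace ℝ (Fin n)) :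
    ‖psi ρ g X y - psi ρ g X' y'‖ ≤ L * ‖(y - y') - act (X - X') (estimator ρ g X y)‖
        + √(L / (n * τ)) * ‖act (X - X')ᵀ (psi ρ g X y)‖ := by
  have h := estimator_comparison_norm hρ hg hτ hL hn X X' y y'
  set u := psi ρ g X y - psi ρ g X' y'
  set A := ‖(y - y') - act (X - X') (estimator ρ g X y)‖
  set B := ‖act (X - X')ᵀ (psi ρ g X y)‖
  have hnt : 0 < n * τ := by positivity
  have h1 : ‖u‖ ^ 2 / L ≤ L * A ^ 2 + B ^ 2 / (n * τ) := by
    have : 0 ≤ n * τ * ‖estimator ρ g X y - estimator ρ g X' y'‖ ^ 2 := by positivity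
    linarith
  rw [div_le_iff₀ hL] at h1
  refine abs_le_of_sq_le_sq' ?_ (by positivity) |>.2
  have hs : √(L / (n * τ)) ^ 2 = L / (n * τ) := Real.sq_sqrt (by positivity)
  have : 0 ≤ 2 * (L * A) * (√(L / (n * τ)) * B) := by positivity
  calc ‖u‖ ^ 2 ≤ (L * A ^ 2 + B ^ 2 / (n * τ)) * L := h1
    _ = (L * A) ^ 2 + L / (n * τ) * B ^ 2 := by ring
    _ = (L * A) ^ 2 + (√(L / (n * τ)) * B) ^ 2 := by rw [mul_pow _ B, hs]
    _ ≤ _ := by nlinarith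

/-- The comparison bound, with the estimator evaluated at the limit point only, is continuous in the
other data and vanishes at the limit point. -/
lemma continuous_estimator (hρ : IsRobustLoss ρ L K) (hg : IsStronglyConvexPenalty g τ)
    (hτ : 0 < τ) (hL : 0 < L) (hn : 0 < n) :
    Continuous fun q : Matrix (Fin n) (Fin p) ℝ × EuclideanSpace ℝ (Fin n) =>
      estimator ρ g q.1 q.2 := by
  rw [continuous_iff_continuousAt]
  rintro ⟨X, y⟩
  rw [ContinuousAt, tendsto_iff_norm_sub_tendsto_zero]
  have hnt : 0 < n * τ := by positivity
  let B : Matrix (Fin n) (Fin p) ℝ × EuclideanSpace ℝ (Fin n) → ℝ := fun q =>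
    √((L * ‖(y - q.2) - act (X - q.1) (estimator ρ g X y)‖ ^ 2
        + ‖act (X - q.1)ᵀ (psi ρ g X y)‖ ^ 2 / (n * τ)) / (n * τ))
  have cB : Continuous B := by
    have c1 : Continuous fun q : Matrix (Fin n) (Fin p) ℝ × EuclideanSpace ℝ (Fin n) =>
        act (X - q.1) (estimator ρ g X y) :=
      continuous_act.comp ((continuous_const.sub continuous_fst).prodMk continuous_const)
    have c2 : Continuous fun q : Matrix (Fin n) (Fin p) ℝ × EuclideanSpace ℝ (Fin n) =>
        act (X - q.1)ᵀ (psi ρ g X y) :=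
      continuous_act.comp ((continuous_const.sub continuous_fst).matrix_transpose.prodMk
        continuous_const)
    fun_prop
  have B0 : B (X, y) = 0 := by
    simp [B, act_zero_left]
  have := cB.tendsto (X, y)
  rw [B0] at this
  refine squeeze_zero (fun _ => norm_nonneg _) (fun q => ?_) this
  refine Real.le_sqrt_of_sq_le ?_
  rw [le_div_iff₀ hnt, norm_sub_rev]
  have h := estimator_comparison_norm hρ hg hτ hL hn X q.1 y q.2
  have : 0 ≤ ‖psi ρ g X y - psi ρ g q.1 q.2‖ ^ 2 / L := by positivity
  linarith

lemma continuous_score (hρ : IsRobustLoss ρ L K) :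
    Continuous (score ρ : EuclideanSpace ℝ (Fin n) → EuclideanSpace ℝ (Fin n)) := by
  have := hρ.contDiff.continuous_deriv (by norm_num)
  refine (PiLp.continuous_toLp 2 _).comp (continuous_pi fun i => ?_)
  exact this.comp (by fun_prop)

lemma continuous_psi (hρ : IsRobustLoss ρ L K) (hg : IsStronglyConvexPenalty g τ)
    (hτ : 0 < τ) (hL : 0 < L) (hn : 0 < n) :
    Continuous fun q : Matrix (Fin n) (Fin p) ℝ × EuclideanSpace ℝ (Fin n) => psi ρ g q.1 q.2 := by
  simp only [psi_eq_score]
  exact (continuous_score hρ).comp (continuous_snd.sub (continuous_act.comp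
    (continuous_fst.prodMk (continuous_estimator hρ hg hτ hL hn))))

/-- Comparison with the unpenalized point `argmin g`, which is the estimator for the zero design. -/
lemma norm_estimator_sub_argmin_le (hρ : IsRobustLoss ρ L K) (hg : IsStronglyConvexPenalty g τ)
    (hτ : 0 < τ) (hn : 0 < n) (X : Matrix (Fin n) (Fin p) ℝ) (y y' : EuclideanSpace ℝ (Fin n)) :
    n * τ * ‖estimator ρ g X y - estimator ρ g (0 : Matrix (Fin n) (Fin p) ℝ) y'‖
      ≤ ‖act X‖ * ‖psi ρ g X y‖ := by
  have h := estimator_comparison hρ hg hτ hn X 0 y y'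
  simp only [sub_zero, act_zero_left] at h
  -- For the zero design the score inner products on both sides coincide and cancel, so neither y'
  -- nor cocoercivity enters.
  have e : y - act X (estimator ρ g X y) - y' = y - y' - act X (estimator ρ g X y) := by abel
  rw [e] at h
  set d := estimator ρ g X y - estimator ρ g (0 : Matrix (Fin n) (Fin p) ℝ) y'
  by_cases hd : ‖d‖ = 0
  · rw [hd, mul_zero]; positivity
  have hd0 : 0 < ‖d‖ := lt_of_le_of_ne (norm_nonneg _) (Ne.symm hd)
  have h1 := real_inner_le_norm (act Xᵀ (psi ρ g X y)) d
  have h2 := mul_le_mul_of_nonneg_right (norm_act_transpose_le X (psi ρ g X y)) hd0.le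
  refine le_of_mul_le_mul_right ?_ hd0
  nlinarith

end Estimator

/-! ### Differentiability and derivative bounds from increments -/

section Slope

/-- A function whose increments from `x` are bounded by `C x * ‖x - y‖` with `C` continuous is
almost everywhere differentiable. -/
lemma ae_differentiableAt_of_slope {E F : Type*} [NormedAddCommGroup E] [NormedSpace ℝ E]
    [FiniteDimensional ℝ E] [MeasurableSpace E] [BorelSpace E] [NormedAddCommGroup F]
    [NormedSpace ℝ F] [FiniteDimensional ℝ F] (μ : Measure E) [μ.IsAddHaarMeasure]
    {G : E → F} {C : E → ℝ} (hC : Continuous C) (h : ∀ x y, ‖G x - G y‖ ≤ C x * ‖x - y‖) :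
    ∀ᵐ x ∂μ, DifferentiableAt ℝ G x := by
  have : ProperSpace E := FiniteDimensional.proper ℝ E
  have key : ∀ k : ℕ, ∀ᵐ x ∂μ, x ∈ Metric.ball (0 : E) k → DifferentiableAt ℝ G x := by
    intro k
    obtain ⟨M, hM⟩ := (isCompact_closedBall (0 : E) k).exists_bound_of_continuousOn hC.continuousOn
    have hl : LipschitzOnWith M.toNNReal G (Metric.ball (0 : E) k) := by
      refine LipschitzOnWith.of_dist_le_mul fun x hx y _ => ?_
      rw [dist_eq_norm, dist_eq_norm]
      refine (h x y).trans ?_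
      gcongr
      exact (le_abs_self _).trans ((hM x (Metric.ball_subset_closedBall hx)).trans
        (Real.le_coe_toNNReal M))
    filter_upwards [hl.ae_differentiableWithinAt_of_mem (μ := μ)] with x hx hxk
    exact (hx hxk).differentiableAt (Metric.isOpen_ball.mem_nhds hxk)
  filter_upwards [ae_all_iff.2 key] with x hx
  obtain ⟨k, hk⟩ := exists_nat_gt ‖x‖
  exact hx k (by simpa using hk)

/-- Pass to the limit in the difference quotients. Only absolute homogeneity of N is used, so the
bound may be anisotropic and may vanish in some directions. -/
lemma norm_fderiv_le_of_slope {E F : Type*} [NormedAddCommGroup E] [NormedSpace ℝ E]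
    [NormedAddCommGroup F] [NormedSpace ℝ F] {G : E → F} {x : E} (hd : DifferentiableAt ℝ G x)
    {N : E → ℝ} (hN : ∀ (t : ℝ) v, N (t • v) = |t| * N v) (h : ∀ v, ‖G (x + v) - G x‖ ≤ N v)
    (v : E) : ‖fderiv ℝ G x v‖ ≤ N v := by
  have h1 := (hd.hasFDerivAt.hasLineDerivAt v).tendsto_slope_zero_right
  refine le_of_tendsto h1.norm ?_
  filter_upwards [self_mem_nhdsWithin] with t ht
  have ht' : 0 < t := ht
  rw [norm_smul, norm_inv, Real.norm_of_nonneg ht'.le, inv_mul_le_iff₀ ht']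
  refine (h _).trans ?_
  rw [hN, abs_of_pos ht']

end Slope

/-! ### Traces and Frobenius norms under rank one bounds -/

section RankOne

variable {n : ℕ}

lemma sum_sq_apply_single (ℓ : EuclideanSpace ℝ (Fin n) →L[ℝ] ℝ) :
    ∑ i, ℓ (EuclideanSpace.single i 1) ^ 2 = ‖ℓ‖ ^ 2 := by
  rw [(EuclideanSpace.basisFun (Fin n) ℝ).norm_dual ℓ]
  simp

lemma eq_sum_single (v : EuclideanSpace ℝ (Fin n)) :
    v = ∑ i, v i • EuclideanSpace.single i (1 : ℝ) := by
  ext k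
  simp [Finset.sum_apply, Pi.single_apply]

lemma sum_coord_mul_inner (u v : EuclideanSpace ℝ (Fin n))
    (A : EuclideanSpace ℝ (Fin n) →L[ℝ] EuclideanSpace ℝ (Fin n)) :
    ∑ i, u i * ⟪v, A (EuclideanSpace.single i 1)⟫ = ⟪v, A u⟫ := by
  conv_rhs => rw [eq_sum_single u]
  simp [inner_sum, inner_smul_right]

/-- Such a map kills the orthogonal complement of u, so it has rank at most one and its trace is ⟪u,
B u⟫/‖u‖². No factor n appears, unlike in a bound through the operator norm. -/
lemma abs_clmTrace_le_of_norm_le_inner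
    {B : EuclideanSpace ℝ (Fin n) →L[ℝ] EuclideanSpace ℝ (Fin n)} {q : ℝ}
    {u : EuclideanSpace ℝ (Fin n)} (h : ∀ v, ‖B v‖ ≤ q * |⟪v, u⟫|) :
    |clmTrace B| ≤ q * ‖u‖ := by
  by_cases hu : ‖u‖ = 0
  · have hu' : u = 0 := norm_eq_zero.1 hu
    have hB : ∀ v, B v = 0 := fun v => by
      have := h v
      rw [hu', inner_zero_right, abs_zero, mul_zero] at this
      exact norm_le_zero_iff.1 this
    simp [clmTrace, hB, hu]
  have hu0 : 0 < ‖u‖ := lt_of_le_of_ne (norm_nonneg _) (Ne.symm hu)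
  have hB : ∀ v, B v = (⟪v, u⟫ / ‖u‖ ^ 2) • B u := by
    intro v
    have h1 := h (v - (⟪v, u⟫ / ‖u‖ ^ 2) • u)
    rw [inner_sub_left, inner_smul_left, real_inner_self_eq_norm_sq] at h1
    have : ⟪v, u⟫ - (starRingEnd ℝ) (⟪v, u⟫ / ‖u‖ ^ 2) * ‖u‖ ^ 2 = 0 := by
      simp; field_simp; simp
    rw [this, abs_zero, mul_zero] at h1
    have h2 := norm_le_zero_iff.1 h1
    rw [map_sub, map_smul, sub_eq_zero] at h2
    exact h2
  have e : clmTrace B = ⟪u, B u⟫ / ‖u‖ ^ 2 := by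
    rw [clmTrace, PiLp.inner_apply, Finset.sum_div]
    refine Finset.sum_congr rfl fun i _ => ?_
    rw [hB]
    simp [EuclideanSpace.inner_single_left]
    ring
  rw [e, abs_div, abs_of_pos (by positivity : 0 < ‖u‖ ^ 2), div_le_iff₀ (by positivity)]
  refine (abs_real_inner_le_norm _ _).trans ?_
  have h3 := h u
  rw [real_inner_self_eq_norm_sq, abs_of_nonneg (sq_nonneg _)] at h3
  nlinarith

lemma frobSq_le_of_norm_le_inner
    {B : EuclideanSpace ℝ (Fin n) →L[ℝ] EuclideanSpace ℝ (Fin n)} {q : ℝ}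
    {u : EuclideanSpace ℝ (Fin n)} (h : ∀ v, ‖B v‖ ≤ q * |⟪v, u⟫|) :
    frobSq B ≤ q ^ 2 * ‖u‖ ^ 2 := by
  rw [frobSq, EuclideanSpace.real_norm_sq_eq, Finset.mul_sum]
  refine Finset.sum_le_sum fun i _ => ?_
  have := h (EuclideanSpace.single i 1)
  have e : ⟪EuclideanSpace.single i (1 : ℝ), u⟫ = u i := by
    simp [EuclideanSpace.inner_single_left]
  rw [e] at this
  calc ‖B (EuclideanSpace.single i 1)‖ ^ 2 ≤ (q * |u i|) ^ 2 := by gcongr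
    _ = q ^ 2 * u i ^ 2 := by rw [mul_pow, sq_abs]

lemma frobSq_add_le {F : Type*} [NormedAddCommGroup F] [NormedSpace ℝ F]
    (A B : EuclideanSpace ℝ (Fin n) →L[ℝ] F) : frobSq (A + B) ≤ 2 * frobSq A + 2 * frobSq B := by
  simp only [frobSq, Finset.mul_sum, ← Finset.sum_add_distrib]
  refine Finset.sum_le_sum fun i _ => ?_
  rw [add_apply]
  have := norm_add_le (A (EuclideanSpace.single i 1)) (B (EuclideanSpace.single i 1))
  nlinarith [norm_nonneg (A (EuclideanSpace.single i 1) + B (EuclideanSpace.single i 1)),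
    sq_nonneg (‖A (EuclideanSpace.single i 1)‖ - ‖B (EuclideanSpace.single i 1)‖)]

lemma frobSq_le_mul {F F' : Type*} [NormedAddCommGroup F] [NormedSpace ℝ F]
    [NormedAddCommGroup F'] [NormedSpace ℝ F']
    {A : EuclideanSpace ℝ (Fin n) →L[ℝ] F} {B : EuclideanSpace ℝ (Fin n) →L[ℝ] F'} {k : ℝ}
    (h : ∀ v, ‖A v‖ ≤ k * ‖B v‖) : frobSq A ≤ k ^ 2 * frobSq B := by
  rw [frobSq, frobSq, Finset.mul_sum]
  refine Finset.sum_le_sum fun i _ => ?_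
  rw [← mul_pow]
  gcongr
  exact h _

lemma clmTrace_add (A B : EuclideanSpace ℝ (Fin n) →L[ℝ] EuclideanSpace ℝ (Fin n)) :
    clmTrace (A + B) = clmTrace A + clmTrace B := by
  simp [clmTrace, Finset.sum_add_distrib]

lemma clmTrace_smul (c : ℝ) (A : EuclideanSpace ℝ (Fin n) →L[ℝ] EuclideanSpace ℝ (Fin n)) :
    clmTrace (c • A) = c * clmTrace A := by
  simp [clmTrace, Finset.mul_sum]

variable {T : EuclideanSpace ℝ (Fin n) × EuclideanSpace ℝ (Fin n) →L[ℝ] EuclideanSpace ℝ (Fin n)}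
  {L a q : ℝ} {u : EuclideanSpace ℝ (Fin n)}

/-- The consequences of a bound on the joint derivative of the scores in the Gaussian direction and
in the noise. -/
lemma joint_derivative_bounds (hL : 0 ≤ L) (hq : 0 ≤ q)
    (h : ∀ v, ‖T v‖ ≤ L * ‖v.2 - a • v.1‖ + q * |⟪v.1, u⟫|) :
    |clmTrace (T.comp (inl ℝ _ _)) + a * clmTrace (T.comp (inr ℝ _ _))| ≤ q * ‖u‖ ∧
    frobSq (T.comp (inl ℝ _ _)) ≤ 2 * (n * (L * a) ^ 2) + 2 * (q ^ 2 * ‖u‖ ^ 2) ∧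
    |clmTrace (T.comp (inr ℝ _ _))| ≤ n * L ∧
    ∀ v, ‖T (v, 0)‖ ≤ (L * |a| + q * ‖u‖) * ‖v‖ := by
  set W := T.comp (inl ℝ _ _) with hW
  set S := T.comp (inr ℝ _ _) with hS
  have hSn : ‖S‖ ≤ L := by
    refine S.opNorm_le_bound hL fun v => ?_
    have := h (0, v)
    simpa [hS] using this
  -- The direction (v, a v) annihilates the first term of the bound. Hence W is -a S up to a rank
  -- one map, which yields both the trace comparison and the Frobenius bound.
  have hB : ∀ v, ‖(W + a • S) v‖ ≤ q * |⟪v, u⟫| := by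
    intro v
    have := h (v, a • v)
    have e : T (v, a • v) = (W + a • S) v := by
      simp only [hW, hS, add_apply, smul_apply, comp_apply, inl_apply, inr_apply, ← map_smul,
        ← map_add]
      simp
    rw [e] at this
    simpa using this
  refine ⟨?_, ?_, ?_, ?_⟩
  · have := abs_clmTrace_le_of_norm_le_inner hB
    rwa [clmTrace_add, clmTrace_smul] at this
  · have e : W = (-a • S) + (W + a • S) := by ext v; simp
    rw [e]
    refine (frobSq_add_le _ _).trans ?_
    have h1 := frobSq_le_of_norm_le_inner hB
    have h2 : frobSq (-a • S) ≤ n * (L * a) ^ 2 := by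
      refine (frobSq_le _).trans ?_
      rw [Fintype.card_fin, norm_smul, norm_neg]
      have : (‖a‖ * ‖S‖) ^ 2 ≤ (‖a‖ * L) ^ 2 := by gcongr
      have e2 : (‖a‖ * L) ^ 2 = (L * a) ^ 2 := by
        rw [mul_pow, mul_pow, Real.norm_eq_abs, sq_abs]; ring
      rw [e2] at this
      gcongr
    linarith
  · refine (abs_clmTrace_le _).trans ?_
    rw [Fintype.card_fin]
    gcongr
  · intro v
    have h1 := h (v, 0)
    simp only [zero_sub, norm_neg, norm_smul, Real.norm_eq_abs] at h1
    have h2 := mul_le_mul_of_nonneg_left (abs_real_inner_le_norm v u) hq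
    nlinarith

end RankOne

/-! ### Smooth normalization -/

section Normalize

variable {F : Type*} [NormedAddCommGroup F] [InnerProductSpace ℝ F]

/-- The smooth normalization `v ↦ v / √(‖v‖² + s)`. -/
noncomputable def smoothNormalize (s : ℝ) (v : F) : F := (√(‖v‖ ^ 2 + s))⁻¹ • v

lemma norm_smoothNormalize_le {s : ℝ} (hs : 0 < s) (v : F) : ‖smoothNormalize s v‖ ≤ 1 := by
  rw [smoothNormalize, norm_smul, norm_inv, Real.norm_of_nonneg (Real.sqrt_nonneg _),
    inv_mul_le_iff₀ (by positivity), mul_one]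
  exact Real.le_sqrt_of_sq_le (by linarith)

lemma hasFDerivAt_smoothNormalize {s : ℝ} (hs : 0 < s) (v : F) :
    HasFDerivAt (smoothNormalize s)
      ((√(‖v‖ ^ 2 + s))⁻¹ • (ContinuousLinearMap.id ℝ F)
        + (-((√(‖v‖ ^ 2 + s))⁻¹ ^ 3) • innerSL ℝ v).smulRight v) v := by
  have hpos : 0 < ‖v‖ ^ 2 + s := by positivity
  have h1 : HasFDerivAt (fun v : F => ‖v‖ ^ 2 + s) ((2 : ℝ) • innerSL ℝ v) v := by
    have := ((hasStrictFDerivAt_norm_sq v).hasFDerivAt).add_const s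
    convert! this using 1
    ext w; simp
  have h2 := (h1.sqrt hpos.ne')
  have h3 := (hasDerivAt_inv (Real.sqrt_pos.2 hpos).ne').comp_hasFDerivAt v h2
  have h4 := h3.smul (hasFDerivAt_id v)
  unfold smoothNormalize
  convert! h4 using 1
  ext w
  simp
  ring_nf

lemma norm_fderiv_smoothNormalize_apply_le {s : ℝ} (hs : 0 < s) (v w : F) :
    ‖fderiv ℝ (smoothNormalize s) v w‖ ≤ 2 * (√(‖v‖ ^ 2 + s))⁻¹ * ‖w‖ := by
  rw [(hasFDerivAt_smoothNormalize hs v).fderiv]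
  set D := √(‖v‖ ^ 2 + s) with hD
  have hD0 : 0 < D := Real.sqrt_pos.2 (by positivity)
  have hvD : ‖v‖ ≤ D := Real.le_sqrt_of_sq_le (by linarith)
  simp only [add_apply, smul_apply, smulRight_apply, innerSL_apply_apply, id_apply, smul_eq_mul]
  refine (norm_add_le _ _).trans ?_
  have h1 : ‖D⁻¹ • w‖ = D⁻¹ * ‖w‖ := by
    rw [norm_smul, Real.norm_of_nonneg (inv_nonneg.2 hD0.le)]
  have h2 : ‖(-(D⁻¹ ^ 3) * ⟪v, w⟫) • v‖ ≤ D⁻¹ * ‖w‖ := by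
    rw [norm_smul, norm_mul, norm_neg, Real.norm_of_nonneg (by positivity)]
    have hi : ‖⟪v, w⟫‖ ≤ ‖v‖ * ‖w‖ := norm_inner_le_norm v w
    have hv1 : D⁻¹ * ‖v‖ ≤ 1 := by rwa [inv_mul_le_iff₀ hD0, mul_one]
    have hv0 : 0 ≤ D⁻¹ * ‖v‖ := by positivity
    calc D⁻¹ ^ 3 * ‖⟪v, w⟫‖ * ‖v‖ ≤ D⁻¹ ^ 3 * (‖v‖ * ‖w‖) * ‖v‖ := by gcongr
      _ = (D⁻¹ * ‖v‖) * (D⁻¹ * ‖v‖) * (D⁻¹ * ‖w‖) := by ring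
      _ ≤ 1 * 1 * (D⁻¹ * ‖w‖) := by gcongr
      _ = _ := by ring
  rw [h1]
  linarith

lemma lipschitzWith_smoothNormalize {s : ℝ} (hs : 0 < s) :
    LipschitzWith (2 * (√s)⁻¹).toNNReal (smoothNormalize s : F → F) := by
  have h0 : 0 ≤ 2 * (√s)⁻¹ := by positivity
  refine lipschitzWith_of_nnnorm_fderiv_le
    (fun v => (hasFDerivAt_smoothNormalize hs v).differentiableAt) fun v => ?_
  rw [← NNReal.coe_le_coe, coe_nnnorm, Real.coe_toNNReal _ h0]
  refine ContinuousLinearMap.opNorm_le_bound _ h0 fun w => ?_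
  refine (norm_fderiv_smoothNormalize_apply_le hs v w).trans ?_
  have : √s ≤ √(‖v‖ ^ 2 + s) := Real.sqrt_le_sqrt (by nlinarith [sq_nonneg ‖v‖])
  have := Real.sqrt_pos.2 hs
  gcongr

end Normalize

/-! ### Cutoffs and compactly supported normalized fields -/

section Cutoff

variable {E : Type*} [NormedAddCommGroup E]

/-- A Lipschitz cutoff, equal to `1` on the ball of radius `R` and supported in that of radius
`2 R`. -/
noncomputable def cutoff (R : ℝ) (w : E) : ℝ := max 0 (min 1 (2 - ‖w‖ / R))

lemma cutoff_nonneg (R : ℝ) (w : E) : 0 ≤ cutoff R w := le_max_left _ _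

lemma cutoff_le_one (R : ℝ) (w : E) : cutoff R w ≤ 1 :=
  max_le zero_le_one (min_le_left _ _)

lemma cutoff_eq_one {R : ℝ} (hR : 0 < R) {w : E} (hw : ‖w‖ ≤ R) : cutoff R w = 1 := by
  have : ‖w‖ / R ≤ 1 := (div_le_one hR).2 hw
  rw [cutoff, min_eq_left (by linarith), max_eq_right zero_le_one]

lemma cutoff_eq_zero {R : ℝ} (hR : 0 < R) {w : E} (hw : 2 * R ≤ ‖w‖) : cutoff R w = 0 := by
  have : 2 ≤ ‖w‖ / R := (le_div_iff₀ hR).2 hw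
  rw [cutoff, max_eq_left]
  exact (min_le_right _ _).trans (by linarith)

lemma lipschitzWith_cutoff {R : ℝ} (hR : 0 < R) :
    LipschitzWith (R⁻¹).toNNReal (cutoff R : E → ℝ) := by
  have h : LipschitzWith (R⁻¹).toNNReal (fun w : E => 2 - ‖w‖ / R) := by
    refine LipschitzWith.of_dist_le_mul fun x y => ?_
    rw [Real.coe_toNNReal _ (inv_nonneg.2 hR.le), Real.dist_eq, dist_eq_norm]
    have e : 2 - ‖x‖ / R - (2 - ‖y‖ / R) = R⁻¹ * (‖y‖ - ‖x‖) := by field_simp; ring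
    rw [e, abs_mul, abs_of_pos (inv_pos.2 hR), norm_sub_rev]
    gcongr
    exact abs_norm_sub_norm_le y x
  exact (h.const_min 1).const_max 0

end Cutoff

section CutNormalize

/-- The smoothly normalized field `G`, cut off outside the ball of radius `2 R`. -/
noncomputable def cutNormalize {E F : Type*} [NormedAddCommGroup E] [NormedAddCommGroup F]
    [InnerProductSpace ℝ F] (R s : ℝ) (G : E → F) (w : E) : F :=
  cutoff R w • smoothNormalize s (G w)

section

variable {E F : Type*} [NormedAddCommGroup E] [NormedSpace ℝ E] [FiniteDimensional ℝ E]
  [NormedAddCommGroup F] [InnerProductSpace ℝ F] {G : E → F} {C : E → ℝ} {R s : ℝ}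

lemma norm_cutNormalize_le (hs : 0 < s) (w : E) : ‖cutNormalize R s G w‖ ≤ 1 := by
  rw [cutNormalize, norm_smul, Real.norm_of_nonneg (cutoff_nonneg _ _)]
  exact mul_le_one₀ (cutoff_le_one _ _) (norm_nonneg _) (norm_smoothNormalize_le hs _)

lemma hasCompactSupport_cutNormalize (hR : 0 < R) : HasCompactSupport (cutNormalize R s G) := by
  have : ProperSpace E := FiniteDimensional.proper ℝ E
  refine HasCompactSupport.intro (isCompact_closedBall (0 : E) (2 * R)) fun w hw => ?_
  have : 2 * R ≤ ‖w‖ := by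
    have := hw
    simp only [Metric.mem_closedBall, dist_zero_right, not_le] at this
    exact this.le
  rw [cutNormalize, cutoff_eq_zero hR this, zero_smul]

/-- The field G is only locally Lipschitz, but its increments are controlled by the slope at a
single endpoint. It suffices to use the slope at y when y lies in the support of the cutoff, where C
is bounded. -/
lemma exists_lipschitzWith_cutNormalize (hs : 0 < s) (hR : 0 < R) (hC : Continuous C)
    (h : ∀ x y, ‖G x - G y‖ ≤ C x * ‖x - y‖) : ∃ K, LipschitzWith K (cutNormalize R s G) := by
  have : ProperSpace E := FiniteDimensional.proper ℝ E
  obtain ⟨M, hM⟩ := (isCompact_closedBall (0 : E) (2 * R)).exists_bound_of_continuousOn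
    hC.continuousOn
  have hM0 : 0 ≤ M := (norm_nonneg _).trans (hM 0 (by simp [hR.le]))
  set kN := (2 * (√s)⁻¹).toNNReal
  refine ⟨(R⁻¹ + kN * M).toNNReal, LipschitzWith.of_dist_le_mul fun x y => ?_⟩
  rw [Real.coe_toNNReal _ (by positivity), dist_eq_norm, dist_eq_norm]
  have e : cutNormalize R s G x - cutNormalize R s G y
      = (cutoff R x - cutoff R y) • smoothNormalize s (G x)
        + cutoff R y • (smoothNormalize s (G x) - smoothNormalize s (G y)) := by
    simp only [cutNormalize]; module
  rw [e, add_mul]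
  refine (norm_add_le _ _).trans (add_le_add ?_ ?_)
  · have h1 := (lipschitzWith_cutoff (E := E) hR).dist_le_mul x y
    rw [Real.coe_toNNReal _ (inv_nonneg.2 hR.le), dist_eq_norm, dist_eq_norm] at h1
    rw [norm_smul]
    calc _ ≤ (R⁻¹ * ‖x - y‖) * 1 := by
          gcongr
          exact norm_smoothNormalize_le hs _
      _ = _ := mul_one _
  · rcases le_or_gt (2 * R) ‖y‖ with hy | hy
    · rw [cutoff_eq_zero hR hy, zero_smul, norm_zero]; positivity
    · rw [norm_smul, Real.norm_of_nonneg (cutoff_nonneg _ _)]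
      have h1 := (lipschitzWith_smoothNormalize (F := F) hs).dist_le_mul (G x) (G y)
      rw [dist_eq_norm, dist_eq_norm] at h1
      have h2 : ‖G x - G y‖ ≤ M * ‖x - y‖ := by
        rw [norm_sub_rev, norm_sub_rev x y]
        refine (h y x).trans ?_
        gcongr
        exact (le_abs_self _).trans (hM y (by simpa using hy.le))
      calc _ ≤ 1 * (kN * (M * ‖x - y‖)) := by
            gcongr
            · exact cutoff_le_one _ _
            · exact h1.trans (by gcongr)
        _ = _ := by ring

end

variable {n : ℕ} {G : EuclideanSpace ℝ (Fin n) → EuclideanSpace ℝ (Fin n)} {R s : ℝ}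
  {w : EuclideanSpace ℝ (Fin n)}

/-- In the product rule, differentiating the normalization costs 2/√(‖G‖² + s), and differentiating
the cutoff costs a rank one term of size at most 1/R; the sum of two squares costs a factor 2. -/
lemma frobSq_fderiv_cutNormalize_le (hs : 0 < s) (hR : 0 < R) (hG : DifferentiableAt ℝ G w)
    (hχ : DifferentiableAt ℝ (cutoff R) w) :
    frobSq (fderiv ℝ (cutNormalize R s G) w)
      ≤ 8 * (frobSq (fderiv ℝ G w) / (‖G w‖ ^ 2 + s)) + 2 / R ^ 2 := by
  have hN := hasFDerivAt_smoothNormalize hs (G w)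
  have h1 : HasFDerivAt (fun x => smoothNormalize s (G x))
      ((fderiv ℝ (smoothNormalize s) (G w)).comp (fderiv ℝ G w)) w :=
    (hN.differentiableAt.hasFDerivAt).comp w hG.hasFDerivAt
  have h2 := (hχ.hasFDerivAt.smul h1).fderiv
  have e : fderiv ℝ (cutNormalize R s G) w
      = cutoff R w • ((fderiv ℝ (smoothNormalize s) (G w)).comp (fderiv ℝ G w))
        + (fderiv ℝ (cutoff R) w).smulRight (smoothNormalize s (G w)) := h2
  rw [e]
  refine (frobSq_add_le _ _).trans ?_
  have hD : 0 < ‖G w‖ ^ 2 + s := by positivity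
  have b1 : frobSq (cutoff R w • ((fderiv ℝ (smoothNormalize s) (G w)).comp (fderiv ℝ G w)))
      ≤ (2 * (√(‖G w‖ ^ 2 + s))⁻¹) ^ 2 * frobSq (fderiv ℝ G w) := by
    refine frobSq_le_mul fun v => ?_
    rw [smul_apply, norm_smul, Real.norm_of_nonneg (cutoff_nonneg _ _)]
    refine (mul_le_of_le_one_left (norm_nonneg _) (cutoff_le_one _ _)).trans ?_
    exact norm_fderiv_smoothNormalize_apply_le hs _ _
  have b2 : frobSq ((fderiv ℝ (cutoff R) w).smulRight (smoothNormalize s (G w))) ≤ 1 / R ^ 2 := by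
    have h3 : ‖fderiv ℝ (cutoff R) w‖ ≤ R⁻¹ := by
      have := norm_fderiv_le_of_lipschitz ℝ (lipschitzWith_cutoff
        (E := EuclideanSpace ℝ (Fin n)) hR) (x₀ := w)
      rwa [Real.coe_toNNReal _ (inv_nonneg.2 hR.le)] at this
    have h4 : frobSq ((fderiv ℝ (cutoff R) w).smulRight (smoothNormalize s (G w)))
        ≤ 1 ^ 2 * frobSq (fderiv ℝ (cutoff R) w) := by
      refine frobSq_le_mul fun v => ?_
      rw [smulRight_apply, norm_smul, mul_comm]
      gcongr
      exact norm_smoothNormalize_le hs _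
    refine h4.trans ?_
    have h5 : frobSq (fderiv ℝ (cutoff R) w) = ‖fderiv ℝ (cutoff R) w‖ ^ 2 := by
      rw [← sum_sq_apply_single, frobSq]
      simp
    rw [h5, one_pow, one_mul, one_div, ← inv_pow]
    gcongr
  rw [mul_pow, inv_pow, Real.sq_sqrt hD.le] at b1
  have e1 : 8 * (frobSq (fderiv ℝ G w) / (‖G w‖ ^ 2 + s)) + 2 / R ^ 2
      = 2 * (2 ^ 2 * (‖G w‖ ^ 2 + s)⁻¹ * frobSq (fderiv ℝ G w)) + 2 * (1 / R ^ 2) := by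
    ring
  rw [e1]
  gcongr

/-- Near w the cutoff is identically 1, so only the normalization is differentiated. It contributes
the last term, of third order in 1/√(‖G‖² + s). -/
lemma skorokhod_cutNormalize (hs : 0 < s) (hR : 0 < R) (hw : ‖w‖ < R)
    (hG : DifferentiableAt ℝ G w) :
    skorokhod (cutNormalize R s G) w
      = (⟪G w, w⟫ - clmTrace (fderiv ℝ G w)) / √(‖G w‖ ^ 2 + s)
        + ⟪G w, fderiv ℝ G w (G w)⟫ / √(‖G w‖ ^ 2 + s) ^ 3 := by
  have hev : cutNormalize R s G =ᶠ[𝓝 w] fun x => smoothNormalize s (G x) := by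
    filter_upwards [(isOpen_lt continuous_norm continuous_const).mem_nhds hw] with x hx
    have hx' : ‖x‖ < R := hx
    rw [cutNormalize, cutoff_eq_one hR hx'.le, one_smul]
  have h1 : HasFDerivAt (fun x => smoothNormalize s (G x)) _ w :=
    (hasFDerivAt_smoothNormalize hs (G w)).comp w hG.hasFDerivAt
  rw [skorokhod, hev.fderiv_eq, h1.fderiv, hev.eq_of_nhds]
  set D := √(‖G w‖ ^ 2 + s)
  have e : ∀ i, (((D⁻¹ • (ContinuousLinearMap.id ℝ (EuclideanSpace ℝ (Fin n)))
        + (-(D⁻¹ ^ 3) • innerSL ℝ (G w)).smulRight (G w)).comp (fderiv ℝ G w))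
        (EuclideanSpace.single i 1)) i
      = D⁻¹ * (fderiv ℝ G w (EuclideanSpace.single i 1)) i
        - D⁻¹ ^ 3 * (G w i * ⟪G w, fderiv ℝ G w (EuclideanSpace.single i 1)⟫) := by
    intro i
    simp
    ring
  rw [clmTrace]
  simp_rw [e]
  rw [Finset.sum_sub_distrib, ← Finset.mul_sum, ← Finset.mul_sum, sum_coord_mul_inner,
    smoothNormalize, inner_smul_left, clmTrace]
  simp only [conj_trivial]
  ring

end CutNormalize

/-! ### Scores as functions of the Gaussian direction and the noise -/

section Perturbation

variable {n p : ℕ}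

/-- The rank one matrix `w e_jᵀ`. -/
def colMat (j : Fin p) (w : EuclideanSpace ℝ (Fin n)) : Matrix (Fin n) (Fin p) ℝ :=
  Matrix.of fun i k => if k = j then w i else 0

lemma act_colMat (j : Fin p) (w : EuclideanSpace ℝ (Fin n)) (b : EuclideanSpace ℝ (Fin p)) :
    act (colMat j w) b = b j • w := by
  ext i
  simp [act_apply, colMat, Matrix.mulVec, dotProduct, mul_comm]

lemma act_smul_left (c : ℝ) (X : Matrix (Fin n) (Fin p) ℝ) (b : EuclideanSpace ℝ (Fin p)) :
    act (c • X) b = c • act X b := by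
  ext i; simp [act_apply, Matrix.smul_mulVec]

lemma colMat_sub (j : Fin p) (w w' : EuclideanSpace ℝ (Fin n)) :
    colMat j (w - w') = colMat j w - colMat j w' := by
  ext i k; simp only [colMat, Matrix.of_apply, Matrix.sub_apply]; split_ifs <;> simp

lemma norm_act_colMat_transpose (j : Fin p) (w u : EuclideanSpace ℝ (Fin n)) :
    ‖act (colMat j w)ᵀ u‖ = |⟪w, u⟫| := by
  have e : act (colMat j w)ᵀ u = EuclideanSpace.single j ⟪w, u⟫ := by
    ext k
    simp only [act_apply, colMat, Matrix.mulVec, dotProduct, Matrix.transpose_apply,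
      Matrix.of_apply, PiLp.inner_apply, PiLp.single_apply]
    split_ifs with h <;> simp [mul_comm]
  rw [e]; simp

lemma continuous_colMat (j : Fin p) :
    Continuous (colMat j : EuclideanSpace ℝ (Fin n) → Matrix (Fin n) (Fin p) ℝ) := by
  refine continuous_matrix fun i k => ?_
  simp only [colMat, Matrix.of_apply]
  split_ifs <;> fun_prop

/-- The data `(X, y)` with `X = A + c w e_jᵀ` and `y = X β + e`, as a function of `(w, e)`. -/
noncomputable def pertData (A : Matrix (Fin n) (Fin p) ℝ) (β : EuclideanSpace ℝ (Fin p))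
    (j : Fin p) (c : ℝ) (q : EuclideanSpace ℝ (Fin n) × EuclideanSpace ℝ (Fin n)) :
    Matrix (Fin n) (Fin p) ℝ × EuclideanSpace ℝ (Fin n) :=
  (A + c • colMat j q.1, response (A + c • colMat j q.1) β q.2)

lemma response_eq (X : Matrix (Fin n) (Fin p) ℝ) (β : EuclideanSpace ℝ (Fin p))
    (e : EuclideanSpace ℝ (Fin n)) : response X β e = act X β + e := rfl

lemma continuous_pertData (β : EuclideanSpace ℝ (Fin p)) (j : Fin p) (c : ℝ) :
    Continuous fun q : Matrix (Fin n) (Fin p) ℝ ×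
      (EuclideanSpace ℝ (Fin n) × EuclideanSpace ℝ (Fin n)) => pertData q.1 β j c q.2 := by
  have h1 : Continuous fun q : Matrix (Fin n) (Fin p) ℝ ×
      (EuclideanSpace ℝ (Fin n) × EuclideanSpace ℝ (Fin n)) => q.1 + c • colMat j q.2.1 :=
    continuous_fst.add (((continuous_colMat j).comp (continuous_fst.comp continuous_snd)).const_smul c)
  simp only [pertData, response_eq]
  exact h1.prodMk ((continuous_act.comp (h1.prodMk continuous_const)).add
    (continuous_snd.comp continuous_snd))

variable {ρ : ℝ → ℝ} {L K τ : ℝ} {g : EuclideanSpace ℝ (Fin p) → ℝ}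

/-- The scores as a function of `(w, e)`. -/
noncomputable def pertPsi (ρ : ℝ → ℝ) (g : EuclideanSpace ℝ (Fin p) → ℝ)
    (A : Matrix (Fin n) (Fin p) ℝ) (β : EuclideanSpace ℝ (Fin p)) (j : Fin p) (c : ℝ)
    (q : EuclideanSpace ℝ (Fin n) × EuclideanSpace ℝ (Fin n)) : EuclideanSpace ℝ (Fin n) :=
  psi ρ g (pertData A β j c q).1 (pertData A β j c q).2

/-- The error in the coordinate `j`, as a function of `(w, e)`. -/
noncomputable def pertErr (ρ : ℝ → ℝ) (g : EuclideanSpace ℝ (Fin p) → ℝ)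
    (A : Matrix (Fin n) (Fin p) ℝ) (β : EuclideanSpace ℝ (Fin p)) (j : Fin p) (c : ℝ)
    (q : EuclideanSpace ℝ (Fin n) × EuclideanSpace ℝ (Fin n)) : ℝ :=
  estimator ρ g (pertData A β j c q).1 (pertData A β j c q).2 j - β j

/-- A change of w moves the response by c β_j and, for a frozen estimator b, the fitted values by c
b_j times that change. The residual thus moves by the change of noise minus c (b_j - β_j) times the
change of w. -/
lemma norm_pertPsi_sub_le (hρ : IsRobustLoss ρ L K) (hg : IsStronglyConvexPenalty g τ)
    (hτ : 0 < τ) (hL : 0 < L) (hn : 0 < n) (A : Matrix (Fin n) (Fin p) ℝ)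
    (β : EuclideanSpace ℝ (Fin p)) (j : Fin p) {c : ℝ} (hc : 0 ≤ c)
    (q q' : EuclideanSpace ℝ (Fin n) × EuclideanSpace ℝ (Fin n)) :
    ‖pertPsi ρ g A β j c q - pertPsi ρ g A β j c q'‖
      ≤ L * ‖(q.2 - q'.2) - (c * pertErr ρ g A β j c q) • (q.1 - q'.1)‖
        + √(L / (n * τ)) * c * |⟪q.1 - q'.1, pertPsi ρ g A β j c q⟫| := by
  have h := norm_psi_sub_le hρ hg hτ hL hn (pertData A β j c q).1 (pertData A β j c q').1
    (pertData A β j c q).2 (pertData A β j c q').2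
  have e1 : (pertData A β j c q).1 - (pertData A β j c q').1 = c • colMat j (q.1 - q'.1) := by
    simp only [pertData, colMat_sub, smul_sub]; abel
  rw [e1] at h
  have e2 : (pertData A β j c q).2 - (pertData A β j c q').2
      - act (c • colMat j (q.1 - q'.1)) (estimator ρ g (pertData A β j c q).1 (pertData A β j c q).2)
      = (q.2 - q'.2) - (c * pertErr ρ g A β j c q) • (q.1 - q'.1) := by
    rw [pertErr, act_smul_left, act_colMat]
    simp only [pertData, response_eq, act_add_left, act_smul_left, act_colMat]
    module
  rw [e2, Matrix.transpose_smul, act_smul_left, norm_smul, norm_act_colMat_transpose,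
    Real.norm_of_nonneg hc, ← mul_assoc] at h
  exact h

lemma continuous_pertPsi (hρ : IsRobustLoss ρ L K) (hg : IsStronglyConvexPenalty g τ)
    (hτ : 0 < τ) (hL : 0 < L) (hn : 0 < n) (β : EuclideanSpace ℝ (Fin p)) (j : Fin p) (c : ℝ) :
    Continuous fun q : Matrix (Fin n) (Fin p) ℝ ×
      (EuclideanSpace ℝ (Fin n) × EuclideanSpace ℝ (Fin n)) => pertPsi ρ g q.1 β j c q.2 :=
  (continuous_psi hρ hg hτ hL hn).comp (continuous_pertData β j c)

lemma continuous_pertErr (hρ : IsRobustLoss ρ L K) (hg : IsStronglyConvexPenalty g τ)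
    (hτ : 0 < τ) (hL : 0 < L) (hn : 0 < n) (β : EuclideanSpace ℝ (Fin p)) (j : Fin p) (c : ℝ) :
    Continuous fun q : Matrix (Fin n) (Fin p) ℝ ×
      (EuclideanSpace ℝ (Fin n) × EuclideanSpace ℝ (Fin n)) => pertErr ρ g q.1 β j c q.2 := by
  have h := (continuous_estimator hρ hg hτ hL hn).comp (continuous_pertData β j c)
  have h2 : Continuous fun b : EuclideanSpace ℝ (Fin p) => b j - β j := by fun_prop
  exact h2.comp h

lemma norm_pertPsi_sub_le_slope (hρ : IsRobustLoss ρ L K) (hg : IsStronglyConvexPenalty g τ)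
    (hτ : 0 < τ) (hL : 0 < L) (hn : 0 < n) (A : Matrix (Fin n) (Fin p) ℝ)
    (β : EuclideanSpace ℝ (Fin p)) (j : Fin p) {c : ℝ} (hc : 0 ≤ c)
    (q q' : EuclideanSpace ℝ (Fin n) × EuclideanSpace ℝ (Fin n)) :
    ‖pertPsi ρ g A β j c q - pertPsi ρ g A β j c q'‖
      ≤ (L * (1 + c * |pertErr ρ g A β j c q|)
        + √(L / (n * τ)) * c * ‖pertPsi ρ g A β j c q‖) * ‖q - q'‖ := by
  refine (norm_pertPsi_sub_le hρ hg hτ hL hn A β j hc q q').trans ?_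
  have h1 : ‖q.1 - q'.1‖ ≤ ‖q - q'‖ := norm_fst_le (q - q')
  have h2 : ‖q.2 - q'.2‖ ≤ ‖q - q'‖ := norm_snd_le (q - q')
  have h3 : ‖(q.2 - q'.2) - (c * pertErr ρ g A β j c q) • (q.1 - q'.1)‖
      ≤ ‖q - q'‖ + c * |pertErr ρ g A β j c q| * ‖q - q'‖ := by
    refine (norm_sub_le _ _).trans (add_le_add h2 ?_)
    rw [norm_smul, norm_mul, Real.norm_of_nonneg hc, Real.norm_eq_abs]
    gcongr
  have h4 : |⟪q.1 - q'.1, pertPsi ρ g A β j c q⟫| ≤ ‖q - q'‖ * ‖pertPsi ρ g A β j c q‖ :=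
    (abs_real_inner_le_norm _ _).trans (by gcongr)
  calc _ ≤ L * (‖q - q'‖ + c * |pertErr ρ g A β j c q| * ‖q - q'‖)
        + √(L / (n * τ)) * c * (‖q - q'‖ * ‖pertPsi ρ g A β j c q‖) := by gcongr
    _ = _ := by ring

lemma fderiv_pertPsi_bound (hρ : IsRobustLoss ρ L K) (hg : IsStronglyConvexPenalty g τ)
    (hτ : 0 < τ) (hL : 0 < L) (hn : 0 < n) (A : Matrix (Fin n) (Fin p) ℝ)
    (β : EuclideanSpace ℝ (Fin p)) (j : Fin p) {c : ℝ} (hc : 0 ≤ c)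
    {q : EuclideanSpace ℝ (Fin n) × EuclideanSpace ℝ (Fin n)}
    (hd : DifferentiableAt ℝ (pertPsi ρ g A β j c) q)
    (v : EuclideanSpace ℝ (Fin n) × EuclideanSpace ℝ (Fin n)) :
    ‖fderiv ℝ (pertPsi ρ g A β j c) q v‖
      ≤ L * ‖v.2 - (c * pertErr ρ g A β j c q) • v.1‖
        + √(L / (n * τ)) * c * |⟪v.1, pertPsi ρ g A β j c q⟫| := by
  refine norm_fderiv_le_of_slope hd (N := fun v => L * ‖v.2 - (c * pertErr ρ g A β j c q) • v.1‖
        + √(L / (n * τ)) * c * |⟪v.1, pertPsi ρ g A β j c q⟫|) ?_ ?_ v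
  · intro t v
    have e : (t • v).2 - (c * pertErr ρ g A β j c q) • (t • v).1
        = t • (v.2 - (c * pertErr ρ g A β j c q) • v.1) := by
      simp only [Prod.smul_fst, Prod.smul_snd]; module
    rw [e, norm_smul, Prod.smul_fst, inner_smul_left, abs_mul, Real.norm_eq_abs]
    simp only [conj_trivial]
    ring
  · intro v
    rw [norm_sub_rev]
    have h := norm_pertPsi_sub_le hρ hg hτ hL hn A β j hc q (q + v)
    have e1 : q.1 - (q + v).1 = -v.1 := by simp
    have e2 : q.2 - (q + v).2 = -v.2 := by simp
    rw [e1, e2, inner_neg_left, abs_neg] at h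
    have e3 : -v.2 - (c * pertErr ρ g A β j c q) • (-v.1)
        = -(v.2 - (c * pertErr ρ g A β j c q) • v.1) := by module
    rwa [e3, norm_neg] at h

/-- The trace of the gradient in `y` is that of the derivative in the noise. -/
lemma trace_gradPsi_eq {A : Matrix (Fin n) (Fin p) ℝ} {β : EuclideanSpace ℝ (Fin p)} {j : Fin p}
    {c : ℝ} {q : EuclideanSpace ℝ (Fin n) × EuclideanSpace ℝ (Fin n)}
    (hd : DifferentiableAt ℝ (pertPsi ρ g A β j c) q) :
    (gradPsi ρ g (pertData A β j c q).1 (pertData A β j c q).2).trace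
      = clmTrace ((fderiv ℝ (pertPsi ρ g A β j c) q).comp
        (inr ℝ (EuclideanSpace ℝ (Fin n)) (EuclideanSpace ℝ (Fin n)))) := by
  have e : psi ρ g (pertData A β j c q).1
      = fun y => pertPsi ρ g A β j c (q.1, y - act (pertData A β j c q).1 β) := by
    ext1 y
    simp [pertPsi, pertData, response_eq]
  have e2 : (q.1, (pertData A β j c q).2 - act (pertData A β j c q).1 β) = q := by
    simp [pertData, response_eq]
  have h1 : HasFDerivAt (fun y : EuclideanSpace ℝ (Fin n) =>
      (q.1, y - act (pertData A β j c q).1 β))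
      (inr ℝ (EuclideanSpace ℝ (Fin n)) (EuclideanSpace ℝ (Fin n))) (pertData A β j c q).2 := by
    have := (hasFDerivAt_const (𝕜 := ℝ) q.1 (pertData A β j c q).2).prodMk
      ((hasFDerivAt_id (𝕜 := ℝ) (pertData A β j c q).2).sub_const (act (pertData A β j c q).1 β))
    exact this
  have h2 : HasFDerivAt (pertPsi ρ g A β j c) (fderiv ℝ (pertPsi ρ g A β j c) q)
      (q.1, (pertData A β j c q).2 - act (pertData A β j c q).1 β) := by
    rw [e2]; exact hd.hasFDerivAt
  have h3 : HasFDerivAt (psi ρ g (pertData A β j c q).1) ((fderiv ℝ (pertPsi ρ g A β j c) q).comp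
      (inr ℝ (EuclideanSpace ℝ (Fin n)) (EuclideanSpace ℝ (Fin n)))) (pertData A β j c q).2 := by
    rw [e]
    exact HasFDerivAt.comp (f := fun y : EuclideanSpace ℝ (Fin n) =>
      (q.1, y - act (pertData A β j c q).1 β)) (pertData A β j c q).2 h2 h1
  simp only [gradPsi, Matrix.trace, Matrix.diag, Matrix.of_apply, clmTrace]
  rw [h3.fderiv]

end Perturbation

/-! ### Quadratic forms of the covariance and the precision diagonal -/

section Covariance

variable {p : ℕ} {Sigma : Matrix (Fin p) (Fin p) ℝ} {κ : ℝ}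

lemma dotProduct_mulVec_bounds (hS : Sigma.IsSymm) (hsp : spectrum ℝ Sigma ⊆ Set.Icc κ (1 / κ))
    (v : Fin p → ℝ) :
    κ * (v ⬝ᵥ v) ≤ v ⬝ᵥ (Sigma *ᵥ v) ∧ v ⬝ᵥ (Sigma *ᵥ v) ≤ 1 / κ * (v ⬝ᵥ v) := by
  have hH : Sigma.IsHermitian := by
    rw [Matrix.IsHermitian, Matrix.conjTranspose_eq_transpose_of_trivial]; exact hS
  have hone : ∀ r : ℝ, (algebraMap ℝ (Matrix (Fin p) (Fin p) ℝ) r).IsHermitian := fun r => by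
    rw [Matrix.IsHermitian, Matrix.algebraMap_eq_diagonal, Matrix.diagonal_conjTranspose]; rfl
  have key : ∀ r : ℝ, v ⬝ᵥ ((algebraMap ℝ (Matrix (Fin p) (Fin p) ℝ) r) *ᵥ v) = r * (v ⬝ᵥ v) := by
    intro r
    rw [Algebra.algebraMap_eq_smul_one, Matrix.smul_mulVec, Matrix.one_mulVec, dotProduct_smul,
      smul_eq_mul]
  constructor
  · have h : (Sigma - algebraMap ℝ _ κ).PosSemidef := by
      refine Matrix.posSemidef_iff_isHermitian_and_spectrum_nonneg.2 ⟨hH.sub (hone κ), ?_⟩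
      rw [← spectrum.sub_singleton_eq]
      rintro _ ⟨a, ha, b, hb, rfl⟩
      simp only [Set.mem_singleton_iff] at hb
      have := (hsp ha).1
      simp only [Set.mem_ofPred_eq, hb]; linarith
    have h2 := h.dotProduct_mulVec_nonneg v
    rw [star_trivial, Matrix.sub_mulVec, dotProduct_sub, key] at h2
    linarith
  · have h : (algebraMap ℝ _ (1 / κ) - Sigma).PosSemidef := by
      refine Matrix.posSemidef_iff_isHermitian_and_spectrum_nonneg.2 ⟨(hone _).sub hH, ?_⟩
      rw [← spectrum.singleton_sub_eq]
      rintro _ ⟨b, hb, a, ha, rfl⟩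
      simp only [Set.mem_singleton_iff] at hb
      have := (hsp ha).2
      simp only [Set.mem_ofPred_eq, hb]; linarith
    have h2 := h.dotProduct_mulVec_nonneg v
    rw [star_trivial, Matrix.sub_mulVec, dotProduct_sub, key] at h2
    linarith

lemma ofLp_dotProduct_self (v : EuclideanSpace ℝ (Fin p)) : v.ofLp ⬝ᵥ v.ofLp = ‖v‖ ^ 2 := by
  rw [EuclideanSpace.real_norm_sq_eq]; simp [dotProduct, sq]

lemma posDef_of_spectrum (hκ : 0 < κ) (hS : Sigma.IsSymm)
    (hsp : spectrum ℝ Sigma ⊆ Set.Icc κ (1 / κ)) : Sigma.PosDef := by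
  have hH : Sigma.IsHermitian := by
    rw [Matrix.IsHermitian, Matrix.conjTranspose_eq_transpose_of_trivial]; exact hS
  refine Matrix.PosDef.of_dotProduct_mulVec_pos hH fun {v} hv => ?_
  rw [star_trivial]
  refine lt_of_lt_of_le ?_ (dotProduct_mulVec_bounds hS hsp v).1
  refine mul_pos hκ ?_
  have := Matrix.dotProduct_star_self_pos_iff.2 hv
  rwa [star_trivial] at this

/-- The column `Sigma⁻¹ e_j` of the precision matrix. -/
noncomputable def precCol (Sigma : Matrix (Fin p) (Fin p) ℝ) (j : Fin p) :
    EuclideanSpace ℝ (Fin p) := WithLp.toLp 2 (Sigma⁻¹ *ᵥ Pi.single j 1)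

lemma precCol_apply_self (j : Fin p) : precCol Sigma j j = omega Sigma j := by
  simp [precCol, omega]

lemma mulVec_precCol (hκ : 0 < κ) (hS : Sigma.IsSymm)
    (hsp : spectrum ℝ Sigma ⊆ Set.Icc κ (1 / κ)) (j : Fin p) :
    Sigma *ᵥ (precCol Sigma j).ofLp = Pi.single j 1 := by
  have h := (posDef_of_spectrum hκ hS hsp).det_pos.ne'
  simp only [precCol]
  rw [Matrix.mulVec_mulVec, Matrix.mul_nonsing_inv _ h.isUnit, Matrix.one_mulVec]

lemma omega_pos (hκ : 0 < κ) (hS : Sigma.IsSymm)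
    (hsp : spectrum ℝ Sigma ⊆ Set.Icc κ (1 / κ)) (j : Fin p) : 0 < omega Sigma j :=
  (posDef_of_spectrum hκ hS hsp).inv.diag_pos

lemma dotProduct_mulVec_comm (hS : Sigma.IsSymm) (a b : Fin p → ℝ) :
    a ⬝ᵥ (Sigma *ᵥ b) = b ⬝ᵥ (Sigma *ᵥ a) := by
  rw [Matrix.dotProduct_mulVec, ← Matrix.mulVec_transpose, hS.eq, dotProduct_comm]

/-- The quadratic form of Sigma at e_j - Ω_jj⁻¹ Sigma⁻¹ e_j equals Sigma_jj - Ω_jj⁻¹ and is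
nonnegative, so Ω_jj⁻¹ ≤ Sigma_jj ≤ 1/κ. -/
lemma le_omega (hκ : 0 < κ) (hS : Sigma.IsSymm)
    (hsp : spectrum ℝ Sigma ⊆ Set.Icc κ (1 / κ)) (j : Fin p) : κ ≤ omega Sigma j := by
  have hO := omega_pos hκ hS hsp j
  have hu := mulVec_precCol hκ hS hsp j
  have huj := precCol_apply_self (Sigma := Sigma) j
  set u := (precCol Sigma j).ofLp
  have h := (dotProduct_mulVec_bounds hS hsp (Pi.single j 1 - (omega Sigma j)⁻¹ • u)).1
  have h0 : 0 ≤ (Pi.single j 1 - (omega Sigma j)⁻¹ • u) ⬝ᵥ (Pi.single j 1 - (omega Sigma j)⁻¹ • u) :=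
    Finset.sum_nonneg fun i _ => mul_self_nonneg _
  have h1 : (Pi.single j (1 : ℝ)) ⬝ᵥ (Sigma *ᵥ (Pi.single j 1)) ≤ 1 / κ := by
    refine (dotProduct_mulVec_bounds hS hsp _).2.trans ?_
    simp
  have e : (Pi.single j 1 - (omega Sigma j)⁻¹ • u) ⬝ᵥ
      (Sigma *ᵥ (Pi.single j 1 - (omega Sigma j)⁻¹ • u))
      = (Pi.single j (1 : ℝ)) ⬝ᵥ (Sigma *ᵥ (Pi.single j 1)) - (omega Sigma j)⁻¹ := by
    have e1 : u ⬝ᵥ (Sigma *ᵥ (Pi.single j 1)) = 1 := by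
      rw [dotProduct_mulVec_comm hS, hu]; simp
    have e2 : u ⬝ᵥ Pi.single j 1 = omega Sigma j := by rw [← huj]; simp
    rw [Matrix.mulVec_sub, Matrix.mulVec_smul, hu, dotProduct_sub, sub_dotProduct, sub_dotProduct,
      smul_dotProduct, smul_dotProduct, dotProduct_smul, e1, dotProduct_smul, e2]
    simp only [smul_eq_mul, dotProduct_single, Pi.single_eq_same]
    field_simp
    ring
  rw [e] at h
  have h2 : (omega Sigma j)⁻¹ ≤ κ⁻¹ := by
    rw [one_div] at h1
    have := mul_nonneg hκ.le h0
    linarith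
  exact (inv_le_inv₀ hO hκ).1 h2

end Covariance

/-! ### Splitting the design along the Gaussian direction -/

section RowLaw

variable {p : ℕ} {Sigma : Matrix (Fin p) (Fin p) ℝ} {κ : ℝ}

/-- The part of a row that is independent of its product with `Sigma⁻¹ e_j`. -/
noncomputable def rowResidual (Sigma : Matrix (Fin p) (Fin p) ℝ) (j : Fin p)
    (a : EuclideanSpace ℝ (Fin p)) : EuclideanSpace ℝ (Fin p) :=
  a - ((omega Sigma j)⁻¹ * ⟪precCol Sigma j, a⟫) • EuclideanSpace.single j 1

/-- A row, rebuilt from its residual and an independent standard normal variable. -/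
noncomputable def rowCombine (Sigma : Matrix (Fin p) (Fin p) ℝ) (j : Fin p)
    (q : EuclideanSpace ℝ (Fin p) × ℝ) : EuclideanSpace ℝ (Fin p) :=
  rowResidual Sigma j q.1 + ((√(omega Sigma j))⁻¹ * q.2) • EuclideanSpace.single j 1

lemma continuous_rowResidual (j : Fin p) : Continuous (rowResidual Sigma j) := by
  unfold rowResidual; fun_prop

lemma continuous_rowCombine (j : Fin p) : Continuous (rowCombine Sigma j) := by
  unfold rowCombine
  have := (continuous_rowResidual (Sigma := Sigma) j).comp
    (continuous_fst (X := EuclideanSpace ℝ (Fin p)) (Y := ℝ))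
  exact this.add (by fun_prop)

lemma inner_precCol_rowResidual (hκ : 0 < κ) (hS : Sigma.IsSymm)
    (hsp : spectrum ℝ Sigma ⊆ Set.Icc κ (1 / κ)) (j : Fin p) (a : EuclideanSpace ℝ (Fin p)) :
    ⟪precCol Sigma j, rowResidual Sigma j a⟫ = 0 := by
  have hO := (omega_pos hκ hS hsp j).ne'
  rw [rowResidual, inner_sub_right, inner_smul_right, EuclideanSpace.inner_single_right,
    precCol_apply_self]
  simp only [conj_trivial, one_mul]
  field_simp
  ring

/-- Passing to the residual removes Ω_jj⁻¹ t_j² from the quadratic form of Sigma in the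
characteristic function, and the fresh normal variable restores exactly this. Resampling replaces a
proof that the direction is independent of the residual within the original row. -/
lemma map_rowCombine (hκ : 0 < κ) (hS : Sigma.IsSymm)
    (hsp : spectrum ℝ Sigma ⊆ Set.Icc κ (1 / κ)) (j : Fin p) :
    ((multivariateGaussian 0 Sigma).prod (gaussianReal 0 1)).map (rowCombine Sigma j)
      = multivariateGaussian 0 Sigma := by
  have hO := omega_pos hκ hS hsp j
  have hps := (posDef_of_spectrum hκ hS hsp).posSemidef
  have hm := (continuous_rowCombine (Sigma := Sigma) j).measurable
  have : IsProbabilityMeasure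
      (((multivariateGaussian 0 Sigma).prod (gaussianReal 0 1)).map (rowCombine Sigma j)) :=
    Measure.isProbabilityMeasure_map hm.aemeasurable
  refine Measure.ext_of_charFun ?_
  ext t
  rw [charFun_apply, integral_map hm.aemeasurable (by fun_prop)]
  set t' : EuclideanSpace ℝ (Fin p) := t - ((omega Sigma j)⁻¹ * t j) • precCol Sigma j with ht'
  have e1 : ∀ q : EuclideanSpace ℝ (Fin p) × ℝ,
      Complex.exp (⟪rowCombine Sigma j q, t⟫ * Complex.I)
      = Complex.exp (⟪q.1, t'⟫ * Complex.I)
        * Complex.exp (⟪q.2, (√(omega Sigma j))⁻¹ * t j⟫ * Complex.I) := by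
    intro q
    rw [← Complex.exp_add, ← add_mul]
    congr 2
    norm_cast
    rw [rowCombine, rowResidual, ht']
    simp only [inner_add_left, inner_sub_left, inner_smul_left, inner_sub_right, inner_smul_right,
      EuclideanSpace.inner_single_left, conj_trivial, one_mul]
    rw [real_inner_comm q.1 (precCol Sigma j)]
    simp only [RCLike.inner_apply, conj_trivial]
    ring
  simp_rw [e1]
  rw [integral_prod_mul (μ := multivariateGaussian 0 Sigma) (ν := gaussianReal 0 1)
    (f := fun a => Complex.exp (⟪a, t'⟫ * Complex.I))
    (g := fun s => Complex.exp (⟪s, (√(omega Sigma j))⁻¹ * t j⟫ * Complex.I)),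
    ← charFun_apply, ← charFun_apply, charFun_multivariateGaussian hps,
    charFun_multivariateGaussian hps, charFun_gaussianReal, ← Complex.exp_add]
  congr 1
  have e2 : t'.ofLp ⬝ᵥ (Sigma *ᵥ t'.ofLp) = t.ofLp ⬝ᵥ (Sigma *ᵥ t.ofLp)
      - (omega Sigma j)⁻¹ * t j ^ 2 := by
    have hu := mulVec_precCol hκ hS hsp j
    have e3 : (precCol Sigma j).ofLp ⬝ᵥ (Sigma *ᵥ t.ofLp) = t j := by
      rw [dotProduct_mulVec_comm hS, hu]; simp
    have e4 : (precCol Sigma j).ofLp ⬝ᵥ Pi.single j 1 = omega Sigma j := by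
      rw [← precCol_apply_self]; simp
    rw [ht', WithLp.ofLp_sub, WithLp.ofLp_smul, Matrix.mulVec_sub, Matrix.mulVec_smul, hu,
      dotProduct_sub, sub_dotProduct, sub_dotProduct, smul_dotProduct, smul_dotProduct,
      dotProduct_smul, dotProduct_smul, e3, e4]
    simp only [smul_eq_mul, dotProduct_single]
    field_simp
    ring
  have e5 : ((√(omega Sigma j))⁻¹ * t j) ^ 2 = (omega Sigma j)⁻¹ * t j ^ 2 := by
    rw [mul_pow, inv_pow, Real.sq_sqrt hO.le]
  simp only [e2]
  push_cast
  have e6 : ((((√(omega Sigma j))⁻¹ * t j : ℝ) : ℂ)) ^ 2 = (((omega Sigma j)⁻¹ * t j ^ 2 : ℝ) : ℂ) := by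
    rw [← e5]; push_cast; rfl
  push_cast at e6
  rw [e6]
  simp
  ring

/-- The rows of the design, rebuilt from their residuals and a standard normal vector. -/
noncomputable def designCombine {n : ℕ} (Sigma : Matrix (Fin p) (Fin p) ℝ) (j : Fin p)
    (q : (Fin n → EuclideanSpace ℝ (Fin p)) × EuclideanSpace ℝ (Fin n)) :
    Fin n → EuclideanSpace ℝ (Fin p) := fun i => rowCombine Sigma j (q.1 i, q.2 i)

lemma continuous_designCombine {n : ℕ} (j : Fin p) :
    Continuous (designCombine (n := n) Sigma j) := by
  refine continuous_pi fun i => (continuous_rowCombine j).comp ?_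
  fun_prop

/-- The law of the rows of the design. -/
noncomputable def designLaw (n : ℕ) (Sigma : Matrix (Fin p) (Fin p) ℝ) :
    Measure (Fin n → EuclideanSpace ℝ (Fin p)) :=
  Measure.pi fun _ => multivariateGaussian 0 Sigma

instance {n : ℕ} : IsProbabilityMeasure (designLaw n Sigma) := by
  unfold designLaw; infer_instance

lemma map_designCombine {n : ℕ} (hκ : 0 < κ) (hS : Sigma.IsSymm)
    (hsp : spectrum ℝ Sigma ⊆ Set.Icc κ (1 / κ)) (j : Fin p) :
    ((designLaw n Sigma).prod (stdGaussian (EuclideanSpace ℝ (Fin n)))).map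
      (designCombine Sigma j) = designLaw n Sigma := by
  have hm := (continuous_rowCombine (Sigma := Sigma) j).measurable
  have hp : IsProbabilityMeasure
      (((multivariateGaussian 0 Sigma).prod (gaussianReal 0 1)).map (rowCombine Sigma j)) :=
    Measure.isProbabilityMeasure_map hm.aemeasurable
  have h1 : designLaw n Sigma = (Measure.pi fun _ : Fin n =>
      (multivariateGaussian 0 Sigma).prod (gaussianReal 0 1)).map
        (fun q i => rowCombine Sigma j (q i)) := by
    rw [Measure.pi_map_pi (fun _ => hm.aemeasurable)]
    simp_rw [map_rowCombine hκ hS hsp]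
    rfl
  have h2 := (measurePreserving_arrowProdEquivProdArrow (EuclideanSpace ℝ (Fin p)) ℝ (Fin n)
    (fun _ => multivariateGaussian 0 Sigma) (fun _ => gaussianReal 0 1))
  conv_rhs => rw [h1]
  have h3 : ((designLaw n Sigma).prod (stdGaussian (EuclideanSpace ℝ (Fin n))))
      = ((Measure.pi fun _ => multivariateGaussian 0 Sigma).prod
          (Measure.pi fun _ : Fin n => gaussianReal 0 1)).map
        (Prod.map id (WithLp.toLp 2)) := by
    rw [← Measure.map_prod_map _ _ measurable_id (by fun_prop), Measure.map_id,
      map_pi_eq_stdGaussian]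
    rfl
  have hd : Measurable (designCombine (n := n) Sigma j) := (continuous_designCombine j).measurable
  rw [h3, ← h2.map_eq, Measure.map_map hd (by fun_prop),
    Measure.map_map (hd.comp (by fun_prop)) (MeasurableEquiv.measurable _)]
  rfl

/-- The residual part of the design. -/
noncomputable def designResidual {n : ℕ} (Sigma : Matrix (Fin p) (Fin p) ℝ) (j : Fin p)
    (a : Fin n → EuclideanSpace ℝ (Fin p)) : Matrix (Fin n) (Fin p) ℝ :=
  Matrix.of fun i k => rowResidual Sigma j (a i) k

lemma of_designCombine {n : ℕ} (j : Fin p)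
    (q : (Fin n → EuclideanSpace ℝ (Fin p)) × EuclideanSpace ℝ (Fin n)) :
    Matrix.of (fun i k => designCombine Sigma j q i k)
      = designResidual Sigma j q.1 + (√(omega Sigma j))⁻¹ • colMat j q.2 := by
  ext i k
  simp only [designCombine, rowCombine, designResidual, colMat, Matrix.of_apply, Matrix.add_apply,
    Matrix.smul_apply, PiLp.add_apply, PiLp.smul_apply, PiLp.single_apply, smul_eq_mul]
  split_ifs <;> simp

/-- The residual rows are orthogonal to Sigma⁻¹ e_j, so z_j sees the fresh Gaussian vector only. -/
lemma zvec_designCombine {n : ℕ} (hκ : 0 < κ) (hS : Sigma.IsSymm)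
    (hsp : spectrum ℝ Sigma ⊆ Set.Icc κ (1 / κ)) (j : Fin p)
    (q : (Fin n → EuclideanSpace ℝ (Fin p)) × EuclideanSpace ℝ (Fin n)) :
    zvec (Matrix.of (fun i k => designCombine Sigma j q i k)) Sigma j
      = (√(omega Sigma j))⁻¹ • q.2 := by
  have hO := omega_pos hκ hS hsp j
  ext i
  have e : Sigma⁻¹ *ᵥ ((omega Sigma j)⁻¹ • Pi.single j (1 : ℝ))
      = (omega Sigma j)⁻¹ • (precCol Sigma j).ofLp := by
    rw [Matrix.mulVec_smul, precCol]
  have e2 : (Matrix.of (fun i k => designCombine Sigma j q i k) *ᵥ (precCol Sigma j).ofLp) i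
      = ⟪precCol Sigma j, designCombine Sigma j q i⟫ := by
    simp [Matrix.mulVec, dotProduct, PiLp.inner_apply]
  rw [zvec, e, Matrix.mulVec_smul]
  simp only [Pi.smul_apply, PiLp.smul_apply, smul_eq_mul]
  rw [e2, designCombine, rowCombine, inner_add_right, inner_precCol_rowResidual hκ hS hsp,
    inner_smul_right, EuclideanSpace.inner_single_right, precCol_apply_self]
  simp only [conj_trivial, one_mul, zero_add]
  field_simp

end RowLaw

/-! ### Operator norm of a Gaussian design -/

section OperatorNorm

variable {n p : ℕ} {Sigma : Matrix (Fin p) (Fin p) ℝ} {κ : ℝ}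

lemma map_inner_multivariateGaussian (hS : Sigma.PosSemidef) (v : EuclideanSpace ℝ (Fin p)) :
    (multivariateGaussian 0 Sigma).map (fun a => ⟪a, v⟫)
      = gaussianReal 0 (v.ofLp ⬝ᵥ (Sigma *ᵥ v.ofLp)).toNNReal := by
  have hm : Measurable fun a : EuclideanSpace ℝ (Fin p) => ⟪a, v⟫ := by fun_prop
  have : IsProbabilityMeasure ((multivariateGaussian 0 Sigma).map (fun a => ⟪a, v⟫)) :=
    Measure.isProbabilityMeasure_map hm.aemeasurable
  refine Measure.ext_of_charFun ?_
  ext t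
  rw [charFun_apply, integral_map hm.aemeasurable (by fun_prop)]
  have e : ∀ a : EuclideanSpace ℝ (Fin p), Complex.exp (⟪⟪a, v⟫, t⟫ * Complex.I)
      = Complex.exp (⟪a, t • v⟫ * Complex.I) := by
    intro a
    rw [inner_smul_right]
    simp
  simp_rw [e]
  rw [← charFun_apply, charFun_multivariateGaussian hS, charFun_gaussianReal]
  congr 1
  have h0 : 0 ≤ v.ofLp ⬝ᵥ (Sigma *ᵥ v.ofLp) := by
    have := hS.dotProduct_mulVec_nonneg v.ofLp
    rwa [star_trivial] at this
  rw [Real.coe_toNNReal _ h0]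
  simp [Matrix.mulVec_smul]
  ring

lemma integral_exp_sq_gaussianReal :
    Integrable (fun s : ℝ => exp (s ^ 2 / 4)) (gaussianReal 0 1) ∧
      ∫ s, exp (s ^ 2 / 4) ∂(gaussianReal 0 1) = √2 := by
  have h1 : ∀ s : ℝ, gaussianPDFReal 0 1 s * exp (s ^ 2 / 4)
      = (√(2 * π))⁻¹ * exp (-(1 / 4) * s ^ 2) := by
    intro s
    rw [gaussianPDFReal, mul_assoc, ← Real.exp_add]
    simp only [NNReal.coe_one, mul_one, sub_zero]
    ring_nf
  have hi : Integrable (fun s : ℝ => (√(2 * π))⁻¹ * exp (-(1 / 4) * s ^ 2)) :=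
    (integrable_exp_neg_mul_sq (by norm_num)).const_mul _
  constructor
  · rw [gaussianReal_of_var_ne_zero _ one_ne_zero]
    refine (integrable_withDensity_iff_integrable_smul' (measurable_gaussianPDF 0 1)
      (ae_of_all _ fun _ => gaussianPDF_lt_top)).2 ?_
    simp_rw [toReal_gaussianPDF, smul_eq_mul, h1]
    exact hi
  · rw [integral_gaussianReal_eq_integral_smul one_ne_zero]
    simp_rw [smul_eq_mul, h1]
    rw [integral_const_mul, integral_gaussian, ← Real.sqrt_inv, ← Real.sqrt_mul (by positivity)]
    congr 1
    field_simp
    norm_num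

lemma integral_exp_mul_sq_gaussianReal_le {v : ℝ≥0} {l : ℝ} (hlv : l * v ≤ 1 / 4) :
    Integrable (fun s : ℝ => exp (l * s ^ 2)) (gaussianReal 0 v) ∧
      ∫ s, exp (l * s ^ 2) ∂(gaussianReal 0 v) ≤ √2 := by
  have e : gaussianReal 0 v = (gaussianReal 0 1).map (fun s => √(v : ℝ) * s) := by
    rw [gaussianReal_map_const_mul]
    congr 1
    · simp
    · ext; simp
  have hle : ∀ s : ℝ, exp (l * (√(v : ℝ) * s) ^ 2) ≤ exp (s ^ 2 / 4) := by
    intro s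
    rw [mul_pow, Real.sq_sqrt (NNReal.coe_nonneg v)]
    refine Real.exp_le_exp.2 ?_
    nlinarith [sq_nonneg s]
  have hi : Integrable (fun s : ℝ => exp (l * (√(v : ℝ) * s) ^ 2)) (gaussianReal 0 1) := by
    refine integral_exp_sq_gaussianReal.1.mono' (by fun_prop) (ae_of_all _ fun s => ?_)
    rw [Real.norm_of_nonneg (Real.exp_pos _).le]
    exact hle s
  rw [e]
  constructor
  · rw [integrable_map_measure (by fun_prop) (by fun_prop)]
    exact hi
  · rw [integral_map (by fun_prop) (by fun_prop), ← integral_exp_sq_gaussianReal.2]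
    exact integral_mono hi integral_exp_sq_gaussianReal.1 hle

lemma norm_act_sq (x : Fin n → EuclideanSpace ℝ (Fin p)) (v : EuclideanSpace ℝ (Fin p)) :
    ‖act (Matrix.of fun i k => x i k) v‖ ^ 2 = ∑ i, ⟪x i, v⟫ ^ 2 := by
  rw [EuclideanSpace.real_norm_sq_eq]
  refine Finset.sum_congr rfl fun i _ => ?_
  congr 1
  rw [act_apply]
  simp [Matrix.mulVec, dotProduct, PiLp.inner_apply, mul_comm]

/-- The squared norm is a sum over independent rows, so the exponential moment factorizes; each
factor is at most E exp(s²/4) = √2 for a standard normal s. -/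
lemma integral_exp_norm_act_sq_le (hS : Sigma.PosSemidef) {v : EuclideanSpace ℝ (Fin p)} {l : ℝ}
    (hlv : l * (v.ofLp ⬝ᵥ (Sigma *ᵥ v.ofLp)) ≤ 1 / 4) :
    ∫⁻ x, ENNReal.ofReal (exp (l * ‖act (Matrix.of fun i k => x i k) v‖ ^ 2))
      ∂(designLaw n Sigma) ≤ ENNReal.ofReal (√2 ^ n) := by
  have h0 : 0 ≤ v.ofLp ⬝ᵥ (Sigma *ᵥ v.ofLp) := by
    have := hS.dotProduct_mulVec_nonneg v.ofLp
    rwa [star_trivial] at this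
  have h1 := integral_exp_mul_sq_gaussianReal_le (v := (v.ofLp ⬝ᵥ (Sigma *ᵥ v.ofLp)).toNNReal)
    (by rwa [Real.coe_toNNReal _ h0])
  have hm : Measurable fun a : EuclideanSpace ℝ (Fin p) => ⟪a, v⟫ := by fun_prop
  rw [← map_inner_multivariateGaussian hS, integrable_map_measure (by fun_prop) hm.aemeasurable,
    integral_map hm.aemeasurable (by fun_prop)] at h1
  have e : ∀ x : Fin n → EuclideanSpace ℝ (Fin p),
      exp (l * ‖act (Matrix.of fun i k => x i k) v‖ ^ 2) = ∏ i, exp (l * ⟪x i, v⟫ ^ 2) := by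
    intro x
    rw [norm_act_sq, Finset.mul_sum, Real.exp_sum]
  simp_rw [e]
  have hi : Integrable (fun x : Fin n → EuclideanSpace ℝ (Fin p) => ∏ i, exp (l * ⟪x i, v⟫ ^ 2))
      (designLaw n Sigma) := Integrable.fintype_prod (f := fun _ a => exp (l * ⟪a, v⟫ ^ 2))
        fun _ => h1.1
  rw [← ofReal_integral_eq_lintegral_ofReal hi (ae_of_all _ fun x => by positivity)]
  refine ENNReal.ofReal_le_ofReal ?_
  rw [designLaw, integral_fintype_prod_eq_pow (f := fun a => exp (l * ⟪a, v⟫ ^ 2)),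
    Fintype.card_fin]
  refine pow_le_pow_left₀ (integral_nonneg fun a => (Real.exp_pos _).le) h1.2 n

lemma continuous_of_rows :
    Continuous fun x : Fin n → EuclideanSpace ℝ (Fin p) =>
      (Matrix.of fun i k => x i k : Matrix (Fin n) (Fin p) ℝ) := by
  refine continuous_matrix fun i k => ?_
  have h2 : Continuous fun b : EuclideanSpace ℝ (Fin p) => b k := by fun_prop
  exact h2.comp (continuous_apply i)

lemma exists_norm_eq_opNorm {E F : Type*} [NormedAddCommGroup E] [NormedSpace ℝ E]
    [FiniteDimensional ℝ E] [NormedAddCommGroup F] [NormedSpace ℝ F] (T : E →L[ℝ] F) :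
    ∃ v, ‖v‖ ≤ 1 ∧ ‖T‖ ≤ ‖T v‖ := by
  have : ProperSpace E := FiniteDimensional.proper ℝ E
  obtain ⟨v, hv, hmax⟩ := (isCompact_closedBall (0 : E) 1).exists_isMaxOn
    ⟨0, by simp⟩ (T.continuous.norm.continuousOn)
  refine ⟨v, by simpa using hv, T.opNorm_le_of_unit_norm (norm_nonneg _) fun x hx => ?_⟩
  exact hmax (by simp [hx])

/-- On the ball of radius 1/2 around a norming vector, ‖T v‖ ≥ ‖T‖/2. Averaging over a ball of
radius 3/2 thus replaces the supremum over the sphere, in place of a net; the price is the volume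
ratio 3^p. -/
lemma exp_opNorm_sq_mul_volume_le {F : Type*} [NormedAddCommGroup F] [NormedSpace ℝ F]
    {l : ℝ} (hl : 0 ≤ l) (T : EuclideanSpace ℝ (Fin p) →L[ℝ] F) :
    ENNReal.ofReal (exp (l * ‖T‖ ^ 2 / 4)) *
        volume (Metric.ball (0 : EuclideanSpace ℝ (Fin p)) (1 / 2))
      ≤ ∫⁻ v in Metric.ball (0 : EuclideanSpace ℝ (Fin p)) (3 / 2),
          ENNReal.ofReal (exp (l * ‖T v‖ ^ 2)) := by
  obtain ⟨u, hu, hT⟩ := exists_norm_eq_opNorm T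
  have hsub : Metric.ball u (1 / 2) ⊆ Metric.ball (0 : EuclideanSpace ℝ (Fin p)) (3 / 2) := by
    intro v hv
    have h1 : ‖v - u‖ < 1 / 2 := by simpa [dist_eq_norm] using hv
    have : ‖v‖ ≤ ‖v - u‖ + ‖u‖ := by simpa using norm_add_le (v - u) u
    simp only [Metric.mem_ball, dist_zero_right]; linarith
  calc _ = ENNReal.ofReal (exp (l * ‖T‖ ^ 2 / 4)) * volume (Metric.ball u (1 / 2)) := by
        rw [Measure.addHaar_ball_center _ u]
    _ = ∫⁻ _ in Metric.ball u (1 / 2), ENNReal.ofReal (exp (l * ‖T‖ ^ 2 / 4)) := by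
        rw [setLIntegral_const]
    _ ≤ ∫⁻ v in Metric.ball u (1 / 2), ENNReal.ofReal (exp (l * ‖T v‖ ^ 2)) := by
        refine setLIntegral_mono' Metric.isOpen_ball.measurableSet fun v hv => ?_
        refine ENNReal.ofReal_le_ofReal (Real.exp_le_exp.2 ?_)
        have h1 : ‖u - v‖ < 1 / 2 := by rw [norm_sub_rev]; simpa [dist_eq_norm] using hv
        have h2 : ‖T u‖ ≤ ‖T v‖ + ‖T (u - v)‖ := by
          simpa using norm_add_le (T v) (T (u - v))
        have h3 : ‖T (u - v)‖ ≤ ‖T‖ * (1 / 2) := (T.le_opNorm _).trans (by gcongr)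
        have h4 : ‖T‖ / 2 ≤ ‖T v‖ := by linarith
        have h5 : (‖T‖ / 2) ^ 2 ≤ ‖T v‖ ^ 2 := pow_le_pow_left₀ (by positivity) h4 2
        nlinarith
    _ ≤ _ := lintegral_mono_set hsub

lemma lintegral_exp_opNorm_sq_le (hκ : 0 < κ) (hS : Sigma.IsSymm)
    (hsp : spectrum ℝ Sigma ⊆ Set.Icc κ (1 / κ)) :
    ∫⁻ x, ENNReal.ofReal (exp (κ / 9 * ‖act (Matrix.of fun i k => x i k)‖ ^ 2 / 4))
      ∂(designLaw n Sigma) ≤ ENNReal.ofReal (3 ^ p * √2 ^ n) := by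
  have hps := (posDef_of_spectrum hκ hS hsp).posSemidef
  set V := volume (Metric.ball (0 : EuclideanSpace ℝ (Fin p)) (1 / 2))
  have hV0 : V ≠ 0 := (Metric.measure_ball_pos _ _ (by norm_num)).ne'
  have hVt : V ≠ ⊤ := measure_ball_lt_top.ne
  have hca : Continuous fun q : (Fin n → EuclideanSpace ℝ (Fin p)) × EuclideanSpace ℝ (Fin p) =>
      act (Matrix.of fun i k => q.1 i k) q.2 :=
    continuous_act.comp ((continuous_of_rows.comp continuous_fst).prodMk continuous_snd)
  have hmeas : Measurable fun q : (Fin n → EuclideanSpace ℝ (Fin p)) × EuclideanSpace ℝ (Fin p) =>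
      ENNReal.ofReal (exp (κ / 9 * ‖act (Matrix.of fun i k => q.1 i k) q.2‖ ^ 2)) := by
    have : Continuous fun q : (Fin n → EuclideanSpace ℝ (Fin p)) × EuclideanSpace ℝ (Fin p) =>
      exp (κ / 9 * ‖act (Matrix.of fun i k => q.1 i k) q.2‖ ^ 2) := by fun_prop
    exact this.measurable.ennreal_ofReal
  have h1 : (∫⁻ x, ENNReal.ofReal (exp (κ / 9 * ‖act (Matrix.of fun i k => x i k)‖ ^ 2 / 4))
      ∂(designLaw n Sigma)) * V ≤ ENNReal.ofReal (3 ^ p * √2 ^ n) * V := by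
    rw [← lintegral_mul_const' _ _ hVt]
    calc _ ≤ ∫⁻ x, (∫⁻ v in Metric.ball (0 : EuclideanSpace ℝ (Fin p)) (3 / 2),
          ENNReal.ofReal (exp (κ / 9 * ‖act (Matrix.of fun i k => x i k) v‖ ^ 2)))
          ∂(designLaw n Sigma) :=
          lintegral_mono fun x => exp_opNorm_sq_mul_volume_le (by positivity) _
      _ = ∫⁻ v in Metric.ball (0 : EuclideanSpace ℝ (Fin p)) (3 / 2), ∫⁻ x,
          ENNReal.ofReal (exp (κ / 9 * ‖act (Matrix.of fun i k => x i k) v‖ ^ 2))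
          ∂(designLaw n Sigma) := lintegral_lintegral_swap hmeas.aemeasurable
      _ ≤ ∫⁻ _ in Metric.ball (0 : EuclideanSpace ℝ (Fin p)) (3 / 2),
          ENNReal.ofReal (√2 ^ n) := by
          refine setLIntegral_mono' Metric.isOpen_ball.measurableSet fun v hv => ?_
          refine integral_exp_norm_act_sq_le hps ?_
          have h2 := (dotProduct_mulVec_bounds hS hsp v.ofLp).2
          rw [ofLp_dotProduct_self] at h2
          have h3 : ‖v‖ < 3 / 2 := by simpa using hv
          have h4 : ‖v‖ ^ 2 ≤ (3 / 2) ^ 2 := pow_le_pow_left₀ (norm_nonneg _) h3.le 2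
          -- The exponent κ/9 is chosen so that the ball of radius 3/2 gives exactly the threshold
          -- 1/4.
          calc _ ≤ κ / 9 * (1 / κ * (3 / 2) ^ 2) := by gcongr; exact h2.trans (by gcongr)
            _ = 1 / 4 := by field_simp; norm_num
      _ = ENNReal.ofReal (√2 ^ n) * (ENNReal.ofReal (3 ^ p) * V) := by
          rw [setLIntegral_const]
          congr 1
          have := Measure.addHaar_ball_mul_of_pos (volume : Measure (EuclideanSpace ℝ (Fin p))) 0
            (r := 3) (by norm_num) (1 / 2)
          rw [finrank_euclideanSpace_fin] at this
          rw [← this]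
          norm_num
      _ = _ := by
          rw [← mul_assoc, ← ENNReal.ofReal_mul (by positivity), mul_comm (√2 ^ n)]
  exact (ENNReal.mul_le_mul_iff_left hV0 hVt).1 h1

/-- The expected squared operator norm of a Gaussian design. -/
lemma integral_opNorm_sq_le (hκ : 0 < κ) (hS : Sigma.IsSymm)
    (hsp : spectrum ℝ Sigma ⊆ Set.Icc κ (1 / κ)) :
    Integrable (fun x => ‖act (Matrix.of fun i k => x i k)‖ ^ 2) (designLaw n Sigma) ∧
    ∫ x, ‖act (Matrix.of fun i k => x i k)‖ ^ 2 ∂(designLaw n Sigma)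
      ≤ 36 / κ * (2 * p + n) := by
  have h := lintegral_exp_opNorm_sq_le (n := n) hκ hS hsp
  set N : (Fin n → EuclideanSpace ℝ (Fin p)) → ℝ :=
    fun x => ‖act (Matrix.of fun i k => x i k)‖ ^ 2 with hN
  have hNc : Measurable N := by
    refine (Measurable.norm ?_).pow_const 2
    have hc : Continuous fun X : Matrix (Fin n) (Fin p) ℝ => act X := by
      refine continuous_clm_apply.2 fun v => ?_
      exact continuous_act.comp (continuous_id.prodMk continuous_const)
    exact (hc.comp continuous_of_rows).measurable
  set a : ℝ := log (3 ^ p * √2 ^ n) with ha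
  have hea : exp a = 3 ^ p * √2 ^ n := Real.exp_log (by positivity)
  have hi : Integrable (fun x => exp (κ / 9 * N x / 4)) (designLaw n Sigma) := by
    refine ⟨by fun_prop, ?_⟩
    rw [hasFiniteIntegral_iff_ofReal (ae_of_all _ fun x => (Real.exp_pos _).le)]
    exact h.trans_lt ENNReal.ofReal_lt_top
  have hI : ∫ x, exp (κ / 9 * N x / 4) ∂(designLaw n Sigma) ≤ 3 ^ p * √2 ^ n := by
    rw [integral_eq_lintegral_of_nonneg_ae (ae_of_all _ fun x => (Real.exp_pos _).le) (by fun_prop)]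
    exact ENNReal.toReal_le_of_le_ofReal (by positivity) h
  have hi2 : Integrable (fun x => κ / 36 * N x) (designLaw n Sigma) := by
    refine hi.mono' (by fun_prop) (ae_of_all _ fun x => ?_)
    rw [Real.norm_of_nonneg (by positivity)]
    have := Real.add_one_le_exp (κ / 9 * N x / 4)
    have e : κ / 9 * N x / 4 = κ / 36 * N x := by ring
    rw [e] at this ⊢
    linarith
  have hi3 : Integrable N (designLaw n Sigma) := by
    have := hi2.const_mul (36 / κ)
    refine this.congr (ae_of_all _ fun x => ?_)
    show 36 / κ * (κ / 36 * N x) = N x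
    field_simp
  refine ⟨hi3, ?_⟩
  have h1 : ∫ x, κ / 36 * N x ∂(designLaw n Sigma) ≤ a := by
    -- The tangent of the exponential at a: a form of Jensen's inequality, which turns the
    -- exponential moment bound e^a into the bound a for the mean.
    have hle : ∀ x, κ / 36 * N x ≤ a - 1 + exp (-a) * exp (κ / 9 * N x / 4) := by
      intro x
      rw [← Real.exp_add]
      have := Real.add_one_le_exp (-a + κ / 9 * N x / 4)
      linarith
    refine (integral_mono hi2 ((integrable_const _).add (hi.const_mul _)) hle).trans ?_
    simp only [Pi.add_apply]
    rw [integral_add (integrable_const _) (hi.const_mul _), integral_const_mul]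
    simp only [integral_const, probReal_univ, one_smul]
    have : exp (-a) * ∫ x, exp (κ / 9 * N x / 4) ∂(designLaw n Sigma) ≤ exp (-a) * exp a := by
      rw [hea]; gcongr
    rw [← Real.exp_add] at this
    simp only [neg_add_cancel, Real.exp_zero] at this
    linarith
  rw [integral_const_mul] at h1
  have h2 : a ≤ 2 * p + n := by
    rw [ha, Real.log_mul (by positivity) (by positivity), Real.log_pow, Real.log_pow]
    have h3 : log 3 ≤ 2 := by have := Real.log_le_sub_one_of_pos (x := 3) (by norm_num); linarith
    have h4 : log √2 ≤ 1 := by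
      have := Real.log_le_sub_one_of_pos (x := √2) (by positivity)
      have h5 : √2 ≤ 2 := by rw [Real.sqrt_le_left (by norm_num)]; norm_num
      linarith
    have := mul_le_mul_of_nonneg_left h3 (Nat.cast_nonneg (α := ℝ) p)
    have := mul_le_mul_of_nonneg_left h4 (Nat.cast_nonneg (α := ℝ) n)
    linarith
  calc _ = 36 / κ * (κ / 36 * ∫ x, N x ∂(designLaw n Sigma)) := by field_simp
    _ ≤ 36 / κ * (2 * p + n) := by gcongr; exact h1.trans h2

end OperatorNorm

/-! ### Moments of the squared norm of a Gaussian vector -/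

section ChiSquare

lemma integral_norm_sq_sub_sq_stdGaussian (n : ℕ) :
    Integrable (fun w => (‖w‖ ^ 2 - n) ^ 2) (stdGaussian (EuclideanSpace ℝ (Fin n))) ∧
    ∫ w, (‖w‖ ^ 2 - n) ^ 2 ∂(stdGaussian (EuclideanSpace ℝ (Fin n)))
      = n * Var[fun s : ℝ => s ^ 2; gaussianReal 0 1] := by
  have hL : MemLp (fun s : ℝ => s ^ 2) 2 (gaussianReal 0 1) := by
    have h4 : MemLp (id : ℝ → ℝ) 4 (gaussianReal 0 1) := memLp_id_gaussianReal 4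
    have := h4.mul (q := 4) (r := 2) h4 (hpqr := ⟨by
      rw [← ENNReal.toReal_eq_toReal_iff' (by simp) (by simp)]
      rw [ENNReal.toReal_add (by simp) (by simp)]
      norm_num⟩)
    refine this.ae_eq (ae_of_all _ fun s => ?_)
    simp [sq]
  have h1 : ∫ s : ℝ, s ^ 2 ∂(gaussianReal 0 1) = 1 := by
    have := variance_fun_id_gaussianReal (μ := 0) (v := 1)
    rw [variance_of_integral_eq_zero (by fun_prop) (by simp)] at this
    simpa using this
  have hi : Integrable (fun s : ℝ => s ^ 2) (gaussianReal 0 1) := hL.integrable (by norm_num)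
  have hmp := fun i : Fin n => measurePreserving_eval (fun _ : Fin n => gaussianReal 0 1) i
  set Q := Measure.pi fun _ : Fin n => gaussianReal 0 1 with hQ
  have hie : ∀ i : Fin n, Integrable (fun w : Fin n → ℝ => w i ^ 2) Q :=
    fun i => (hmp i).integrable_comp_of_integrable hi
  have hm : ∀ i : Fin n, ∫ w : Fin n → ℝ, w i ^ 2 ∂Q = 1 := by
    intro i
    rw [← h1, ← (hmp i).map_eq, integral_map (hmp i).aemeasurable (by fun_prop)]
  set Y : (Fin n → ℝ) → ℝ := ∑ i, fun w => w i ^ 2 with hY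
  have hYL : MemLp Y 2 Q := memLp_finsetSum' _ fun i _ => hL.comp_measurePreserving (hmp i)
  have hYm : ∫ w, Y w ∂Q = n := by
    simp only [hY, Finset.sum_apply]
    rw [integral_finsetSum _ fun i _ => hie i]
    simp [hm]
  have hV := variance_sum_pi (μ := fun _ : Fin n => gaussianReal 0 1)
    (X := fun _ s => s ^ 2) fun _ => hL
  have hV2 : Var[Y; Q] = n * Var[fun s : ℝ => s ^ 2; gaussianReal 0 1] := by
    rw [hY, hQ, hV]; simp
  have hYn : ∀ w : Fin n → ℝ, ‖WithLp.toLp 2 w‖ ^ 2 = Y w := by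
    intro w
    rw [EuclideanSpace.real_norm_sq_eq]; simp [hY]
  rw [← map_pi_eq_stdGaussian, integrable_map_measure (by fun_prop) (by fun_prop),
    integral_map (by fun_prop) (by fun_prop)]
  simp only [Function.comp_def, hYn]
  rw [← hV2, variance_eq_integral hYL.aemeasurable, hYm]
  exact ⟨(hYL.sub (memLp_const (n : ℝ))).integrable_sq, rfl⟩

lemma integral_norm_sq_stdGaussian (n : ℕ) :
    ∫ w, ‖w‖ ^ 2 ∂(stdGaussian (EuclideanSpace ℝ (Fin n))) = n := by
  have h := integral_norm_sq_clm_stdGaussian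
    (ContinuousLinearMap.id ℝ (EuclideanSpace ℝ (Fin n)))
  simpa [frobSq] using h

end ChiSquare

/-! ### Small ball estimates for the scores -/

section SmallBall

variable {n p : ℕ} {ρ : ℝ → ℝ} {L K τ κ : ℝ} {g : EuclideanSpace ℝ (Fin p) → ℝ}
  {Sigma : Matrix (Fin p) (Fin p) ℝ}

/-- The score is small only on a short interval. -/
lemma IsRobustLoss.abs_sub_le_of_abs_deriv_lt (hρ : IsRobustLoss ρ L K) (hK : 0 < K) {m : ℝ}
    (hm : m ≤ K / 2) {x y : ℝ} (hx : |deriv ρ x| < m) (hy : |deriv ρ y| < m) :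
    |x - y| ≤ 8 * m / (3 * K ^ 2) := by
  wlog hxy : x ≤ y generalizing x y
  · rw [abs_sub_comm]; exact this hy hx (not_le.1 hxy).le
  rw [abs_sub_comm, abs_of_nonneg (sub_nonneg.2 hxy)]
  have hm0 : 0 < m := (abs_nonneg _).trans_lt hx
  have hmono : MonotoneOn (deriv ρ) (Set.uIcc x y) := hρ.monotone_deriv.monotoneOn _
  have h1 := hmono.intervalIntegral_deriv_mem_uIcc
  have h0 : 0 ≤ deriv ρ y - deriv ρ x := sub_nonneg.2 (hρ.monotone_deriv hxy)
  rw [Set.uIcc_of_le h0] at h1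
  -- By monotonicity |ψ| ≤ m ≤ K/2 on all of [x, y], hence ψ' ≥ 3K²/4 there. The increment of ψ,
  -- less than 2m, dominates the integral of ψ'.
  have h2 : ∫ _ in x..y, (3 / 4 * K ^ 2) ≤ ∫ s in x..y, deriv (deriv ρ) s := by
    refine intervalIntegral.integral_mono_ae_restrict hxy (by simp) hmono.intervalIntegrable_deriv ?_
    filter_upwards [ae_restrict_of_ae hρ.lower, ae_restrict_mem measurableSet_Icc] with s hs hsI
    have h3 : deriv ρ x ≤ deriv ρ s := hρ.monotone_deriv hsI.1
    have h4 : deriv ρ s ≤ deriv ρ y := hρ.monotone_deriv hsI.2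
    have h5 : |deriv ρ s| ≤ m := abs_le.2 ⟨by linarith [(abs_lt.1 hx).1], by linarith [(abs_lt.1 hy).2]⟩
    have h6 : deriv ρ s ^ 2 ≤ (K / 2) ^ 2 := by
      rw [← sq_abs]; exact pow_le_pow_left₀ (abs_nonneg _) (h5.trans hm) 2
    have h7 : K ^ 2 ≤ deriv (deriv ρ) s + deriv ρ s ^ 2 := hs
    show 3 / 4 * K ^ 2 ≤ deriv (deriv ρ) s
    nlinarith
  rw [intervalIntegral.integral_const, smul_eq_mul] at h2
  have h8 := (abs_lt.1 hx).1
  have h9 := (abs_lt.1 hy).2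
  rw [le_div_iff₀ (by positivity)]
  nlinarith [h1.2]

/-- The set lies in an interval of length 2l, and the density is at most 1/(2s) because √(2π) ≥ 2.
-/
lemma gaussianReal_le_of_dist_le {T : Set ℝ} {l : ℝ} (hT : ∀ x ∈ T, ∀ y ∈ T, |x - y| ≤ l)
    {s : ℝ} (hs : 0 < s) : gaussianReal 0 (s ^ 2).toNNReal T ≤ ENNReal.ofReal (l / s) := by
  rcases T.eq_empty_or_nonempty with rfl | ⟨x₀, hx₀⟩
  · simp
  have hv : (s ^ 2).toNNReal ≠ 0 := by simpa using hs.ne'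
  rw [gaussianReal_apply _ hv]
  have hpdf : ∀ x, gaussianPDF 0 (s ^ 2).toNNReal x ≤ ENNReal.ofReal (2 * s)⁻¹ := by
    intro x
    refine ENNReal.ofReal_le_ofReal ?_
    rw [gaussianPDFReal, Real.coe_toNNReal _ (sq_nonneg s), Real.sqrt_mul (by positivity),
      Real.sqrt_sq hs.le]
    have h1 : 2 ≤ √(2 * π) := by
      rw [Real.le_sqrt (by norm_num) (by positivity)]
      nlinarith [Real.pi_gt_three]
    calc _ ≤ (√(2 * π) * s)⁻¹ * 1 := by
          gcongr
          refine Real.exp_le_one_iff.2 ?_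
          rw [neg_div]
          exact neg_nonpos.2 (by positivity)
      _ ≤ _ := by rw [mul_one]; gcongr
  have hsub : T ⊆ Set.Icc (x₀ - l) (x₀ + l) := fun x hx => by
    have := abs_le.1 (hT x hx x₀ hx₀)
    constructor <;> linarith
  calc _ ≤ ∫⁻ _ in T, ENNReal.ofReal (2 * s)⁻¹ := lintegral_mono fun x => hpdf x
    _ = ENNReal.ofReal (2 * s)⁻¹ * volume T := by rw [setLIntegral_const]
    _ ≤ ENNReal.ofReal (2 * s)⁻¹ * volume (Set.Icc (x₀ - l) (x₀ + l)) := by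
        gcongr
    _ = ENNReal.ofReal (l / s) := by
        rw [Real.volume_Icc, ← ENNReal.ofReal_mul (by positivity)]
        congr 1
        field_simp
        ring

/-- The joint law of the rows of the design and of the noise. -/
noncomputable def modelLaw (n : ℕ) (Sigma : Matrix (Fin p) (Fin p) ℝ)
    (ν : Measure (EuclideanSpace ℝ (Fin n))) :
    Measure ((Fin n → EuclideanSpace ℝ (Fin p)) × EuclideanSpace ℝ (Fin n)) :=
  (designLaw n Sigma).prod ν

instance {ν : Measure (EuclideanSpace ℝ (Fin n))} [IsProbabilityMeasure ν] :
    IsProbabilityMeasure (modelLaw n Sigma ν) := by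
  unfold modelLaw; infer_instance

/-- The design matrix with given rows. -/
def rowsMatrix (x : Fin n → EuclideanSpace ℝ (Fin p)) : Matrix (Fin n) (Fin p) ℝ :=
  Matrix.of fun i k => x i k

lemma continuous_rowsMatrix :
    Continuous (rowsMatrix : (Fin n → EuclideanSpace ℝ (Fin p)) → Matrix (Fin n) (Fin p) ℝ) :=
  continuous_of_rows

lemma act_rowsMatrix_apply (x : Fin n → EuclideanSpace ℝ (Fin p)) (v : EuclideanSpace ℝ (Fin p))
    (i : Fin n) : act (rowsMatrix x) v i = ⟪x i, v⟫ := by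
  rw [act_apply]
  simp [rowsMatrix, Matrix.mulVec, dotProduct, PiLp.inner_apply, mul_comm]

/-- A linear predictor has small scores with small probability. -/
lemma modelLaw_norm_score_lt_le (hρ : IsRobustLoss ρ L K) (hK : 0 < K) (hn : 0 < n)
    (hS : Sigma.PosSemidef) {ν : Measure (EuclideanSpace ℝ (Fin n))} [IsProbabilityMeasure ν]
    {v : EuclideanSpace ℝ (Fin p)} {m s : ℝ} (hm0 : 0 < m) (hm : m ≤ K / 2) (hs : 0 < s)
    (hv : v.ofLp ⬝ᵥ (Sigma *ᵥ v.ofLp) = s ^ 2) :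
    (modelLaw n Sigma ν).real {q | ‖score ρ (q.2 - act (rowsMatrix q.1) v)‖ ^ 2 < m ^ 2 * n / 2}
      ≤ 2 * (8 * m / (3 * K ^ 2) / s) := by
  set b := 8 * m / (3 * K ^ 2) / s with hb
  have hb0 : 0 ≤ b := by positivity
  set r : ((Fin n → EuclideanSpace ℝ (Fin p)) × EuclideanSpace ℝ (Fin n)) →
    EuclideanSpace ℝ (Fin n) := fun q => q.2 - act (rowsMatrix q.1) v with hr
  have hrc : Continuous r := continuous_snd.sub (continuous_act.comp
    ((continuous_rowsMatrix.comp continuous_fst).prodMk continuous_const))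
  have hdc : Continuous (deriv ρ) := hρ.contDiff.continuous_deriv (by norm_num)
  set T : Fin n → Set ((Fin n → EuclideanSpace ℝ (Fin p)) × EuclideanSpace ℝ (Fin n)) :=
    fun i => {q | |deriv ρ (r q i)| < m} with hT
  have hTo : ∀ i, MeasurableSet (T i) := by
    intro i
    have : Continuous fun q => |deriv ρ (r q i)| := by fun_prop
    exact (isOpen_lt this continuous_const).measurableSet
  set S := {q | ‖score ρ (r q)‖ ^ 2 < m ^ 2 * n / 2} with hSdef
  have hSo : MeasurableSet S := by
    have : Continuous fun q => ‖score ρ (r q)‖ ^ 2 :=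
      (((continuous_score hρ).comp hrc).norm).pow 2
    exact (isOpen_lt this continuous_const).measurableSet
  have hTb : ∀ i, (modelLaw n Sigma ν).real (T i) ≤ b := by
    intro i
    refine ENNReal.toReal_le_of_le_ofReal hb0 ?_
    -- For fixed noise the residual is a shifted Gaussian variable of variance s², so the bound is
    -- uniform in the law of the noise.
    rw [modelLaw, Measure.prod_apply_symm (hTo i)]
    calc _ ≤ ∫⁻ _, ENNReal.ofReal b ∂ν := by
          refine lintegral_mono fun e => ?_
          have hmi : Measurable fun a : EuclideanSpace ℝ (Fin p) => ⟪a, v⟫ := by fun_prop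
          have e1 : (fun x => (x, e)) ⁻¹' T i
              = (Function.eval i) ⁻¹' ((fun a => ⟪a, v⟫) ⁻¹' {u | |deriv ρ (e i - u)| < m}) := by
            ext x
            simp [hT, hr, act_rowsMatrix_apply]
          have hmU : MeasurableSet {u | |deriv ρ (e i - u)| < m} := by
            have : Continuous fun u => |deriv ρ (e i - u)| := by fun_prop
            exact (isOpen_lt this continuous_const).measurableSet
          have e2 : (designLaw n Sigma) ((fun x => (x, e)) ⁻¹' T i)
              = gaussianReal 0 (s ^ 2).toNNReal {u | |deriv ρ (e i - u)| < m} := by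
            rw [e1, designLaw, (measurePreserving_eval _ i).measure_preimage
              (hmi hmU).nullMeasurableSet, ← Measure.map_apply hmi hmU,
              map_inner_multivariateGaussian hS, hv]
          rw [e2]
          refine gaussianReal_le_of_dist_le (fun x hx y hy => ?_) hs
          have := hρ.abs_sub_le_of_abs_deriv_lt hK hm hx hy
          rwa [sub_sub_sub_cancel_left, abs_sub_comm] at this
      _ = _ := by simp
  -- If the squared norm is below m² n/2, at least half of the scores are below m in absolute value;
  -- the bound then follows from the expected number of such scores.
  have hcount : ∀ q, (n / 2 : ℝ) * S.indicator 1 q ≤ ∑ i, (T i).indicator 1 q := by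
    intro q
    by_cases hq : q ∈ S
    · rw [Set.indicator_of_mem hq]
      have h1 : ∀ i, m ^ 2 * (1 - (T i).indicator 1 q) ≤ (score ρ (r q) i) ^ 2 := by
        intro i
        by_cases hi : q ∈ T i
        · rw [Set.indicator_of_mem hi]; simp; positivity
        · rw [Set.indicator_of_notMem hi]
          have : m ≤ |deriv ρ (r q i)| := not_lt.1 hi
          simp only [sub_zero, mul_one, score]
          rw [← sq_abs (deriv ρ (r q i))]
          exact pow_le_pow_left₀ hm0.le this 2
      have h2 := Finset.sum_le_sum fun i (_ : i ∈ Finset.univ) => h1 i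
      rw [← EuclideanSpace.real_norm_sq_eq, ← Finset.mul_sum, Finset.sum_sub_distrib] at h2
      have h3 : ‖score ρ (r q)‖ ^ 2 < m ^ 2 * n / 2 := hq
      simp only [Finset.sum_const, Finset.card_univ, Fintype.card_fin, nsmul_eq_mul, mul_one] at h2
      have h4 := h2.trans_lt h3
      rw [mul_div_assoc] at h4
      have := lt_of_mul_lt_mul_left h4 (by positivity)
      simp only [Pi.one_apply, mul_one]
      linarith
    · rw [Set.indicator_of_notMem hq, mul_zero]
      exact Finset.sum_nonneg fun i _ => Set.indicator_nonneg (fun _ _ => zero_le_one) _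
  have hint : ∀ {A : Set ((Fin n → EuclideanSpace ℝ (Fin p)) × EuclideanSpace ℝ (Fin n))},
      MeasurableSet A → Integrable
      (A.indicator (1 : (Fin n → EuclideanSpace ℝ (Fin p)) × EuclideanSpace ℝ (Fin n) → ℝ)) (modelLaw n Sigma ν) :=
    fun hA => (integrable_const (1 : ℝ)).indicator hA
  have hI := integral_mono ((hint hSo).const_mul (n / 2 : ℝ))
    (integrable_finsetSum Finset.univ fun i _ => hint (hTo i)) hcount
  rw [integral_const_mul, integral_finsetSum _ fun i _ => hint (hTo i),
    integral_indicator_one hSo] at hI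
  simp only [integral_indicator_one (hTo _)] at hI
  have h5 := Finset.sum_le_sum fun i (_ : i ∈ Finset.univ) => hTb i
  simp only [Finset.sum_const, Finset.card_univ, Fintype.card_fin, nsmul_eq_mul] at h5
  have hn' : (0 : ℝ) < n := by exact_mod_cast hn
  have h6 : (n : ℝ) * (modelLaw n Sigma ν).real S ≤ n * (2 * b) := by linarith
  exact le_of_mul_le_mul_left h6 hn'

/-- Scores of absolutely continuous noise do not all vanish. -/
lemma exists_measure_norm_score_lt_le (hρ : IsRobustLoss ρ L K) (hK : 0 < K) (hn : 0 < n)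
    {ν : Measure (EuclideanSpace ℝ (Fin n))} [IsProbabilityMeasure ν] (hν : ν ≪ volume)
    {η : ℝ} (hη : 0 < η) : ∃ d, 0 < d ∧ ν.real {e | ‖score ρ e‖ < d} ≤ η := by
  set s : ℕ → Set (EuclideanSpace ℝ (Fin n)) := fun k => {e | ‖score ρ e‖ < 1 / ((k : ℝ) + 1)}
  have hs : ∀ k, MeasurableSet (s k) := fun k =>
    (isOpen_lt (continuous_score hρ).norm continuous_const).measurableSet
  have hanti : Antitone s := by
    intro a b hab e he
    have he' : ‖score ρ e‖ < 1 / ((b : ℝ) + 1) := he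
    refine lt_of_lt_of_le he' ?_
    have : (a : ℝ) ≤ b := by exact_mod_cast hab
    gcongr
  have hlim := tendsto_measure_iInter_atTop (μ := ν) (fun k => (hs k).nullMeasurableSet) hanti
    ⟨0, measure_ne_top _ _⟩
  have hnull : ν (⋂ k, s k) = 0 := by
    refine hν ?_
    have hz : ∀ e ∈ ⋂ k, s k, score ρ e = 0 := by
      intro e he
      by_contra hne
      obtain ⟨k, hk⟩ := exists_nat_one_div_lt (norm_pos_iff.2 hne)
      have h1 : ‖score ρ e‖ < 1 / ((k : ℝ) + 1) := Set.mem_iInter.1 he k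
      exact lt_irrefl _ (h1.trans hk)
    set i₀ : Fin n := ⟨0, hn⟩
    rcases (⋂ k, s k).eq_empty_or_nonempty with h | ⟨e₀, he₀⟩
    · rw [h, measure_empty]
    -- Two zeros of ψ are at distance at most 8m/(3K²) for every small m, so ψ has at most one zero
    -- and the event lies in a hyperplane, a null set.
    have hsub : (⋂ k, s k) ⊆ (WithLp.ofLp) ⁻¹' {f : Fin n → ℝ | f i₀ = e₀ i₀} := by
      intro e he
      have h1 : deriv ρ (e i₀) = 0 := congrArg (fun v : EuclideanSpace ℝ (Fin n) => v i₀) (hz e he)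
      have h2 : deriv ρ (e₀ i₀) = 0 := congrArg (fun v : EuclideanSpace ℝ (Fin n) => v i₀) (hz e₀ he₀)
      have h3 : ∀ m, 0 < m → m ≤ K / 2 → |e i₀ - e₀ i₀| ≤ 8 * m / (3 * K ^ 2) := fun m hm0 hm =>
        hρ.abs_sub_le_of_abs_deriv_lt hK hm (by rw [h1]; simpa) (by rw [h2]; simpa)
      show e i₀ = e₀ i₀
      by_contra hne
      have h4 : 0 < |e i₀ - e₀ i₀| := abs_pos.2 (sub_ne_zero.2 hne)
      have h5 := h3 (min (K / 2) (|e i₀ - e₀ i₀| * (3 * K ^ 2) / 16)) (by positivity) (min_le_left _ _)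
      have h6 : 8 * min (K / 2) (|e i₀ - e₀ i₀| * (3 * K ^ 2) / 16) / (3 * K ^ 2)
          ≤ |e i₀ - e₀ i₀| / 2 := by
        rw [div_le_iff₀ (by positivity)]
        linarith [min_le_right (K / 2) (|e i₀ - e₀ i₀| * (3 * K ^ 2) / 16)]
      linarith
    refine measure_mono_null hsub ?_
    rw [(PiLp.volume_preserving_ofLp (Fin n)).measure_preimage
      (measurableSet_eq_fun (by fun_prop) (by fun_prop)).nullMeasurableSet, volume_pi]
    exact Measure.pi_hyperplane (fun _ : Fin n => (volume : Measure ℝ)) i₀ (e₀ i₀)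
  rw [hnull] at hlim
  have hev := hlim.eventually (gt_mem_nhds (ENNReal.ofReal_pos.2 hη))
  obtain ⟨k, hk⟩ := hev.exists
  exact ⟨1 / ((k : ℝ) + 1), by positivity, ENNReal.toReal_le_of_le_ofReal hη.le hk.le⟩

end SmallBall

/-! ### Choice of the regularization level -/

section Model

variable {n p : ℕ} {ρ : ℝ → ℝ} {L K τ κ : ℝ} {g : EuclideanSpace ℝ (Fin p) → ℝ}
  {Sigma : Matrix (Fin p) (Fin p) ℝ} {β : EuclideanSpace ℝ (Fin p)}

/-- The response as a function of the rows and the noise. -/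
noncomputable def modelResponse (β : EuclideanSpace ℝ (Fin p))
    (q : (Fin n → EuclideanSpace ℝ (Fin p)) × EuclideanSpace ℝ (Fin n)) :
    EuclideanSpace ℝ (Fin n) := response (rowsMatrix q.1) β q.2

/-- The scores as a function of the rows and the noise. -/
noncomputable def modelPsi (ρ : ℝ → ℝ) (g : EuclideanSpace ℝ (Fin p) → ℝ)
    (β : EuclideanSpace ℝ (Fin p))
    (q : (Fin n → EuclideanSpace ℝ (Fin p)) × EuclideanSpace ℝ (Fin n)) :
    EuclideanSpace ℝ (Fin n) := psi ρ g (rowsMatrix q.1) (modelResponse β q)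

/-- The estimation error as a function of the rows and the noise. -/
noncomputable def modelErr (ρ : ℝ → ℝ) (g : EuclideanSpace ℝ (Fin p) → ℝ)
    (β : EuclideanSpace ℝ (Fin p))
    (q : (Fin n → EuclideanSpace ℝ (Fin p)) × EuclideanSpace ℝ (Fin n)) :
    EuclideanSpace ℝ (Fin p) := estimator ρ g (rowsMatrix q.1) (modelResponse β q) - β

lemma continuous_modelData (β : EuclideanSpace ℝ (Fin p)) :
    Continuous fun q : (Fin n → EuclideanSpace ℝ (Fin p)) × EuclideanSpace ℝ (Fin n) =>
      (rowsMatrix q.1, modelResponse β q) := by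
  have h1 : Continuous fun q : (Fin n → EuclideanSpace ℝ (Fin p)) × EuclideanSpace ℝ (Fin n) =>
      rowsMatrix q.1 := continuous_rowsMatrix.comp continuous_fst
  exact h1.prodMk ((continuous_act.comp (h1.prodMk continuous_const)).add continuous_snd)

lemma continuous_modelPsi (hρ : IsRobustLoss ρ L K) (hg : IsStronglyConvexPenalty g τ)
    (hτ : 0 < τ) (hL : 0 < L) (hn : 0 < n) : Continuous (modelPsi (n := n) ρ g β) :=
  (continuous_psi hρ hg hτ hL hn).comp (continuous_modelData β)

lemma continuous_modelErr (hρ : IsRobustLoss ρ L K) (hg : IsStronglyConvexPenalty g τ)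
    (hτ : 0 < τ) (hL : 0 < L) (hn : 0 < n) : Continuous (modelErr (n := n) ρ g β) :=
  ((continuous_estimator hρ hg hτ hL hn).comp (continuous_modelData β)).sub continuous_const

lemma squaredError_eq (q : (Fin n → EuclideanSpace ℝ (Fin p)) × EuclideanSpace ℝ (Fin n)) :
    squaredError ρ g Sigma β (rowsMatrix q.1) (modelResponse β q)
      = (modelErr ρ g β q).ofLp ⬝ᵥ (Sigma *ᵥ (modelErr ρ g β q).ofLp) := rfl

/-- The minimizer of the penalty, relative to `β`. -/
noncomputable def penaltyBias (n : ℕ) (ρ : ℝ → ℝ) (g : EuclideanSpace ℝ (Fin p) → ℝ)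
    (β : EuclideanSpace ℝ (Fin p)) : EuclideanSpace ℝ (Fin p) :=
  estimator ρ g (0 : Matrix (Fin n) (Fin p) ℝ) 0 - β

lemma norm_modelErr_sub_le (hρ : IsRobustLoss ρ L K) (hg : IsStronglyConvexPenalty g τ)
    (hτ : 0 < τ) (hn : 0 < n)
    (q : (Fin n → EuclideanSpace ℝ (Fin p)) × EuclideanSpace ℝ (Fin n)) :
    n * τ * ‖modelErr ρ g β q - penaltyBias n ρ g β‖
      ≤ ‖act (rowsMatrix q.1)‖ * ‖modelPsi ρ g β q‖ := by
  have h := norm_estimator_sub_argmin_le hρ hg hτ hn (rowsMatrix q.1) (modelResponse β q) 0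
  rw [modelErr, penaltyBias, sub_sub_sub_cancel_right]
  exact h

/-- Small scores force the estimator close to the minimizer of the penalty, so the scores there are
small too. This transfers the small ball bound from a deterministic predictor to the estimator,
which depends on the design. -/
lemma norm_score_bias_le (hρ : IsRobustLoss ρ L K) (hg : IsStronglyConvexPenalty g τ)
    (hτ : 0 < τ) (hL : 0 < L) (hn : 0 < n)
    (q : (Fin n → EuclideanSpace ℝ (Fin p)) × EuclideanSpace ℝ (Fin n)) :
    ‖score ρ (q.2 - act (rowsMatrix q.1) (penaltyBias n ρ g β))‖
      ≤ (1 + L * ‖act (rowsMatrix q.1)‖ ^ 2 / (n * τ)) * ‖modelPsi ρ g β q‖ := by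
  have hnt : 0 < n * τ := by positivity
  have h1 := norm_modelErr_sub_le (β := β) hρ hg hτ hn q
  have e1 : modelPsi ρ g β q = score ρ (q.2 - act (rowsMatrix q.1) (modelErr ρ g β q)) := by
    rw [modelPsi, psi_eq_score, modelErr, map_sub]
    congr 1
    rw [modelResponse, response_eq]
    abel
  have h2 := hρ.norm_score_sub_le hL (q.2 - act (rowsMatrix q.1) (penaltyBias n ρ g β))
    (q.2 - act (rowsMatrix q.1) (modelErr ρ g β q))
  have e2 : q.2 - act (rowsMatrix q.1) (penaltyBias n ρ g β)
      - (q.2 - act (rowsMatrix q.1) (modelErr ρ g β q))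
      = act (rowsMatrix q.1) (modelErr ρ g β q - penaltyBias n ρ g β) := by
    rw [map_sub]; abel
  rw [e2, ← e1] at h2
  have h3 := (act (rowsMatrix q.1)).le_opNorm (modelErr ρ g β q - penaltyBias n ρ g β)
  have h4 : ‖modelErr ρ g β q - penaltyBias n ρ g β‖
      ≤ ‖act (rowsMatrix q.1)‖ * ‖modelPsi ρ g β q‖ / (n * τ) := by
    rw [le_div_iff₀ hnt]; linarith
  have h5 := norm_add_le (score ρ (q.2 - act (rowsMatrix q.1) (penaltyBias n ρ g β))
    - modelPsi ρ g β q) (modelPsi ρ g β q)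
  rw [sub_add_cancel] at h5
  calc _ ≤ L * (‖act (rowsMatrix q.1)‖ *
        (‖act (rowsMatrix q.1)‖ * ‖modelPsi ρ g β q‖ / (n * τ))) + ‖modelPsi ρ g β q‖ := by
        refine h5.trans (add_le_add (h2.trans ?_) le_rfl)
        gcongr
        exact h3.trans (by gcongr)
    _ = _ := by ring

/-- The error is split at the minimizer of the penalty: the distance to it is proportional to the
norm of the scores and is divided by ‖ψ‖², while the deterministic bias is divided by s. -/
lemma energy_le (hρ : IsRobustLoss ρ L K) (hg : IsStronglyConvexPenalty g τ)
    (hτ : 0 < τ) (hn : 0 < n) {s : ℝ} (hs : 0 < s)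
    (q : (Fin n → EuclideanSpace ℝ (Fin p)) × EuclideanSpace ℝ (Fin n)) :
    n * ‖modelErr ρ g β q‖ ^ 2 / (‖modelPsi ρ g β q‖ ^ 2 + s)
      ≤ 2 * ‖act (rowsMatrix q.1)‖ ^ 2 / (n * τ ^ 2) + 2 * n * ‖penaltyBias n ρ g β‖ ^ 2 / s := by
  have hn' : (0 : ℝ) < n := by exact_mod_cast hn
  have h1 := norm_modelErr_sub_le (β := β) hρ hg hτ hn q
  set h := modelErr ρ g β q
  set h0 := penaltyBias n ρ g β
  set N := ‖act (rowsMatrix q.1)‖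
  set P := ‖modelPsi ρ g β q‖
  have h2 : (n * τ * ‖h - h0‖) ^ 2 ≤ (N * P) ^ 2 := pow_le_pow_left₀ (by positivity) h1 2
  have h3 : ‖h‖ ^ 2 ≤ 2 * ‖h - h0‖ ^ 2 + 2 * ‖h0‖ ^ 2 := by
    have h4 : ‖h‖ ≤ ‖h - h0‖ + ‖h0‖ := by simpa using norm_add_le (h - h0) h0
    have h5 := pow_le_pow_left₀ (norm_nonneg _) h4 2
    nlinarith [sq_nonneg (‖h - h0‖ - ‖h0‖)]
  have h6 : n * ‖h - h0‖ ^ 2 ≤ N ^ 2 / (n * τ ^ 2) * P ^ 2 := by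
    rw [div_mul_eq_mul_div, le_div_iff₀ (by positivity)]
    nlinarith
  rw [div_le_iff₀ (by positivity)]
  have h7 : 0 ≤ 2 * N ^ 2 / (n * τ ^ 2) * s := by positivity
  have h8 : 0 ≤ 2 * n * ‖h0‖ ^ 2 / s * P ^ 2 := by positivity
  have e9 : 2 * n * ‖h0‖ ^ 2 / s * s = 2 * n * ‖h0‖ ^ 2 := by field_simp
  have e10 : 2 * N ^ 2 / (n * τ ^ 2) * P ^ 2 = 2 * (N ^ 2 / (n * τ ^ 2) * P ^ 2) := by ring
  calc n * ‖h‖ ^ 2 ≤ n * (2 * ‖h - h0‖ ^ 2 + 2 * ‖h0‖ ^ 2) := by gcongr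
    _ ≤ _ := by
      rw [add_mul, mul_add, mul_add, mul_add, e9, e10]
      linarith

/-- The expected squared operator norm of the design under the joint law. -/
lemma integral_modelLaw_opNorm_sq_le (hκ : 0 < κ) (hS : Sigma.IsSymm)
    (hsp : spectrum ℝ Sigma ⊆ Set.Icc κ (1 / κ))
    {ν : Measure (EuclideanSpace ℝ (Fin n))} [IsProbabilityMeasure ν]
    {γ : ℝ} (hn : 0 < n) (hγ : (p : ℝ) / n ≤ γ) :
    Integrable (fun q => ‖act (rowsMatrix q.1)‖ ^ 2) (modelLaw n Sigma ν) ∧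
      ∫ q, ‖act (rowsMatrix q.1)‖ ^ 2 ∂(modelLaw n Sigma ν) ≤ 36 / κ * (2 * γ + 1) * n := by
  have h := integral_opNorm_sq_le (n := n) hκ hS hsp
  have hi : Integrable (fun q => ‖act (rowsMatrix q.1)‖ ^ 2) (modelLaw n Sigma ν) :=
    h.1.comp_fst ν
  refine ⟨hi, ?_⟩
  have e : ∫ q, ‖act (rowsMatrix q.1)‖ ^ 2 ∂(modelLaw n Sigma ν)
      = ∫ x, ‖act (rowsMatrix x)‖ ^ 2 ∂(designLaw n Sigma) := by
    rw [modelLaw, integral_fun_fst (f := fun x => ‖act (rowsMatrix x)‖ ^ 2)]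
    simp
  rw [e]
  refine h.2.trans ?_
  have hn' : (0 : ℝ) < n := by exact_mod_cast hn
  have hp : (p : ℝ) ≤ γ * n := (div_le_iff₀ hn').1 hγ
  rw [mul_assoc]
  gcongr
  linarith

/-- Off the event ‖X‖² ≥ A n, of probability at most η/2 by Markov, small scores of the estimator
imply small scores at the minimizer of the penalty. -/
lemma modelLaw_norm_psi_lt_le (hρ : IsRobustLoss ρ L K) (hg : IsStronglyConvexPenalty g τ)
    (hτ : 0 < τ) (hL : 0 < L) (hn : 0 < n) (hκ : 0 < κ) (hS : Sigma.IsSymm)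
    (hsp : spectrum ℝ Sigma ⊆ Set.Icc κ (1 / κ))
    {ν : Measure (EuclideanSpace ℝ (Fin n))} [IsProbabilityMeasure ν]
    {γ : ℝ} (hγ : (p : ℝ) / n ≤ γ) {η d A : ℝ} (hA : 0 < A)
    (hA2 : 36 / κ * (2 * γ + 1) ≤ A * (η / 2))
    (hd : (modelLaw n Sigma ν).real
      {q | ‖score ρ (q.2 - act (rowsMatrix q.1) (penaltyBias n ρ g β))‖ ^ 2 < d} ≤ η / 2) :
    (modelLaw n Sigma ν).real {q | ‖modelPsi ρ g β q‖ ^ 2 < d / (1 + L * A / τ) ^ 2} ≤ η := by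
  have hn' : (0 : ℝ) < n := by exact_mod_cast hn
  have hX := integral_modelLaw_opNorm_sq_le (ν := ν) hκ hS hsp hn hγ
  have hM := mul_meas_ge_le_integral_of_nonneg (ae_of_all _ fun q => by positivity) hX.1 (A * n)
  have h1 : (modelLaw n Sigma ν).real {q | A * n ≤ ‖act (rowsMatrix q.1)‖ ^ 2} ≤ η / 2 := by
    have h2 : A * n * (modelLaw n Sigma ν).real {q | A * n ≤ ‖act (rowsMatrix q.1)‖ ^ 2}
        ≤ A * n * (η / 2) := by
      refine hM.trans (hX.2.trans ?_)
      calc _ ≤ A * (η / 2) * n := by gcongr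
        _ = _ := by ring
    exact le_of_mul_le_mul_left h2 (by positivity)
  have hsub : {q : (Fin n → EuclideanSpace ℝ (Fin p)) × EuclideanSpace ℝ (Fin n) |
      ‖modelPsi ρ g β q‖ ^ 2 < d / (1 + L * A / τ) ^ 2}
      ⊆ {q | ‖score ρ (q.2 - act (rowsMatrix q.1) (penaltyBias n ρ g β))‖ ^ 2 < d}
        ∪ {q | A * n ≤ ‖act (rowsMatrix q.1)‖ ^ 2} := by
    intro q hq
    by_contra hne
    simp only [Set.mem_union, Set.mem_ofPred_eq, not_or, not_lt, not_le] at hne hq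
    obtain ⟨ha, hb⟩ := hne
    have h3 := norm_score_bias_le (β := β) hρ hg hτ hL hn q
    have h4 : 1 + L * ‖act (rowsMatrix q.1)‖ ^ 2 / (n * τ) ≤ 1 + L * A / τ := by
      have : L * ‖act (rowsMatrix q.1)‖ ^ 2 / (n * τ) ≤ L * (A * n) / (n * τ) := by gcongr
      have e : L * (A * n) / (n * τ) = L * A / τ := by field_simp
      linarith
    have hB : 0 < 1 + L * A / τ := by positivity
    have h5 : ‖score ρ (q.2 - act (rowsMatrix q.1) (penaltyBias n ρ g β))‖ ^ 2
        ≤ ((1 + L * A / τ) * ‖modelPsi ρ g β q‖) ^ 2 :=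
      pow_le_pow_left₀ (norm_nonneg _) (h3.trans (by gcongr)) 2
    rw [lt_div_iff₀ (by positivity)] at hq
    nlinarith
  calc _ ≤ _ := measureReal_mono hsub
    _ ≤ η / 2 + η / 2 := (measureReal_union_le _ _).trans (add_le_add hd h1)
    _ = η := by ring

/-- A regularization level that is rarely attained by the squared norm of the scores, and for which
the normalized squared errors have a bounded sum. -/
theorem exists_regularization {γ R η : ℝ} (hγ : 0 < γ) (hη : 0 < η) (hκ : 0 < κ)
    (hτ : 0 < τ) (hL : 0 < L) (hK : 0 < K) :
    ∃ C : ℝ, ∀ (n p : ℕ), 0 < n → (p : ℝ) / n ≤ γ → ∀ (ρ : ℝ → ℝ), IsRobustLoss ρ L K →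
      ∀ (g : EuclideanSpace ℝ (Fin p) → ℝ), IsStronglyConvexPenalty g τ →
      ∀ (Sigma : Matrix (Fin p) (Fin p) ℝ), Sigma.IsSymm →
        spectrum ℝ Sigma ⊆ Set.Icc κ (1 / κ) →
      ∀ (β : EuclideanSpace ℝ (Fin p)) (ν : Measure (EuclideanSpace ℝ (Fin n)))
        [IsProbabilityMeasure ν], ν ≪ volume →
      Integrable (fun q => squaredError ρ g Sigma β (rowsMatrix q.1) (modelResponse β q))
        (modelLaw n Sigma ν) →
      ∫ q, squaredError ρ g Sigma β (rowsMatrix q.1) (modelResponse β q) ∂(modelLaw n Sigma ν) ≤ R →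
      ∃ s : ℝ, 0 < s ∧ (modelLaw n Sigma ν).real {q | ‖modelPsi ρ g β q‖ ^ 2 < s} ≤ η ∧
        Integrable (fun q => n * ‖modelErr ρ g β q‖ ^ 2 / (‖modelPsi ρ g β q‖ ^ 2 + s))
          (modelLaw n Sigma ν) ∧
        ∫ q, n * ‖modelErr ρ g β q‖ ^ 2 / (‖modelPsi ρ g β q‖ ^ 2 + s) ∂(modelLaw n Sigma ν)
          ≤ C := by
  set C0 := 36 / κ * (2 * γ + 1) with hC0
  have hC0p : 0 < C0 := by positivity
  set A := 2 * C0 / η with hA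
  have hAp : 0 < A := by positivity
  set B := 1 + L * A / τ with hB
  have hBp : 0 < B := by positivity
  -- This makes the small ball probability 2 (8 c t / (3K²)) / t equal to η/2.
  set c := 3 * K ^ 2 * η / 32 with hc
  have hcp : 0 < c := by positivity
  refine ⟨8 * B ^ 2 / K ^ 2 * (R / κ) + 2 / τ ^ 2 * C0 + 4 * B ^ 2 / (κ * c ^ 2), ?_⟩
  intro n p hn hpn ρ hρ g hg Sigma hS hsp β ν _ hν hi hI
  have hn' : (0 : ℝ) < n := by exact_mod_cast hn
  have hX := integral_modelLaw_opNorm_sq_le (ν := ν) hκ hS hsp hn hpn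
  have hA2 : 36 / κ * (2 * γ + 1) ≤ A * (η / 2) := by
    rw [← hC0, hA]; field_simp; rfl
  set h0 := penaltyBias n ρ g β with hh0
  have hq0 := dotProduct_mulVec_bounds hS hsp h0.ofLp
  rw [ofLp_dotProduct_self] at hq0
  -- the error is controlled by the squared error
  have herr : ∀ q, ‖modelErr (n := n) ρ g β q‖ ^ 2
      ≤ 1 / κ * squaredError ρ g Sigma β (rowsMatrix q.1) (modelResponse β q) := by
    intro q
    have := (dotProduct_mulVec_bounds hS hsp (modelErr ρ g β q).ofLp).1
    rw [ofLp_dotProduct_self, ← squaredError_eq] at this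
    rw [one_div, ← div_eq_inv_mul, le_div_iff₀ hκ]
    linarith
  have hie : Integrable (fun q => ‖modelErr (n := n) ρ g β q‖ ^ 2) (modelLaw n Sigma ν) := by
    refine (hi.const_mul (1 / κ)).mono'
      ((continuous_modelErr hρ hg hτ hL hn).norm.pow 2).aestronglyMeasurable
      (ae_of_all _ fun q => ?_)
    rw [Real.norm_of_nonneg (by positivity)]
    exact herr q
  have hIe : ∫ q, ‖modelErr (n := n) ρ g β q‖ ^ 2 ∂(modelLaw n Sigma ν) ≤ R / κ := by
    refine (integral_mono hie (hi.const_mul (1 / κ)) herr).trans ?_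
    rw [integral_const_mul, one_div, ← div_eq_inv_mul]
    gcongr
  -- it suffices to find a level with a pointwise bound
  suffices H : ∃ s : ℝ, 0 < s ∧ (modelLaw n Sigma ν).real {q | ‖modelPsi ρ g β q‖ ^ 2 < s} ≤ η ∧
      ∀ q : (Fin n → EuclideanSpace ℝ (Fin p)) × EuclideanSpace ℝ (Fin n),
        n * ‖modelErr ρ g β q‖ ^ 2 / (‖modelPsi ρ g β q‖ ^ 2 + s)
        ≤ 8 * B ^ 2 / K ^ 2 * ‖modelErr ρ g β q‖ ^ 2
          + 2 / (n * τ ^ 2) * ‖act (rowsMatrix q.1)‖ ^ 2 + 4 * B ^ 2 / (κ * c ^ 2) by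
    obtain ⟨s, hs, hprob, hpt⟩ := H
    have hib : Integrable (fun q => 8 * B ^ 2 / K ^ 2 * ‖modelErr (n := n) ρ g β q‖ ^ 2
          + 2 / (n * τ ^ 2) * ‖act (rowsMatrix q.1)‖ ^ 2 + 4 * B ^ 2 / (κ * c ^ 2))
        (modelLaw n Sigma ν) :=
      ((hie.const_mul _).add (hX.1.const_mul _)).add (integrable_const _)
    have hfi : Integrable (fun q => n * ‖modelErr ρ g β q‖ ^ 2 / (‖modelPsi ρ g β q‖ ^ 2 + s))
        (modelLaw n Sigma ν) := by
      refine hib.mono' (Continuous.aestronglyMeasurable ?_) (ae_of_all _ fun q => ?_)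
      · refine Continuous.div (((continuous_modelErr hρ hg hτ hL hn).norm.pow 2).const_smul
          (n : ℝ)) (((continuous_modelPsi hρ hg hτ hL hn).norm.pow 2).add continuous_const)
          fun q => by positivity
      · rw [Real.norm_of_nonneg (by positivity)]
        exact hpt q
    refine ⟨s, hs, hprob, hfi, (integral_mono hfi hib hpt).trans ?_⟩
    have i1 := hie.const_mul (8 * B ^ 2 / K ^ 2)
    have i2 := hX.1.const_mul (2 / (n * τ ^ 2))
    have i3 : Integrable (fun q => 8 * B ^ 2 / K ^ 2 * ‖modelErr (n := n) ρ g β q‖ ^ 2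
          + 2 / (n * τ ^ 2) * ‖act (rowsMatrix q.1)‖ ^ 2) (modelLaw n Sigma ν) := i1.add i2
    rw [integral_add i3 (integrable_const _), integral_add i1 i2, integral_const_mul,
      integral_const_mul]
    simp only [integral_const, probReal_univ, one_smul]
    have e : 2 / τ ^ 2 * C0 = 2 / (n * τ ^ 2) * (C0 * n) := by field_simp
    rw [e]
    gcongr
    exact hX.2
  -- Without bias the residuals at the minimizer of the penalty are the noise itself. The level then
  -- depends on the noise law, which is harmless since the energy bound no longer involves s.
  by_cases h0z : h0 = 0
  · obtain ⟨d, hd, hdp⟩ := exists_measure_norm_score_lt_le hρ hK hn hν (half_pos hη)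
    refine ⟨d ^ 2 / B ^ 2, by positivity, ?_, fun q => ?_⟩
    · refine modelLaw_norm_psi_lt_le hρ hg hτ hL hn hκ hS hsp hpn hAp hA2 ?_
      refine le_trans (le_of_eq ?_) hdp
      rw [← hh0, h0z]
      have e : {q : (Fin n → EuclideanSpace ℝ (Fin p)) × EuclideanSpace ℝ (Fin n) |
          ‖score ρ (q.2 - act (rowsMatrix q.1) 0)‖ ^ 2 < d ^ 2}
          = Prod.snd ⁻¹' {e | ‖score ρ e‖ < d} := by
        ext q
        simp only [map_zero, sub_zero, Set.mem_ofPred_eq, Set.mem_preimage]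
        exact sq_lt_sq₀ (norm_nonneg _) hd.le
      have hm : MeasurableSet {e : EuclideanSpace ℝ (Fin n) | ‖score ρ e‖ < d} :=
        (isOpen_lt (continuous_score hρ).norm continuous_const).measurableSet
      rw [e, measureReal_def, modelLaw, measurePreserving_snd.measure_preimage hm.nullMeasurableSet,
        measureReal_def]
    · have h := energy_le (β := β) hρ hg hτ hn (s := d ^ 2 / B ^ 2) (by positivity) q
      rw [← hh0, h0z, norm_zero] at h
      have e : 2 * ‖act (rowsMatrix q.1)‖ ^ 2 / (n * τ ^ 2) + 2 * n * (0 : ℝ) ^ 2 / (d ^ 2 / B ^ 2)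
          = 2 / (n * τ ^ 2) * ‖act (rowsMatrix q.1)‖ ^ 2 := by ring
      rw [e] at h
      have h1 : 0 ≤ 8 * B ^ 2 / K ^ 2 * ‖modelErr ρ g β q‖ ^ 2 := by positivity
      have h2 : 0 ≤ 4 * B ^ 2 / (κ * c ^ 2) := by positivity
      linarith
  · have hn0 : 0 < ‖h0‖ := norm_pos_iff.2 h0z
    have hv0 : 0 < h0.ofLp ⬝ᵥ (Sigma *ᵥ h0.ofLp) := lt_of_lt_of_le (by positivity) hq0.1
    set t := √(h0.ofLp ⬝ᵥ (Sigma *ᵥ h0.ofLp)) with ht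
    have htp : 0 < t := Real.sqrt_pos.2 hv0
    have ht2 : h0.ofLp ⬝ᵥ (Sigma *ᵥ h0.ofLp) = t ^ 2 := (Real.sq_sqrt hv0.le).symm
    -- If the minimum is K/2, then s is of order n and the squared error bounds the energy. If it is
    -- c t, then s is of order n t² and compensates the bias n ‖h0‖² ≤ n t²/κ.
    set m := min (K / 2) (c * t) with hm
    have hmp : 0 < m := lt_min (by positivity) (by positivity)
    have hsb := modelLaw_norm_score_lt_le (ν := ν) hρ hK hn
      (posDef_of_spectrum hκ hS hsp).posSemidef hmp (min_le_left _ _) htp ht2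
    refine ⟨m ^ 2 * n / 2 / B ^ 2, by positivity, ?_, fun q => ?_⟩
    · refine modelLaw_norm_psi_lt_le hρ hg hτ hL hn hκ hS hsp hpn hAp hA2 (hsb.trans ?_)
      have h1 : m ≤ c * t := min_le_right _ _
      calc _ ≤ 2 * (8 * (c * t) / (3 * K ^ 2) / t) := by gcongr
        _ = η / 2 := by rw [hc]; field_simp; norm_num
    · rcases min_choice (K / 2) (c * t) with hmc | hmc
      · have h1 : n * ‖modelErr ρ g β q‖ ^ 2 / (‖modelPsi ρ g β q‖ ^ 2 + m ^ 2 * n / 2 / B ^ 2)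
            ≤ n * ‖modelErr ρ g β q‖ ^ 2 / (m ^ 2 * n / 2 / B ^ 2) := by
          gcongr
          linarith [sq_nonneg ‖modelPsi ρ g β q‖]
        have e : n * ‖modelErr ρ g β q‖ ^ 2 / (m ^ 2 * n / 2 / B ^ 2)
            = 8 * B ^ 2 / K ^ 2 * ‖modelErr ρ g β q‖ ^ 2 := by
          rw [hm, hmc]; field_simp; norm_num
        have h2 : 0 ≤ 2 / (n * τ ^ 2) * ‖act (rowsMatrix q.1)‖ ^ 2 := by positivity
        have h3 : 0 ≤ 4 * B ^ 2 / (κ * c ^ 2) := by positivity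
        linarith
      · have h := energy_le (β := β) hρ hg hτ hn (s := m ^ 2 * n / 2 / B ^ 2) (by positivity) q
        have h1 : ‖h0‖ ^ 2 ≤ t ^ 2 / κ := by
          rw [le_div_iff₀ hκ, ← ht2]; linarith [hq0.1]
        have h2 : 2 * n * ‖h0‖ ^ 2 / (m ^ 2 * n / 2 / B ^ 2)
            ≤ 2 * n * (t ^ 2 / κ) / (m ^ 2 * n / 2 / B ^ 2) := by gcongr
        have e : 2 * n * (t ^ 2 / κ) / (m ^ 2 * n / 2 / B ^ 2) = 4 * B ^ 2 / (κ * c ^ 2) := by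
          rw [hm, hmc]; field_simp; norm_num
        have e2 : 2 * ‖act (rowsMatrix q.1)‖ ^ 2 / (n * τ ^ 2)
            = 2 / (n * τ ^ 2) * ‖act (rowsMatrix q.1)‖ ^ 2 := by ring
        have h3 : 0 ≤ 8 * B ^ 2 / K ^ 2 * ‖modelErr ρ g β q‖ ^ 2 := by positivity
        rw [← hh0] at h
        linarith

end Model

/-! ### Normal approximation for a Gaussian field -/

section NormalApproximation

lemma measureReal_le_integral_div {α : Type*} [MeasurableSpace α] {μ : Measure α}
    [IsProbabilityMeasure μ] {f : α → ℝ} (hf : ∀ x, 0 ≤ f x) (hi : Integrable f μ) {c : ℝ}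
    (hc : 0 < c) : μ.real {x | c ≤ f x} ≤ (∫ x, f x ∂μ) / c := by
  rw [le_div_iff₀ hc, mul_comm]
  exact mul_meas_ge_le_integral_of_nonneg (ae_of_all _ hf) hi c

lemma stdNormalCDF_eq (t : ℝ) : stdNormalCDF t = (gaussianReal 0 1).real (Set.Iic t) := by
  rw [stdNormalCDF, cdf_eq_real]

lemma stdNormalCDF_add_le (t : ℝ) {l : ℝ} (hl : 0 ≤ l) :
    stdNormalCDF (t + l) ≤ stdNormalCDF t + l := by
  rw [stdNormalCDF_eq, stdNormalCDF_eq]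
  have h1 : Set.Iic (t + l) ⊆ Set.Iic t ∪ Set.Ioc t (t + l) := by
    intro x hx
    rcases le_or_gt x t with h | h
    · exact Or.inl h
    · exact Or.inr ⟨h, hx⟩
  have h2 : gaussianReal 0 ((1 : ℝ) ^ 2).toNNReal (Set.Ioc t (t + l)) ≤ ENNReal.ofReal (l / 1) := by
    refine gaussianReal_le_of_dist_le (fun x hx y hy => abs_le.2 ⟨?_, ?_⟩) one_pos
    · linarith [hx.1, hy.2]
    · linarith [hx.2, hy.1]
  simp only [one_pow, Real.toNNReal_one, div_one] at h2
  refine (measureReal_mono h1).trans ((measureReal_union_le _ _).trans ?_)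
  gcongr
  exact ENNReal.toReal_le_of_le_ofReal hl h2

/-- Comparison of distribution functions of random variables that are often close. -/
lemma abs_measureReal_le_sub_stdNormalCDF_le {α : Type*} [MeasurableSpace α] {μ : Measure α}
    [IsProbabilityMeasure μ] {Z Y : α → ℝ} (hY : μ.map Y = gaussianReal 0 1)
    (hYm : Measurable Y) {l : ℝ} (hl : 0 ≤ l) (t : ℝ) :
    |μ.real {x | Z x ≤ t} - stdNormalCDF t| ≤ l + μ.real {x | l < |Z x - Y x|} := by
  have hc : ∀ u, μ.real {x | Y x ≤ u} = stdNormalCDF u := by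
    intro u
    rw [stdNormalCDF_eq, ← hY, measureReal_def, measureReal_def,
      Measure.map_apply hYm measurableSet_Iic]
    rfl
  have h1 : μ.real {x | Z x ≤ t} ≤ stdNormalCDF (t + l) + μ.real {x | l < |Z x - Y x|} := by
    rw [← hc]
    refine (measureReal_mono (fun x hx => ?_)).trans (measureReal_union_le _ _)
    by_cases h : l < |Z x - Y x|
    · exact Or.inr h
    · left
      have h2 : Z x ≤ t := hx
      have := (abs_le.1 (not_lt.1 h)).1
      show Y x ≤ t + l
      linarith
  have h2 : stdNormalCDF (t - l) ≤ μ.real {x | Z x ≤ t} + μ.real {x | l < |Z x - Y x|} := by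
    rw [← hc]
    refine (measureReal_mono (fun x hx => ?_)).trans (measureReal_union_le _ _)
    by_cases h : l < |Z x - Y x|
    · exact Or.inr h
    · left
      have h2 : Y x ≤ t - l := hx
      have := (abs_le.1 (not_lt.1 h)).2
      show Z x ≤ t
      linarith
  have h3 := stdNormalCDF_add_le t hl
  have h4 := stdNormalCDF_add_le (t - l) hl
  rw [sub_add_cancel] at h4
  rw [abs_le]
  constructor <;> linarith

variable {n : ℕ}

lemma map_inner_stdGaussian {u : EuclideanSpace ℝ (Fin n)} (hu : ‖u‖ = 1) :
    (stdGaussian (EuclideanSpace ℝ (Fin n))).map (fun w => ⟪w, u⟫) = gaussianReal 0 1 := by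
  rw [← multivariateGaussian_zero_one, map_inner_multivariateGaussian Matrix.PosSemidef.one]
  rw [Matrix.one_mulVec, ofLp_dotProduct_self, hu]
  simp

lemma exists_unit_smul_eq (hn : 0 < n) (m : EuclideanSpace ℝ (Fin n)) :
    ∃ u : EuclideanSpace ℝ (Fin n), ‖u‖ = 1 ∧ m = ‖m‖ • u := by
  by_cases hm : m = 0
  · exact ⟨EuclideanSpace.single ⟨0, hn⟩ 1, by simp, by simp [hm]⟩
  · refine ⟨‖m‖⁻¹ • m, ?_, ?_⟩
    · rw [norm_smul, norm_inv, norm_norm, inv_mul_cancel₀ (norm_ne_zero_iff.2 hm)]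
    · rw [smul_smul, mul_inv_cancel₀ (norm_ne_zero_iff.2 hm), one_smul]

lemma integrable_skorokhod_sub_sq {f : EuclideanSpace ℝ (Fin n) → EuclideanSpace ℝ (Fin n)}
    {C : ℝ≥0} (hf : LipschitzWith C f) {B : ℝ} (hB : ∀ w, ‖f w‖ ≤ B)
    (m : EuclideanSpace ℝ (Fin n)) :
    Integrable (fun w => (skorokhod f w - ⟪w, m⟫) ^ 2)
      (stdGaussian (EuclideanSpace ℝ (Fin n))) := by
  have hB0 : 0 ≤ B := (norm_nonneg _).trans (hB 0)
  have hi : Integrable (fun w : EuclideanSpace ℝ (Fin n) =>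
      2 * (n * C) ^ 2 + 2 * (B + ‖m‖) ^ 2 * ‖w‖ ^ 2) (stdGaussian (EuclideanSpace ℝ (Fin n))) :=
    (integrable_const _).add (integrable_norm_sq_stdGaussian.const_mul _)
  have hmeas : Measurable (skorokhod f) := by
    refine (hf.continuous.inner continuous_id).measurable.sub ?_
    have hc : Measurable (clmTrace (ι := Fin n)) := continuous_clmTrace.measurable
    exact hc.comp (measurable_fderiv ℝ f)
  refine hi.mono' ((hmeas.sub (by fun_prop)).pow_const 2).aestronglyMeasurable
    (ae_of_all _ fun w => ?_)
  rw [Real.norm_of_nonneg (sq_nonneg _), ← sq_abs]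
  have h1 : |skorokhod f w - ⟪w, m⟫| ≤ n * C + (B + ‖m‖) * ‖w‖ := by
    have h2 : |⟪f w, w⟫| ≤ B * ‖w‖ := (abs_real_inner_le_norm _ _).trans (by gcongr; exact hB w)
    have h3 : |⟪w, m⟫| ≤ ‖w‖ * ‖m‖ := abs_real_inner_le_norm _ _
    have h4 : |clmTrace (fderiv ℝ f w)| ≤ n * C := by
      refine (abs_clmTrace_le _).trans ?_
      rw [Fintype.card_fin]
      gcongr
      exact norm_fderiv_le_of_lipschitz ℝ hf
    rw [skorokhod]
    have h5 := abs_sub (⟪f w, w⟫ - clmTrace (fderiv ℝ f w)) ⟪w, m⟫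
    have h6 := abs_sub ⟪f w, w⟫ (clmTrace (fderiv ℝ f w))
    linarith
  calc |skorokhod f w - ⟪w, m⟫| ^ 2 ≤ (n * C + (B + ‖m‖) * ‖w‖) ^ 2 :=
        pow_le_pow_left₀ (abs_nonneg _) h1 2
    _ ≤ _ := by nlinarith [sq_nonneg (n * C - (B + ‖m‖) * ‖w‖)]

/-- The pointwise core of the normal approximation: `z` is the statistic, `r = ‖ψ‖ / D` is the norm
of the normalized field, `M` is the norm of its mean, `y` is the normal variable. -/
lemma abs_sub_le_of_normalized {z r M y k d l N : ℝ} (hr : 1 / 2 ≤ r) (hN : 0 < N)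
    (hd : |r - M| ≤ d) (hd2 : d ≤ l / (8 * N)) (hy : |y| ≤ N)
    (hk : |z * r - M * y| ≤ k) (hk2 : k ≤ 3 * l / 8) : |z - y| ≤ l := by
  have h1 : r * |z - y| ≤ k + d * N := by
    have e : r * (z - y) = (z * r - M * y) - (r - M) * y := by ring
    have e' : r * |z - y| = |r * (z - y)| := by
      rw [abs_mul, abs_of_nonneg (by linarith : (0 : ℝ) ≤ r)]
    rw [e', e]
    refine (abs_sub _ _).trans (add_le_add hk ?_)
    rw [abs_mul]
    exact mul_le_mul hd hy (abs_nonneg _) ((abs_nonneg _).trans hd)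
  have h2 : d * N ≤ l / 8 := by
    calc d * N ≤ l / (8 * N) * N := by gcongr
      _ = l / 8 := by field_simp
  have h3 : 1 / 2 * |z - y| ≤ r * |z - y| := by gcongr
  linarith

/-- The variance of the square of a standard normal variable. -/
noncomputable def chiVariance : ℝ := Var[fun s : ℝ => s ^ 2; gaussianReal 0 1]

/-- The total error of the normal approximation. -/
noncomputable def approxError (l N R k₁ k₂ k₄ v : ℝ) : ℝ :=
  (1 + chiVariance) / N ^ 2 + (128 * N ^ 2 + 192) / l ^ 2 * (8 * (k₁ * v + k₂) + 2 / R ^ 2)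
    + 64 * k₄ ^ 2 * (1 + N) ^ 2 / l ^ 2 * v

/-- The statistic Z times the norm of the normalized field is close to its divergence, which is
close to ⟪w, m⟫; the norm itself is close to ‖m‖. So Z is close to ⟪w, m/‖m‖⟫. `V` controls both the
Dirichlet energy and the error of the divergence, and each comparison fails with a probability
bounded by Markov; these probabilities make up `approxError`. -/
theorem normal_approximation (hn : 0 < n)
    {G : EuclideanSpace ℝ (Fin n) → EuclideanSpace ℝ (Fin n)} {C : EuclideanSpace ℝ (Fin n) → ℝ}
    (hC : Continuous C) (hG : ∀ x y, ‖G x - G y‖ ≤ C x * ‖x - y‖) {s R : ℝ} (hs : 0 < s)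
    (hR : 0 < R) {V : EuclideanSpace ℝ (Fin n) → ℝ} (hV : ∀ w, 0 ≤ V w)
    (hVi : Integrable V (stdGaussian (EuclideanSpace ℝ (Fin n))))
    {Z : EuclideanSpace ℝ (Fin n) → ℝ} {k₁ k₂ k₃ k₄ l N : ℝ}
    (hk₄ : 0 ≤ k₄) (hl : 0 < l) (hN : 0 < N) (hk₃ : k₃ ≤ l / 8)
    (h₁ : ∀ᵐ w ∂(stdGaussian (EuclideanSpace ℝ (Fin n))),
      frobSq (fderiv ℝ G w) ≤ (‖G w‖ ^ 2 + s) * (k₁ * V w + k₂))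
    (h₂ : ∀ᵐ w ∂(stdGaussian (EuclideanSpace ℝ (Fin n))), ‖w‖ < R →
      s ≤ ‖G w‖ ^ 2 → |Z w * (‖G w‖ / √(‖G w‖ ^ 2 + s)) - skorokhod (cutNormalize R s G) w|
        ≤ k₃ + k₄ * √(V w) * (1 + |‖w‖ ^ 2 - n| / √n)) (t : ℝ) :
    |(stdGaussian (EuclideanSpace ℝ (Fin n))).real {w | Z w ≤ t} - stdNormalCDF t|
      ≤ l + ((stdGaussian (EuclideanSpace ℝ (Fin n))).real {w | R ≤ ‖w‖}
        + (stdGaussian (EuclideanSpace ℝ (Fin n))).real {w | ‖G w‖ ^ 2 < s}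
        + approxError l N R k₁ k₂ k₄ (∫ w, V w ∂(stdGaussian (EuclideanSpace ℝ (Fin n))))) := by
  set γ := stdGaussian (EuclideanSpace ℝ (Fin n)) with hγ
  set f := cutNormalize R s G with hf
  obtain ⟨Kf, hfL⟩ := exists_lipschitzWith_cutNormalize (R := R) hs hR hC hG
  have hfc : HasCompactSupport f := hasCompactSupport_cutNormalize hR
  have hP := gaussian_poincare_of_lipschitz hfL hfc
  have hfB : ∀ w, ‖f w‖ ≤ 1 := norm_cutNormalize_le hs
  set m := ∫ w, f w ∂γ with hm
  set F := ∫ w, frobSq (fderiv ℝ f w) ∂γ with hF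
  obtain ⟨u, hu, hmu⟩ := exists_unit_smul_eq hn m
  have hn' : (0 : ℝ) < n := by exact_mod_cast hn
  set v := ∫ w, V w ∂γ with hv
  have hv0 : 0 ≤ v := integral_nonneg hV
  -- the Dirichlet energy
  have hFle : F ≤ 8 * (k₁ * v + k₂) + 2 / R ^ 2 := by
    have hGd : ∀ᵐ w ∂γ, DifferentiableAt ℝ G w :=
      stdGaussian_absolutelyContinuous.ae_le (ae_differentiableAt_of_slope volume hC hG)
    have hχd : ∀ᵐ w ∂γ, DifferentiableAt ℝ (cutoff R) w :=
      stdGaussian_absolutelyContinuous.ae_le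
        (lipschitzWith_cutoff (E := EuclideanSpace ℝ (Fin n)) hR).ae_differentiableAt
    have hi : Integrable (fun w => 8 * (k₁ * V w + k₂) + 2 / R ^ 2) γ :=
      (((hVi.const_mul k₁).add (integrable_const k₂)).const_mul 8).add (integrable_const _)
    have h : F ≤ ∫ w, (8 * (k₁ * V w + k₂) + 2 / R ^ 2) ∂γ := by
      refine integral_mono_of_nonneg (ae_of_all _ fun w => frobSq_nonneg _) hi ?_
      filter_upwards [hGd, hχd, h₁] with w hw1 hw2 hw3
      refine (frobSq_fderiv_cutNormalize_le hs hR hw1 hw2).trans ?_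
      gcongr
      rw [div_le_iff₀ (by positivity), mul_comm]
      exact hw3
    refine h.trans (le_of_eq ?_)
    have i1 : Integrable (fun w => 8 * (k₁ * V w + k₂)) γ :=
      ((hVi.const_mul k₁).add (integrable_const k₂)).const_mul 8
    rw [integral_add i1 (integrable_const _), integral_const_mul,
      integral_add (hVi.const_mul k₁) (integrable_const k₂), integral_const_mul]
    simp [← hv]
  -- the exceptional events
  have hfi : Integrable (fun w => ‖f w - m‖ ^ 2) γ := by
    refine (integrable_const ((1 + ‖m‖) ^ 2)).mono'
      (((hfL.continuous.sub continuous_const).norm.pow 2).aestronglyMeasurable)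
      (ae_of_all _ fun w => ?_)
    rw [Real.norm_of_nonneg (sq_nonneg _)]
    exact pow_le_pow_left₀ (norm_nonneg _) ((norm_sub_le _ _).trans (by gcongr; exact hfB w)) 2
  have hsi := integrable_skorokhod_sub_sq hfL hfB m
  have hχ := integral_norm_sq_sub_sq_stdGaussian n
  have p3 : γ.real {w | N ^ 2 ≤ ⟪w, u⟫ ^ 2} ≤ 1 / N ^ 2 := by
    refine (measureReal_le_integral_div (fun w => sq_nonneg _)
      (integrable_inner_sq_stdGaussian u) (by positivity)).trans ?_
    rw [integral_inner_sq_stdGaussian, hu, one_pow]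
  have p4 : γ.real {w | (l / (8 * N)) ^ 2 ≤ ‖f w - m‖ ^ 2} ≤ 128 * N ^ 2 / l ^ 2 * F := by
    refine (measureReal_le_integral_div (fun w => sq_nonneg _) hfi (by positivity)).trans ?_
    rw [div_le_iff₀ (by positivity)]
    have e : 128 * N ^ 2 / l ^ 2 * F * (l / (8 * N)) ^ 2 = 2 * F := by field_simp; ring
    rw [e]
    exact hP.1
  have p5 : γ.real {w | (l / 8) ^ 2 ≤ (skorokhod f w - ⟪w, m⟫) ^ 2} ≤ 192 / l ^ 2 * F := by
    refine (measureReal_le_integral_div (fun w => sq_nonneg _) hsi (by positivity)).trans ?_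
    rw [div_le_iff₀ (by positivity)]
    have e : 192 / l ^ 2 * F * (l / 8) ^ 2 = 3 * F := by field_simp; ring
    rw [e]
    exact hP.2
  have p6 : γ.real {w | N ^ 2 * n ≤ (‖w‖ ^ 2 - n) ^ 2} ≤ chiVariance / N ^ 2 := by
    refine (measureReal_le_integral_div (fun w => sq_nonneg _) hχ.1 (by positivity)).trans ?_
    rw [hχ.2, ← chiVariance]
    apply le_of_eq
    field_simp
  have p7 : γ.real {w | l ^ 2 / 64 ≤ k₄ ^ 2 * (1 + N) ^ 2 * V w}
      ≤ 64 * k₄ ^ 2 * (1 + N) ^ 2 / l ^ 2 * v := by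
    refine (measureReal_le_integral_div (fun w => mul_nonneg (by positivity) (hV w))
      (hVi.const_mul _) (by positivity)).trans ?_
    rw [integral_const_mul, ← hv]
    apply le_of_eq
    field_simp
  -- comparison with the normal variable
  have hYm : Measurable fun w : EuclideanSpace ℝ (Fin n) => ⟪w, u⟫ := by fun_prop
  refine (abs_measureReal_le_sub_stdNormalCDF_le (map_inner_stdGaussian hu) hYm hl.le t).trans ?_
  gcongr
  set B : Set (EuclideanSpace ℝ (Fin n)) := {w | R ≤ ‖w‖} ∪ {w | ‖G w‖ ^ 2 < s}
      ∪ ({w | N ^ 2 ≤ ⟪w, u⟫ ^ 2} ∪ {w | (l / (8 * N)) ^ 2 ≤ ‖f w - m‖ ^ 2}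
      ∪ {w | (l / 8) ^ 2 ≤ (skorokhod f w - ⟪w, m⟫) ^ 2} ∪ {w | N ^ 2 * n ≤ (‖w‖ ^ 2 - n) ^ 2}
      ∪ {w | l ^ 2 / 64 ≤ k₄ ^ 2 * (1 + N) ^ 2 * V w}) with hB
  -- Outside B every comparison holds. On ‖G‖² ≥ s the normalized norm is at least 1/2, so dividing
  -- by it at most doubles the error: 2 (3l/8 + l/8) = l.
  have hsub : ∀ᵐ w ∂γ, w ∈ {w | l < |Z w - ⟪w, u⟫|} → w ∈ B := by
    filter_upwards [h₂] with w hw2 hw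
    by_contra hne
    have hlt : l < |Z w - ⟪w, u⟫| := hw
    simp only [hB, Set.mem_union, Set.mem_ofPred_eq, not_or, not_le, not_lt] at hne
    obtain ⟨⟨n1, n2⟩, ⟨⟨⟨n3, n4⟩, n5⟩, n6⟩, n7⟩ := hne
    have hD : 0 < ‖G w‖ ^ 2 + s := by positivity
    have hfw : ‖f w‖ = ‖G w‖ / √(‖G w‖ ^ 2 + s) := by
      rw [hf, cutNormalize, cutoff_eq_one hR n1.le, one_smul, smoothNormalize, norm_smul,
        norm_inv, Real.norm_of_nonneg (Real.sqrt_nonneg _), div_eq_inv_mul]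
    have b1 : 1 / 2 ≤ ‖f w‖ := by
      rw [hfw, le_div_iff₀ (Real.sqrt_pos.2 hD)]
      have : √(‖G w‖ ^ 2 + s) ≤ 2 * ‖G w‖ := by
        rw [Real.sqrt_le_left (by positivity)]
        nlinarith
      linarith
    have b2 : |‖f w‖ - ‖m‖| ≤ ‖f w - m‖ := abs_norm_sub_norm_le _ _
    have b3 : ‖f w - m‖ ≤ l / (8 * N) := (lt_of_pow_lt_pow_left₀ 2 (by positivity) n4).le
    have b4 : |⟪w, u⟫| ≤ N := by
      refine (lt_of_pow_lt_pow_left₀ 2 hN.le ?_).le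
      rwa [sq_abs]
    have b5 : |skorokhod f w - ⟪w, m⟫| ≤ l / 8 := by
      refine (lt_of_pow_lt_pow_left₀ 2 (by positivity) ?_).le
      rwa [sq_abs]
    have b6 : |‖w‖ ^ 2 - n| / √n ≤ N := by
      rw [div_le_iff₀ (Real.sqrt_pos.2 hn')]
      refine (lt_of_pow_lt_pow_left₀ 2 (by positivity) ?_).le
      rw [sq_abs, mul_pow, Real.sq_sqrt hn'.le]
      exact n6
    have b7 : k₄ * √(V w) * (1 + N) ≤ l / 8 := by
      refine (lt_of_pow_lt_pow_left₀ 2 (by positivity) ?_).le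
      rw [mul_pow, mul_pow, Real.sq_sqrt (hV w)]
      have e : (l / 8) ^ 2 = l ^ 2 / 64 := by ring
      rw [e]; linarith
    have b8 := hw2 n1 n2
    rw [← hfw] at b8
    have b9 : k₄ * √(V w) * (1 + |‖w‖ ^ 2 - n| / √n) ≤ k₄ * √(V w) * (1 + N) := by gcongr
    have b10 : |Z w * ‖f w‖ - ‖m‖ * ⟪w, u⟫| ≤ 3 * l / 8 := by
      have e : ‖m‖ * ⟪w, u⟫ = ⟪w, m⟫ := by
        conv_rhs => rw [hmu, inner_smul_right]
      rw [e]
      have := abs_sub_le (Z w * ‖f w‖) (skorokhod f w) ⟪w, m⟫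
      linarith
    have := abs_sub_le_of_normalized b1 hN b2 b3 b4 b10 le_rfl
    linarith
  have hsubr := ENNReal.toReal_mono (measure_ne_top _ _) (measure_mono_ae (μ := γ) hsub)
  refine hsubr.trans ?_
  refine (measureReal_union_le _ _).trans (add_le_add (measureReal_union_le _ _) ?_)
  refine (measureReal_union_le _ _).trans ?_
  rw [approxError]
  refine add_le_add ?_ p7
  refine (measureReal_union_le _ _).trans ((add_le_add (measureReal_union_le _ _) p6).trans ?_)
  have q := (measureReal_union_le {w | N ^ 2 ≤ ⟪w, u⟫ ^ 2} {w | (l / (8 * N)) ^ 2 ≤ ‖f w - m‖ ^ 2}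
    (μ := γ))
  have hFm : (128 * N ^ 2 + 192) / l ^ 2 * F
      ≤ (128 * N ^ 2 + 192) / l ^ 2 * (8 * (k₁ * v + k₂) + 2 / R ^ 2) := by gcongr
  have e1 : (128 * N ^ 2 + 192) / l ^ 2 * F = 128 * N ^ 2 / l ^ 2 * F + 192 / l ^ 2 * F := by ring
  have e2 : (1 + chiVariance) / N ^ 2 = 1 / N ^ 2 + chiVariance / N ^ 2 := by ring
  rw [e2]
  linarith

end NormalApproximation

/-! ### The pivot given the residual design and the noise -/

section ConditionalApproximation

variable {n p : ℕ} {ρ : ℝ → ℝ} {L K τ : ℝ} {g : EuclideanSpace ℝ (Fin p) → ℝ}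

/-- The pivot as a function of `(w, e)`; the factor `r` is `1` or `‖w‖² / n`. -/
noncomputable def pertPivot (ρ : ℝ → ℝ) (g : EuclideanSpace ℝ (Fin p) → ℝ)
    (A : Matrix (Fin n) (Fin p) ℝ) (β : EuclideanSpace ℝ (Fin p)) (j : Fin p) (c r : ℝ)
    (q : EuclideanSpace ℝ (Fin n) × EuclideanSpace ℝ (Fin n)) : ℝ :=
  ‖pertPsi ρ g A β j c q‖⁻¹ * (⟪pertPsi ρ g A β j c q, q.1⟫
    + c * pertErr ρ g A β j c q * r *
      (gradPsi ρ g (pertData A β j c q).1 (pertData A β j c q).2).trace)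

/-- The normalized squared error in the coordinate `j`. -/
noncomputable def pertEnergy (ρ : ℝ → ℝ) (g : EuclideanSpace ℝ (Fin p) → ℝ)
    (A : Matrix (Fin n) (Fin p) ℝ) (β : EuclideanSpace ℝ (Fin p)) (j : Fin p) (c s : ℝ)
    (q : EuclideanSpace ℝ (Fin n) × EuclideanSpace ℝ (Fin n)) : ℝ :=
  n * pertErr ρ g A β j c q ^ 2 / (‖pertPsi ρ g A β j c q‖ ^ 2 + s)

lemma hasFDerivAt_comp_left {E F H : Type*} [NormedAddCommGroup E] [NormedSpace ℝ E]
    [NormedAddCommGroup F] [NormedSpace ℝ F] [NormedAddCommGroup H] [NormedSpace ℝ H]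
    {f : E × F → H} {q : E × F} (hd : DifferentiableAt ℝ f q) :
    HasFDerivAt (fun w => f (w, q.2)) ((fderiv ℝ f q).comp (inl ℝ E F)) q.1 :=
  HasFDerivAt.comp (f := fun w : E => (w, q.2)) q.1 hd.hasFDerivAt (hasFDerivAt_prodMk_left q.1 q.2)

/-- Three errors appear: the factor r in place of 1, the rank one discrepancy between the divergence
in w and the trace in y, and the term from differentiating the normalization. The discrepancy costs
q, the normalization costs q plus c L √V, and r costs c L √V times the fluctuation of ‖w‖². -/
lemma abs_pertPivot_sub_skorokhod_le (hρ : IsRobustLoss ρ L K)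
    (hg : IsStronglyConvexPenalty g τ) (hτ : 0 < τ) (hL : 0 < L) (hn : 0 < n)
    (A : Matrix (Fin n) (Fin p) ℝ) (β : EuclideanSpace ℝ (Fin p)) (j : Fin p) {c : ℝ} (hc : 0 ≤ c)
    {q : EuclideanSpace ℝ (Fin n) × EuclideanSpace ℝ (Fin n)}
    (hd : DifferentiableAt ℝ (pertPsi ρ g A β j c) q) {s R r : ℝ} (hs : 0 < s) (hR : 0 < R)
    (hr : |r - 1| ≤ |‖q.1‖ ^ 2 - n| / n) (hqR : ‖q.1‖ < R)
    (hqs : s ≤ ‖pertPsi ρ g A β j c q‖ ^ 2) :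
    |pertPivot ρ g A β j c r q *
        (‖pertPsi ρ g A β j c q‖ / √(‖pertPsi ρ g A β j c q‖ ^ 2 + s))
      - skorokhod (cutNormalize R s fun w => pertPsi ρ g A β j c (w, q.2)) q.1|
    ≤ 2 * (√(L / (n * τ)) * c) + c * L * √(pertEnergy ρ g A β j c s q)
      * (1 + |‖q.1‖ ^ 2 - n| / √n) := by
  have hn' : (1 : ℝ) ≤ n := by exact_mod_cast hn
  have hq0 : 0 ≤ √(L / (n * τ)) * c := by positivity
  obtain ⟨b1, -, b3, b4⟩ := joint_derivative_bounds hL.le hq0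
    (fderiv_pertPsi_bound hρ hg hτ hL hn A β j hc hd)
  have hleft := hasFDerivAt_comp_left hd
  rw [skorokhod_cutNormalize hs hR hqR hleft.differentiableAt, hleft.fderiv, pertPivot,
    trace_gradPsi_eq hd]
  set P := pertPsi ρ g A β j c q with hP
  set T := fderiv ℝ (pertPsi ρ g A β j c) q with hT
  set err := pertErr ρ g A β j c q with herr
  set qq := √(L / (n * τ)) * c with hqq
  rw [pertEnergy, ← herr, ← hP]
  set tw := clmTrace (T.comp (inl ℝ (EuclideanSpace ℝ (Fin n)) (EuclideanSpace ℝ (Fin n))))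
  set te := clmTrace (T.comp (inr ℝ (EuclideanSpace ℝ (Fin n)) (EuclideanSpace ℝ (Fin n))))
  set D := √(‖P‖ ^ 2 + s) with hD
  have hDp : 0 < D := Real.sqrt_pos.2 (by positivity)
  have hD2 : D ^ 2 = ‖P‖ ^ 2 + s := Real.sq_sqrt (by positivity)
  have hPD : ‖P‖ ≤ D := Real.le_sqrt_of_sq_le (by linarith)
  have hPp : 0 < ‖P‖ := by
    by_contra h
    have h0 : ‖P‖ = 0 := le_antisymm (not_lt.1 h) (norm_nonneg _)
    rw [h0] at hqs
    simp only [ne_eq, OfNat.ofNat_ne_zero, not_false_eq_true, zero_pow] at hqs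
    linarith
  have hV : √(n * err ^ 2 / (‖P‖ ^ 2 + s)) = √n * |err| / D := by
    rw [Real.sqrt_div (by positivity), Real.sqrt_mul (by positivity), Real.sqrt_sq_eq_abs]
  have e1 : ‖P‖⁻¹ * (⟪P, q.1⟫ + c * err * r * te) * (‖P‖ / D)
      - ((⟪P, q.1⟫ - tw) / D
        + ⟪P, (T.comp (inl ℝ (EuclideanSpace ℝ (Fin n)) (EuclideanSpace ℝ (Fin n)))) P⟫ / D ^ 3)
      = (c * err) * (r - 1) * te / D + (tw + c * err * te) / D
        - ⟪P, T (P, 0)⟫ / D ^ 3 := by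
    rw [ContinuousLinearMap.comp_apply, inl_apply]
    field_simp
    ring
  rw [e1, hV]
  have hsn : 0 < √(n : ℝ) := Real.sqrt_pos.2 (by linarith)
  have hsn1 : 1 ≤ √(n : ℝ) := Real.one_le_sqrt.2 hn'
  have hsn2 : √(n : ℝ) * √n = n := Real.mul_self_sqrt (by linarith)
  -- The trace is at most n L and r - 1 at most |‖w‖² - n|/n; the factors of n recombine into √n
  -- |err|/D, the square root of the energy.
  have t1 : |(c * err) * (r - 1) * te / D|
      ≤ c * L * (√n * |err| / D) * (|‖q.1‖ ^ 2 - n| / √n) := by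
    rw [abs_div, abs_mul, abs_mul, abs_mul, abs_of_nonneg hc, abs_of_pos hDp]
    calc _ ≤ c * |err| * (|‖q.1‖ ^ 2 - n| / n) * (n * L) / D := by gcongr
      _ = _ := by field_simp
  have t2 : |(tw + c * err * te) / D| ≤ qq := by
    rw [abs_div, abs_of_pos hDp, div_le_iff₀ hDp]
    exact b1.trans (by gcongr)
  -- The operator norm suffices here: it gives |err|/D without √n, and 1 ≤ √n is wasteful but
  -- harmless.
  have t3 : |⟪P, T (P, 0)⟫ / D ^ 3| ≤ c * L * (√n * |err| / D) + qq := by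
    rw [abs_div, abs_of_pos (by positivity : 0 < D ^ 3), div_le_iff₀ (by positivity)]
    calc |⟪P, T (P, 0)⟫| ≤ ‖P‖ * ‖T (P, 0)‖ := abs_real_inner_le_norm _ _
      _ ≤ ‖P‖ * ((L * |c * err| + qq * ‖P‖) * ‖P‖) := by gcongr; exact b4 P
      _ ≤ D * ((L * |c * err| + qq * D) * D) := by gcongr
      _ = (c * L * (1 * |err| / D) + qq) * D ^ 3 := by
        rw [abs_mul, abs_of_nonneg hc]; field_simp
      _ ≤ _ := by gcongr
  have h1 := abs_sub ((c * err) * (r - 1) * te / D + (tw + c * err * te) / D)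
    (⟪P, T (P, 0)⟫ / D ^ 3)
  have h2 := abs_add_le ((c * err) * (r - 1) * te / D) ((tw + c * err * te) / D)
  have e2 : c * L * (√n * |err| / D) * (1 + |‖q.1‖ ^ 2 - n| / √n)
      = c * L * (√n * |err| / D) + c * L * (√n * |err| / D) * (|‖q.1‖ ^ 2 - n| / √n) := by ring
  rw [e2]
  linarith

/-- The normal approximation of the pivot, conditionally on the residual design and on the noise. -/
theorem conditional_normal_approximation (hρ : IsRobustLoss ρ L K)
    (hg : IsStronglyConvexPenalty g τ) (hτ : 0 < τ) (hL : 0 < L) (hn : 0 < n)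
    (A : Matrix (Fin n) (Fin p) ℝ) (β : EuclideanSpace ℝ (Fin p)) (j : Fin p) {c : ℝ} (hc : 0 ≤ c)
    (e : EuclideanSpace ℝ (Fin n))
    (hd : ∀ᵐ w ∂(stdGaussian (EuclideanSpace ℝ (Fin n))),
      DifferentiableAt ℝ (pertPsi ρ g A β j c) (w, e))
    {s R l N : ℝ} (hs : 0 < s) (hR : 0 < R) (hl : 0 < l) (hN : 0 < N)
    (hq : 2 * (√(L / (n * τ)) * c) ≤ l / 8)
    (hV : Integrable (fun w => pertEnergy ρ g A β j c s (w, e))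
      (stdGaussian (EuclideanSpace ℝ (Fin n))))
    {r : EuclideanSpace ℝ (Fin n) → ℝ} (hr : ∀ w, |r w - 1| ≤ |‖w‖ ^ 2 - n| / n) (t : ℝ) :
    |(stdGaussian (EuclideanSpace ℝ (Fin n))).real {w | pertPivot ρ g A β j c (r w) (w, e) ≤ t}
        - stdNormalCDF t|
      ≤ l + ((stdGaussian (EuclideanSpace ℝ (Fin n))).real {w | R ≤ ‖w‖}
        + (stdGaussian (EuclideanSpace ℝ (Fin n))).real {w | ‖pertPsi ρ g A β j c (w, e)‖ ^ 2 < s}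
        + approxError l N R (2 * (L * c) ^ 2) (2 * (√(L / (n * τ)) * c) ^ 2) (c * L)
          (∫ w, pertEnergy ρ g A β j c s (w, e) ∂(stdGaussian (EuclideanSpace ℝ (Fin n))))) := by
  have hcont : Continuous fun w : EuclideanSpace ℝ (Fin n) => (A, (w, e)) := by fun_prop
  have hjointPsi := continuous_pertPsi hρ hg hτ hL hn β j c
  have hcompPsi := hjointPsi.comp hcont
  have hCP : Continuous fun w : EuclideanSpace ℝ (Fin n) => pertPsi ρ g A β j c (w, e) := hcompPsi
  have hjointErr := continuous_pertErr hρ hg hτ hL hn β j c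
  have hcompErr := hjointErr.comp hcont
  have hCE : Continuous fun w : EuclideanSpace ℝ (Fin n) => pertErr ρ g A β j c (w, e) := hcompErr
  have hslope : ∀ x y : EuclideanSpace ℝ (Fin n),
      ‖pertPsi ρ g A β j c (x, e) - pertPsi ρ g A β j c (y, e)‖
        ≤ (L * (1 + c * |pertErr ρ g A β j c (x, e)|)
          + √(L / (n * τ)) * c * ‖pertPsi ρ g A β j c (x, e)‖) * ‖x - y‖ := by
    intro x y
    have h := norm_pertPsi_sub_le_slope hρ hg hτ hL hn A β j hc (x, e) (y, e)
    have e1 : ‖(x, e) - (y, e)‖ = ‖x - y‖ := by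
      rw [Prod.mk_sub_mk, sub_self, Prod.norm_mk, norm_zero, max_eq_left (norm_nonneg _)]
    rwa [e1] at h
  have hC : Continuous fun w : EuclideanSpace ℝ (Fin n) =>
      L * (1 + c * |pertErr ρ g A β j c (w, e)|)
        + √(L / (n * τ)) * c * ‖pertPsi ρ g A β j c (w, e)‖ :=
    ((continuous_const.add (hCE.abs.const_mul c)).const_mul L).add (hCP.norm.const_mul _)
  have hVnn : ∀ w, 0 ≤ pertEnergy ρ g A β j c s (w, e) := fun w => by
    rw [pertEnergy]; positivity
  have hfrob : ∀ᵐ w ∂(stdGaussian (EuclideanSpace ℝ (Fin n))),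
      frobSq (fderiv ℝ (fun w => pertPsi ρ g A β j c (w, e)) w)
        ≤ (‖pertPsi ρ g A β j c (w, e)‖ ^ 2 + s) *
          (2 * (L * c) ^ 2 * pertEnergy ρ g A β j c s (w, e)
            + 2 * (√(L / (n * τ)) * c) ^ 2) := by
    filter_upwards [hd] with w hw
    have hleft := hasFDerivAt_comp_left hw
    have hq0 : 0 ≤ √(L / (n * τ)) * c := by positivity
    obtain ⟨-, b2, -, -⟩ := joint_derivative_bounds hL.le hq0
      (fderiv_pertPsi_bound hρ hg hτ hL hn A β j hc hw)
    have e1 : fderiv ℝ (fun w => pertPsi ρ g A β j c (w, e)) w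
        = (fderiv ℝ (pertPsi ρ g A β j c) (w, e)).comp
          (inl ℝ (EuclideanSpace ℝ (Fin n)) (EuclideanSpace ℝ (Fin n))) := hleft.fderiv
    rw [e1]
    refine b2.trans ?_
    rw [pertEnergy]
    set P := ‖pertPsi ρ g A β j c (w, e)‖
    set err := pertErr ρ g A β j c (w, e)
    have hD : 0 < P ^ 2 + s := by positivity
    have e2 : (P ^ 2 + s) * (2 * (L * c) ^ 2 * (n * err ^ 2 / (P ^ 2 + s))
          + 2 * (√(L / (n * τ)) * c) ^ 2)
        = 2 * (n * (L * (c * err)) ^ 2) + 2 * ((√(L / (n * τ)) * c) ^ 2 * (P ^ 2 + s)) := by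
      field_simp
    rw [e2]
    gcongr
    linarith
  have hpiv : ∀ᵐ w ∂(stdGaussian (EuclideanSpace ℝ (Fin n))), ‖w‖ < R →
      s ≤ ‖pertPsi ρ g A β j c (w, e)‖ ^ 2 →
      |pertPivot ρ g A β j c (r w) (w, e) * (‖pertPsi ρ g A β j c (w, e)‖ /
          √(‖pertPsi ρ g A β j c (w, e)‖ ^ 2 + s))
        - skorokhod (cutNormalize R s fun w => pertPsi ρ g A β j c (w, e)) w|
      ≤ 2 * (√(L / (n * τ)) * c) + c * L * √(pertEnergy ρ g A β j c s (w, e))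
        * (1 + |‖w‖ ^ 2 - n| / √n) := by
    filter_upwards [hd] with w hw hwR hws
    exact abs_pertPivot_sub_skorokhod_le hρ hg hτ hL hn A β j hc hw hs hR (hr w) hwR hws
  exact normal_approximation hn hC hslope hs hR hVnn hV (mul_nonneg hc hL.le) hl hN hq hfrob hpiv t

end ConditionalApproximation

/-! ### Integration of conditional bounds -/

section Averaging

variable {α β : Type*} [MeasurableSpace α] [MeasurableSpace β] {μ : Measure α} {ν : Measure β}
  [IsProbabilityMeasure μ] [IsProbabilityMeasure ν]

lemma measureReal_prod_eq_integral {B : Set (α × β)} (hB : MeasurableSet B) :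
    Integrable (fun a => ν.real (Prod.mk a ⁻¹' B)) μ ∧
      ∫ a, ν.real (Prod.mk a ⁻¹' B) ∂μ = (μ.prod ν).real B := by
  have hi : Integrable (B.indicator (fun _ => (1 : ℝ))) (μ.prod ν) :=
    (integrable_const 1).indicator hB
  have e : ∀ a, ∫ b, B.indicator (fun _ => (1 : ℝ)) (a, b) ∂ν = ν.real (Prod.mk a ⁻¹' B) := by
    intro a
    have : (fun b => B.indicator (fun _ => (1 : ℝ)) (a, b))
        = (Prod.mk a ⁻¹' B).indicator (fun _ => (1 : ℝ)) := rfl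
    rw [this, integral_indicator_const _ (measurable_prodMk_left hB)]
    simp
  refine ⟨?_, ?_⟩
  · have := hi.integral_prod_left
    simpa only [e] using this
  · have := integral_prod _ hi
    rw [integral_indicator_const _ hB] at this
    simp only [e] at this
    rw [← this]; simp

/-- A bound for conditional probabilities that is affine in conditional quantities integrates. -/
lemma abs_measureReal_prod_sub_le {B D : Set (α × β)} {V : α × β → ℝ} (hB : MeasurableSet B)
    (hD : MeasurableSet D) (hV : Integrable V (μ.prod ν)) {φ k k' : ℝ}
    (h : ∀ᵐ a ∂μ, |ν.real (Prod.mk a ⁻¹' B) - φ|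
      ≤ k + ν.real (Prod.mk a ⁻¹' D) + k' * ∫ b, V (a, b) ∂ν) :
    |(μ.prod ν).real B - φ| ≤ k + (μ.prod ν).real D + k' * ∫ q, V q ∂(μ.prod ν) := by
  obtain ⟨i1, e1⟩ := measureReal_prod_eq_integral (μ := μ) (ν := ν) hB
  obtain ⟨i2, e2⟩ := measureReal_prod_eq_integral (μ := μ) (ν := ν) hD
  have i3 : Integrable (fun a => ∫ b, V (a, b) ∂ν) μ := hV.integral_prod_left
  have i4 : Integrable (fun a => k + ν.real (Prod.mk a ⁻¹' D)) μ := (integrable_const k).add i2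
  have e3 : (μ.prod ν).real B - φ = ∫ a, (ν.real (Prod.mk a ⁻¹' B) - φ) ∂μ := by
    rw [integral_sub i1 (integrable_const φ), e1]; simp
  have e4 : ∫ a, (k + ν.real (Prod.mk a ⁻¹' D) + k' * ∫ b, V (a, b) ∂ν) ∂μ
      = k + (μ.prod ν).real D + k' * ∫ q, V q ∂(μ.prod ν) := by
    rw [integral_add i4 (i3.const_mul k'), integral_add (integrable_const k) i2, e2,
      integral_const_mul, integral_prod _ hV]
    simp
  rw [e3, ← e4]
  exact (abs_integral_le_integral_abs).trans
    (integral_mono_ae (i1.sub (integrable_const φ)).abs (i4.add (i3.const_mul k')) h)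

end Averaging

/-! ### From the conditional bound to the joint law -/

section Coordinate

variable {n p : ℕ} {ρ : ℝ → ℝ} {L K τ κ : ℝ} {g : EuclideanSpace ℝ (Fin p) → ℝ}
  {Sigma : Matrix (Fin p) (Fin p) ℝ} {β : EuclideanSpace ℝ (Fin p)}

/-- The slope of `approxError` in its last argument. -/
noncomputable def approxSlope (l N k₁ k₄ : ℝ) : ℝ :=
  (128 * N ^ 2 + 192) / l ^ 2 * (8 * k₁) + 64 * k₄ ^ 2 * (1 + N) ^ 2 / l ^ 2

lemma approxError_eq (l N R k₁ k₂ k₄ v : ℝ) :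
    approxError l N R k₁ k₂ k₄ v
      = approxError l N R k₁ k₂ k₄ 0 + approxSlope l N k₁ k₄ * v := by
  rw [approxError, approxError, approxSlope]; ring

/-- The design and the noise, from the projected design, the Gaussian direction and the noise. -/
noncomputable def combineNoise (Sigma : Matrix (Fin p) (Fin p) ℝ) (j : Fin p)
    (q : (Fin n → EuclideanSpace ℝ (Fin p)) ×
      (EuclideanSpace ℝ (Fin n) × EuclideanSpace ℝ (Fin n))) :
    (Fin n → EuclideanSpace ℝ (Fin p)) × EuclideanSpace ℝ (Fin n) :=
  (designCombine Sigma j (q.1, q.2.2), q.2.1)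

lemma continuous_combineNoise (j : Fin p) :
    Continuous (combineNoise (n := n) Sigma j) :=
  ((continuous_designCombine j).comp
    (continuous_fst.prodMk (continuous_snd.comp continuous_snd))).prodMk
    (continuous_fst.comp continuous_snd)

lemma measurePreserving_combineNoise (hκ : 0 < κ) (hS : Sigma.IsSymm)
    (hsp : spectrum ℝ Sigma ⊆ Set.Icc κ (1 / κ)) (j : Fin p)
    (ν : Measure (EuclideanSpace ℝ (Fin n))) [IsProbabilityMeasure ν] :
    MeasurePreserving (combineNoise Sigma j)
      ((designLaw n Sigma).prod (ν.prod (stdGaussian (EuclideanSpace ℝ (Fin n)))))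
      (modelLaw n Sigma ν) := by
  have m1 : MeasurePreserving (Prod.map id Prod.swap)
      ((designLaw n Sigma).prod (ν.prod (stdGaussian (EuclideanSpace ℝ (Fin n)))))
      ((designLaw n Sigma).prod ((stdGaussian (EuclideanSpace ℝ (Fin n))).prod ν)) :=
    (MeasurePreserving.id _).prod Measure.measurePreserving_swap
  have m2 := (measurePreserving_prodAssoc (designLaw n Sigma)
    (stdGaussian (EuclideanSpace ℝ (Fin n))) ν).symm
  have m3 : MeasurePreserving (designCombine (n := n) Sigma j)
      ((designLaw n Sigma).prod (stdGaussian (EuclideanSpace ℝ (Fin n)))) (designLaw n Sigma) :=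
    ⟨(continuous_designCombine j).measurable, map_designCombine hκ hS hsp j⟩
  exact (m3.prod (MeasurePreserving.id ν)).comp (m2.comp m1)

/-- The swap reconciles two orders: the noise precedes the Gaussian direction for the iterated
integration, and follows it in the perturbed data. -/
lemma modelData_combineNoise (j : Fin p)
    (q : (Fin n → EuclideanSpace ℝ (Fin p)) ×
      (EuclideanSpace ℝ (Fin n) × EuclideanSpace ℝ (Fin n))) :
    (rowsMatrix (combineNoise Sigma j q).1, modelResponse β (combineNoise Sigma j q))
      = pertData (designResidual Sigma j q.1) β j (√(omega Sigma j))⁻¹ q.2.swap := by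
  have h := of_designCombine (n := n) (Sigma := Sigma) j (q.1, q.2.2)
  change rowsMatrix (designCombine Sigma j (q.1, q.2.2)) = _ at h
  rw [pertData, modelResponse, combineNoise, h]
  rfl

lemma modelPsi_combineNoise (j : Fin p)
    (q : (Fin n → EuclideanSpace ℝ (Fin p)) ×
      (EuclideanSpace ℝ (Fin n) × EuclideanSpace ℝ (Fin n))) :
    modelPsi ρ g β (combineNoise Sigma j q)
      = pertPsi ρ g (designResidual Sigma j q.1) β j (√(omega Sigma j))⁻¹ q.2.swap := by
  have h := modelData_combineNoise (β := β) (Sigma := Sigma) j q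
  rw [modelPsi, pertPsi, ← h]

lemma modelErr_combineNoise (j : Fin p)
    (q : (Fin n → EuclideanSpace ℝ (Fin p)) ×
      (EuclideanSpace ℝ (Fin n) × EuclideanSpace ℝ (Fin n))) :
    modelErr ρ g β (combineNoise Sigma j q) j
      = pertErr ρ g (designResidual Sigma j q.1) β j (√(omega Sigma j))⁻¹ q.2.swap := by
  have h := modelData_combineNoise (β := β) (Sigma := Sigma) j q
  rw [modelErr, pertErr, ← h]
  rfl

/-- The pivots as functions of the rows and the noise; the factor `r` is `1` for `xiPrime` and
`omega ‖z‖² / n` for `xi`. -/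
noncomputable def modelPivot (ρ : ℝ → ℝ) (g : EuclideanSpace ℝ (Fin p) → ℝ)
    (Sigma : Matrix (Fin p) (Fin p) ℝ) (β : EuclideanSpace ℝ (Fin p)) (j : Fin p)
    (r : EuclideanSpace ℝ (Fin n) → ℝ)
    (q : (Fin n → EuclideanSpace ℝ (Fin p)) × EuclideanSpace ℝ (Fin n)) : ℝ :=
  ‖modelPsi ρ g β q‖⁻¹ *
    (⟪modelPsi ρ g β q, √(omega Sigma j) • zvec (rowsMatrix q.1) Sigma j⟫
      + (√(omega Sigma j))⁻¹ * modelErr ρ g β q j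
        * r (√(omega Sigma j) • zvec (rowsMatrix q.1) Sigma j)
        * (gradPsi ρ g (rowsMatrix q.1) (modelResponse β q)).trace)

lemma modelPivot_combineNoise (hκ : 0 < κ) (hS : Sigma.IsSymm)
    (hsp : spectrum ℝ Sigma ⊆ Set.Icc κ (1 / κ)) (j : Fin p) (r : EuclideanSpace ℝ (Fin n) → ℝ)
    (q : (Fin n → EuclideanSpace ℝ (Fin p)) ×
      (EuclideanSpace ℝ (Fin n) × EuclideanSpace ℝ (Fin n))) :
    modelPivot ρ g Sigma β j r (combineNoise Sigma j q)
      = pertPivot ρ g (designResidual Sigma j q.1) β j (√(omega Sigma j))⁻¹ (r q.2.2)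
        q.2.swap := by
  have h0 : √(omega Sigma j) ≠ 0 := (Real.sqrt_pos.2 (omega_pos hκ hS hsp j)).ne'
  have h1 : √(omega Sigma j) • zvec (rowsMatrix (combineNoise Sigma j q).1) Sigma j = q.2.2 := by
    have h := zvec_designCombine (n := n) hκ hS hsp j (q.1, q.2.2)
    change zvec (rowsMatrix (combineNoise Sigma j q).1) Sigma j = _ at h
    rw [h, smul_smul, mul_inv_cancel₀ h0, one_smul]
  rw [modelPivot, h1, modelPsi_combineNoise, modelErr_combineNoise, pertPivot,
    ← modelData_combineNoise (β := β)]
  rfl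

end Coordinate

section Coordinate

variable {n p : ℕ} {ρ : ℝ → ℝ} {L K τ κ : ℝ} {g : EuclideanSpace ℝ (Fin p) → ℝ}
  {Sigma : Matrix (Fin p) (Fin p) ℝ} {β : EuclideanSpace ℝ (Fin p)}

/-- Rademacher applies jointly in the Gaussian direction and the noise. Both laws are absolutely
continuous, so Fubini gives differentiability for almost every noise and then almost every
direction; this makes the trace of the gradient in y meaningful. -/
lemma ae_ae_differentiableAt_pertPsi (hρ : IsRobustLoss ρ L K)
    (hg : IsStronglyConvexPenalty g τ) (hτ : 0 < τ) (hL : 0 < L) (hn : 0 < n)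
    (A : Matrix (Fin n) (Fin p) ℝ) (β : EuclideanSpace ℝ (Fin p)) (j : Fin p) {c : ℝ} (hc : 0 ≤ c)
    {ν : Measure (EuclideanSpace ℝ (Fin n))} [IsProbabilityMeasure ν] (hν : ν ≪ volume) :
    ∀ᵐ e ∂ν, ∀ᵐ w ∂(stdGaussian (EuclideanSpace ℝ (Fin n))),
      DifferentiableAt ℝ (pertPsi ρ g A β j c) (w, e) := by
  have hcont : Continuous fun q : EuclideanSpace ℝ (Fin n) × EuclideanSpace ℝ (Fin n) => (A, q) :=
    by fun_prop
  have hjointPsi := continuous_pertPsi hρ hg hτ hL hn β j c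
  have hcompPsi := hjointPsi.comp hcont
  have hCP : Continuous fun q => pertPsi ρ g A β j c q := hcompPsi
  have hjointErr := continuous_pertErr hρ hg hτ hL hn β j c
  have hcompErr := hjointErr.comp hcont
  have hCE : Continuous fun q => pertErr ρ g A β j c q := hcompErr
  have hC : Continuous fun q => L * (1 + c * |pertErr ρ g A β j c q|)
      + √(L / (n * τ)) * c * ‖pertPsi ρ g A β j c q‖ :=
    (continuous_const.mul (continuous_const.add (continuous_const.mul hCE.abs))).add
      (continuous_const.mul hCP.norm)
  have h1 := ae_differentiableAt_of_slope
    ((volume : Measure (EuclideanSpace ℝ (Fin n))).prod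
      (volume : Measure (EuclideanSpace ℝ (Fin n)))) hC
    (norm_pertPsi_sub_le_slope hρ hg hτ hL hn A β j hc)
  have hac : (stdGaussian (EuclideanSpace ℝ (Fin n))).prod ν
      ≪ (volume : Measure (EuclideanSpace ℝ (Fin n))).prod
        (volume : Measure (EuclideanSpace ℝ (Fin n))) :=
    stdGaussian_absolutelyContinuous.prod hν
  have h2 := hac.ae_le h1
  rw [← Measure.prod_swap] at h2
  have h3 := ae_of_ae_map measurable_swap.aemeasurable h2
  exact Measure.ae_ae_of_ae_prod h3

/-- The conditional error is affine in the conditional energy (`approxError_eq`) and in a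
conditional probability, so it integrates exactly, first over the noise and then over the residual
design. -/
theorem abs_modelLaw_real_sub_le (hκ : 0 < κ) (hS : Sigma.IsSymm)
    (hsp : spectrum ℝ Sigma ⊆ Set.Icc κ (1 / κ)) (hρ : IsRobustLoss ρ L K)
    (hg : IsStronglyConvexPenalty g τ) (hτ : 0 < τ) (hL : 0 < L) (hn : 0 < n) (j : Fin p)
    {ν : Measure (EuclideanSpace ℝ (Fin n))} [IsProbabilityMeasure ν] (hν : ν ≪ volume)
    {s R l N : ℝ} (hs : 0 < s) (hR : 0 < R) (hl : 0 < l) (hN : 0 < N)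
    (hq : 2 * (√(L / (n * τ)) * (√(omega Sigma j))⁻¹) ≤ l / 8)
    (hV : Integrable (fun q => n * modelErr ρ g β q j ^ 2 / (‖modelPsi ρ g β q‖ ^ 2 + s))
      (modelLaw n Sigma ν))
    {r : EuclideanSpace ℝ (Fin n) → ℝ} (hr : ∀ w, |r w - 1| ≤ |‖w‖ ^ 2 - n| / n)
    (hm : Measurable (modelPivot (n := n) ρ g Sigma β j r)) (t : ℝ) :
    |(modelLaw n Sigma ν).real {q | modelPivot ρ g Sigma β j r q ≤ t} - stdNormalCDF t|
      ≤ l + ((stdGaussian (EuclideanSpace ℝ (Fin n))).real {w | R ≤ ‖w‖}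
        + (modelLaw n Sigma ν).real {q | ‖modelPsi ρ g β q‖ ^ 2 < s}
        + approxError l N R (2 * (L * (√(omega Sigma j))⁻¹) ^ 2)
          (2 * (√(L / (n * τ)) * (√(omega Sigma j))⁻¹) ^ 2) ((√(omega Sigma j))⁻¹ * L)
          (∫ q, n * modelErr ρ g β q j ^ 2 / (‖modelPsi ρ g β q‖ ^ 2 + s)
            ∂(modelLaw n Sigma ν))) := by
  set c := (√(omega Sigma j))⁻¹ with hc
  have hc0 : 0 ≤ c := by positivity
  have hmp := measurePreserving_combineNoise (n := n) hκ hS hsp j ν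
  set B : Set ((Fin n → EuclideanSpace ℝ (Fin p)) × EuclideanSpace ℝ (Fin n)) :=
    {q | modelPivot ρ g Sigma β j r q ≤ t} with hB
  have hBm : MeasurableSet B := measurableSet_le hm measurable_const
  set D : Set ((Fin n → EuclideanSpace ℝ (Fin p)) × EuclideanSpace ℝ (Fin n)) :=
    {q | ‖modelPsi ρ g β q‖ ^ 2 < s} with hD
  have hDm : MeasurableSet D := measurableSet_lt
    ((continuous_modelPsi hρ hg hτ hL hn).norm.pow 2).measurable measurable_const
  set V : (Fin n → EuclideanSpace ℝ (Fin p)) × EuclideanSpace ℝ (Fin n) → ℝ :=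
    fun q => n * modelErr ρ g β q j ^ 2 / (‖modelPsi ρ g β q‖ ^ 2 + s) with hVd
  have hVm : Integrable (V ∘ combineNoise Sigma j)
      ((designLaw n Sigma).prod (ν.prod (stdGaussian (EuclideanSpace ℝ (Fin n))))) :=
    hmp.integrable_comp_of_integrable hV
  have hVe : ∀ a e w, (V ∘ combineNoise Sigma j) (a, (e, w))
      = pertEnergy ρ g (designResidual Sigma j a) β j c s (w, e) := by
    intro a e w
    simp only [hVd, Function.comp_apply, pertEnergy, modelErr_combineNoise, modelPsi_combineNoise]
    rfl
  have hΦ := continuous_combineNoise (n := n) (Sigma := Sigma) j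
  have hB' := hmp.measurable hBm
  have hD' := hmp.measurable hDm
  have eB : ((designLaw n Sigma).prod (ν.prod (stdGaussian (EuclideanSpace ℝ (Fin n))))).real
      (combineNoise Sigma j ⁻¹' B) = (modelLaw n Sigma ν).real B :=
    hmp.measureReal_preimage hBm.nullMeasurableSet
  have eD : ((designLaw n Sigma).prod (ν.prod (stdGaussian (EuclideanSpace ℝ (Fin n))))).real
      (combineNoise Sigma j ⁻¹' D) = (modelLaw n Sigma ν).real D :=
    hmp.measureReal_preimage hDm.nullMeasurableSet
  have eV : ∫ q, (V ∘ combineNoise Sigma j) q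
      ∂((designLaw n Sigma).prod (ν.prod (stdGaussian (EuclideanSpace ℝ (Fin n)))))
      = ∫ q, V q ∂(modelLaw n Sigma ν) := by
    rw [← hmp.map_eq, integral_map hmp.measurable.aemeasurable]
    · rfl
    · rw [hmp.map_eq]; exact hV.aestronglyMeasurable
  rw [approxError_eq, ← eB, ← eD, ← eV]
  set k0 := approxError l N R (2 * (L * c) ^ 2) (2 * (√(L / (n * τ)) * c) ^ 2) (c * L) 0
  set k1 := approxSlope l N (2 * (L * c) ^ 2) (c * L)
  set kR := (stdGaussian (EuclideanSpace ℝ (Fin n))).real {w | R ≤ ‖w‖}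
  have main := abs_measureReal_prod_sub_le (μ := designLaw n Sigma)
    (ν := ν.prod (stdGaussian (EuclideanSpace ℝ (Fin n)))) (φ := stdNormalCDF t)
    (k := l + (kR + k0)) (k' := k1) hB' hD' hVm ?_
  · linarith
  filter_upwards [hVm.prod_right_ae] with a ha
  refine abs_measureReal_prod_sub_le (μ := ν) (ν := stdGaussian (EuclideanSpace ℝ (Fin n)))
    (φ := stdNormalCDF t) (k := l + (kR + k0)) (k' := k1) (measurable_prodMk_left hB')
    (measurable_prodMk_left hD') ha ?_
  filter_upwards [ha.prod_right_ae, ae_ae_differentiableAt_pertPsi hρ hg hτ hL hn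
    (designResidual Sigma j a) β j hc0 hν] with e he hde
  simp only [hVe] at he ⊢
  have h := conditional_normal_approximation hρ hg hτ hL hn (designResidual Sigma j a) β j hc0 e hde
    hs hR hl hN hq he hr t
  rw [approxError_eq] at h
  have s1 : Prod.mk e ⁻¹' (Prod.mk a ⁻¹' (combineNoise Sigma j ⁻¹' B))
      = {w | pertPivot ρ g (designResidual Sigma j a) β j c (r w) (w, e) ≤ t} := by
    ext w
    change modelPivot ρ g Sigma β j r (combineNoise Sigma j (a, (e, w))) ≤ t ↔ _
    rw [modelPivot_combineNoise hκ hS hsp]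
    rfl
  have s2 : Prod.mk e ⁻¹' (Prod.mk a ⁻¹' (combineNoise Sigma j ⁻¹' D))
      = {w | ‖pertPsi ρ g (designResidual Sigma j a) β j c (w, e)‖ ^ 2 < s} := by
    ext w
    change ‖modelPsi ρ g β (combineNoise Sigma j (a, (e, w)))‖ ^ 2 < s ↔ _
    rw [modelPsi_combineNoise]
    rfl
  rw [s1, s2]
  linarith

lemma measurable_trace_gradPsi (hρ : IsRobustLoss ρ L K) (hg : IsStronglyConvexPenalty g τ)
    (hτ : 0 < τ) (hL : 0 < L) (hn : 0 < n) :
    Measurable fun q : (Fin n → EuclideanSpace ℝ (Fin p)) × EuclideanSpace ℝ (Fin n) =>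
      (gradPsi ρ g (rowsMatrix q.1) (modelResponse β q)).trace := by
  have hf : Continuous (fun (x : Fin n → EuclideanSpace ℝ (Fin p)) (y : EuclideanSpace ℝ (Fin n)) =>
      psi ρ g (rowsMatrix x) y).uncurry :=
    (continuous_psi hρ hg hτ hL hn).comp
      ((continuous_rowsMatrix.comp continuous_fst).prodMk continuous_snd)
  have hy : Continuous fun q : (Fin n → EuclideanSpace ℝ (Fin p)) × EuclideanSpace ℝ (Fin n) =>
      (q.1, modelResponse β q) :=
    continuous_fst.prodMk (continuous_snd.comp (continuous_modelData β))
  have hm : ∀ i : Fin n, Measurable fun q : (Fin n → EuclideanSpace ℝ (Fin p)) ×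
      EuclideanSpace ℝ (Fin n) => (fderiv ℝ (psi ρ g (rowsMatrix q.1)) (modelResponse β q)
        (EuclideanSpace.single i 1)) i := by
    intro i
    have h1 := (measurable_fderiv_apply_const_with_param ℝ hf (EuclideanSpace.single i 1)).comp
      hy.measurable
    have h2 : Continuous fun v : EuclideanSpace ℝ (Fin n) => v i := by fun_prop
    exact h2.measurable.comp h1
  exact Finset.measurable_sum _ fun i _ => hm i

lemma measurable_modelPivot (hρ : IsRobustLoss ρ L K) (hg : IsStronglyConvexPenalty g τ)
    (hτ : 0 < τ) (hL : 0 < L) (hn : 0 < n) (j : Fin p) {r : EuclideanSpace ℝ (Fin n) → ℝ}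
    (hr : Measurable r) : Measurable (modelPivot (n := n) ρ g Sigma β j r) := by
  have h1 := (continuous_modelPsi (n := n) (β := β) hρ hg hτ hL hn).measurable
  have h2 : Measurable fun q : (Fin n → EuclideanSpace ℝ (Fin p)) × EuclideanSpace ℝ (Fin n) =>
      modelErr ρ g β q j := by
    have h : Continuous fun v : EuclideanSpace ℝ (Fin p) => v j := by fun_prop
    have h' := h.comp (continuous_modelErr (n := n) (β := β) hρ hg hτ hL hn)
    exact h'.measurable
  have h3 : Measurable fun q : (Fin n → EuclideanSpace ℝ (Fin p)) × EuclideanSpace ℝ (Fin n) =>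
      √(omega Sigma j) • zvec (rowsMatrix q.1) Sigma j := by
    have hx : Continuous fun q : (Fin n → EuclideanSpace ℝ (Fin p)) × EuclideanSpace ℝ (Fin n) =>
        (rowsMatrix q.1, WithLp.toLp 2 (Sigma⁻¹ *ᵥ ((omega Sigma j)⁻¹ • Pi.single j (1 : ℝ)))) :=
      (continuous_rowsMatrix.comp continuous_fst).prodMk continuous_const
    have hx2 := continuous_act.comp hx
    have h : Continuous fun q : (Fin n → EuclideanSpace ℝ (Fin p)) × EuclideanSpace ℝ (Fin n) =>
        zvec (rowsMatrix q.1) Sigma j := hx2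
    have h5 := h.const_smul (√(omega Sigma j))
    exact h5.measurable
  have h4 := measurable_trace_gradPsi (p := p) (β := β) hρ hg hτ hL hn
  exact h1.norm.inv.mul ((h1.inner h3).add (((h2.const_mul _).mul (hr.comp h3)).mul h4))

end Coordinate

/-- The error of the normal approximation is small, uniformly in large `n`, when the coordinate of
the estimation error is small. -/
lemma exists_uniform_error {υ τ κ L : ℝ} (hυ : 0 < υ) (hτ : 0 < τ) (hκ : 0 < κ) (hL : 0 < L) :
    ∃ N θ₀ n₀ : ℝ, 0 < N ∧ 0 < θ₀ ∧ ∀ n : ℝ, 0 < n → n₀ ≤ n → ∀ c : ℝ, 0 ≤ c → c ^ 2 ≤ 1 / κ →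
      2 * (√(L / (n * τ)) * c) ≤ υ / 8 / 8 ∧ ∀ θ : ℝ, 0 ≤ θ → θ ≤ θ₀ →
        approxError (υ / 8) N (√(8 * n / υ)) (2 * (L * c) ^ 2) (2 * (√(L / (n * τ)) * c) ^ 2)
          (c * L) θ ≤ 3 * υ / 8 := by
  have hchi : 0 ≤ chiVariance := variance_nonneg _ _
  set N := √(8 * (1 + chiVariance) / υ) with hN
  have hNp : 0 < N := Real.sqrt_pos.2 (by positivity)
  -- N is chosen so that the first term of `approxError` is υ/8.
  have hN2 : N ^ 2 = 8 * (1 + chiVariance) / υ := Real.sq_sqrt (by positivity)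
  set D := (128 * N ^ 2 + 192) / (υ / 8) ^ 2 with hD
  have hDp : 0 < D := by positivity
  set B := D * (8 * (2 * (L ^ 2 / κ))) + 64 * (1 + N) ^ 2 / (υ / 8) ^ 2 * (L ^ 2 / κ) with hB
  have hBp : 0 < B := by positivity
  -- B bounds the slope of `approxError` in the energy, so θ₀ limits that part to υ/8. The threshold
  -- n₀ is a sum of two: one limits the part of order 1/n to υ/8, the other gives 2 √(L/(nτ)) c ≤
  -- υ/64.
  refine ⟨N, υ / 8 / B, D * (16 * (L / (τ * κ)) + υ / 4) * 8 / υ + 256 * (L / (τ * κ)) / (υ / 8) ^ 2,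
    hNp, by positivity, ?_⟩
  intro n hn hn0 c hc hcκ
  have hS2 : (√(L / (n * τ)) * c) ^ 2 ≤ L / (τ * κ) / n := by
    rw [mul_pow, Real.sq_sqrt (by positivity)]
    calc L / (n * τ) * c ^ 2 ≤ L / (n * τ) * (1 / κ) := by gcongr
      _ = L / (τ * κ) / n := by field_simp
  have hLc : (L * c) ^ 2 ≤ L ^ 2 / κ := by
    rw [mul_pow]
    calc L ^ 2 * c ^ 2 ≤ L ^ 2 * (1 / κ) := by gcongr
      _ = L ^ 2 / κ := by ring
  refine ⟨?_, fun θ hθ hθ0 => ?_⟩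
  · refine abs_le_of_sq_le_sq' ?_ (by positivity) |>.2
    have h1 : 256 * (L / (τ * κ)) / (υ / 8) ^ 2 ≤ n := by
      have : 0 < D * (16 * (L / (τ * κ)) + υ / 4) * 8 / υ := by positivity
      linarith
    rw [div_le_iff₀ (by positivity)] at h1
    have h2 : L / (τ * κ) / n ≤ (υ / 8) ^ 2 / 256 := by
      rw [div_le_iff₀ hn]; linarith
    rw [mul_pow]
    nlinarith
  · have h1 : D * (16 * (L / (τ * κ)) + υ / 4) / n ≤ υ / 8 := by
      have h0 : 0 < 256 * (L / (τ * κ)) / (υ / 8) ^ 2 := by positivity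
      have h2 : D * (16 * (L / (τ * κ)) + υ / 4) * 8 / υ ≤ n := by linarith
      rw [div_le_iff₀ hυ] at h2
      rw [div_le_iff₀ hn]; linarith
    have h3 : B * θ ≤ υ / 8 := by
      rw [le_div_iff₀ hBp] at hθ0; linarith
    have hR2 : √(8 * n / υ) ^ 2 = 8 * n / υ := Real.sq_sqrt (by positivity)
    have e1 : (1 + chiVariance) / N ^ 2 = υ / 8 := by
      have : 1 + chiVariance ≠ 0 := by positivity
      rw [hN2]; field_simp
    have e2 : 2 / √(8 * n / υ) ^ 2 = υ / 4 / n := by rw [hR2]; field_simp; norm_num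
    rw [approxError, e1, e2, ← hD]
    have h4 : D * (8 * (2 * (L * c) ^ 2 * θ + 2 * (√(L / (n * τ)) * c) ^ 2) + υ / 4 / n)
        ≤ D * (8 * (2 * (L ^ 2 / κ) * θ + 2 * (L / (τ * κ) / n)) + υ / 4 / n) := by gcongr
    have h5 : 64 * (c * L) ^ 2 * (1 + N) ^ 2 / (υ / 8) ^ 2 * θ
        ≤ 64 * (L ^ 2 / κ) * (1 + N) ^ 2 / (υ / 8) ^ 2 * θ := by
      rw [mul_comm c L]; gcongr
    have e3 : D * (8 * (2 * (L ^ 2 / κ) * θ + 2 * (L / (τ * κ) / n)) + υ / 4 / n)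
        + 64 * (L ^ 2 / κ) * (1 + N) ^ 2 / (υ / 8) ^ 2 * θ
        = B * θ + D * (16 * (L / (τ * κ)) + υ / 4) / n := by
      rw [hB]; ring
    linarith

lemma card_mul_le_sum {ι : Type*} [Fintype ι] {f : ι → ℝ} (hf : ∀ i, 0 ≤ f i) {θ : ℝ}
    {s : Set ι} (h : ∀ i ∈ s, θ ≤ f i) : s.ncard * θ ≤ ∑ i, f i := by
  classical
  rw [Set.ncard_eq_toFinset_card' s, ← nsmul_eq_mul]
  exact (Finset.card_nsmul_le_sum _ _ _ fun i hi => h i (by simpa using hi)).trans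
    (Finset.sum_le_univ_sum_of_nonneg hf)

/-! ### Counting the exceptional coordinates -/

section Model

variable {n p : ℕ} {ρ : ℝ → ℝ} {L K τ κ : ℝ} {g : EuclideanSpace ℝ (Fin p) → ℝ}
  {Sigma : Matrix (Fin p) (Fin p) ℝ} {β : EuclideanSpace ℝ (Fin p)}

lemma integral_coordinate_energy (hρ : IsRobustLoss ρ L K)
    (hg : IsStronglyConvexPenalty g τ) (hτ : 0 < τ) (hL : 0 < L) (hn : 0 < n)
    {μ : Measure ((Fin n → EuclideanSpace ℝ (Fin p)) × EuclideanSpace ℝ (Fin n))} {s : ℝ}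
    (hs : 0 < s)
    (hi : Integrable (fun q => n * ‖modelErr ρ g β q‖ ^ 2 / (‖modelPsi ρ g β q‖ ^ 2 + s)) μ) :
    (∀ j, Integrable (fun q => n * modelErr ρ g β q j ^ 2 / (‖modelPsi ρ g β q‖ ^ 2 + s)) μ) ∧
    ∑ j, ∫ q, n * modelErr ρ g β q j ^ 2 / (‖modelPsi ρ g β q‖ ^ 2 + s) ∂μ
      = ∫ q, n * ‖modelErr ρ g β q‖ ^ 2 / (‖modelPsi ρ g β q‖ ^ 2 + s) ∂μ := by
  have e : ∀ q : (Fin n → EuclideanSpace ℝ (Fin p)) × EuclideanSpace ℝ (Fin n),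
      n * ‖modelErr ρ g β q‖ ^ 2 / (‖modelPsi ρ g β q‖ ^ 2 + s)
      = ∑ j, n * modelErr ρ g β q j ^ 2 / (‖modelPsi ρ g β q‖ ^ 2 + s) := by
    intro q
    rw [EuclideanSpace.real_norm_sq_eq (modelErr ρ g β q), Finset.mul_sum, Finset.sum_div]
  have h1 : ∀ j, Integrable
      (fun q => n * modelErr ρ g β q j ^ 2 / (‖modelPsi ρ g β q‖ ^ 2 + s)) μ := by
    intro j
    have hP := continuous_modelPsi (n := n) (β := β) hρ hg hτ hL hn
    have hv : Continuous fun v : EuclideanSpace ℝ (Fin p) => v j := by fun_prop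
    have hE := hv.comp (continuous_modelErr (n := n) (β := β) hρ hg hτ hL hn)
    have hE' : Continuous fun q : (Fin n → EuclideanSpace ℝ (Fin p)) × EuclideanSpace ℝ (Fin n) =>
      modelErr ρ g β q j := hE
    have hc : Continuous fun q : (Fin n → EuclideanSpace ℝ (Fin p)) × EuclideanSpace ℝ (Fin n) =>
        n * modelErr ρ g β q j ^ 2 / (‖modelPsi ρ g β q‖ ^ 2 + s) :=
      (continuous_const.mul (hE'.pow 2)).div ((hP.norm.pow 2).add continuous_const)
        fun q => by positivity
    refine hi.mono' hc.aestronglyMeasurable (ae_of_all _ fun q => ?_)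
    rw [Real.norm_of_nonneg (by positivity), e q]
    exact Finset.single_le_sum
      (f := fun j => n * modelErr ρ g β q j ^ 2 / (‖modelPsi ρ g β q‖ ^ 2 + s))
      (fun i _ => by positivity) (Finset.mem_univ j)
  refine ⟨h1, ?_⟩
  rw [← integral_finsetSum _ fun j _ => h1 j]
  simp only [e]

/-- For large n an exceptional coordinate must carry energy at least θ₀, while the total energy is
at most C; for small n the number of coordinates is itself bounded. The two cases give the two
entries of the maximum. -/
theorem exists_exceptional_bound {υ γ R : ℝ} (hυ : 0 < υ) (hγ : 0 < γ) (hκ : 0 < κ)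
    (hτ : 0 < τ) (hL : 0 < L) (hK : 0 < K) :
    ∃ a : ℕ, ∀ (n p : ℕ), 0 < n → (p : ℝ) / n ≤ γ → ∀ (ρ : ℝ → ℝ), IsRobustLoss ρ L K →
      ∀ (g : EuclideanSpace ℝ (Fin p) → ℝ), IsStronglyConvexPenalty g τ →
      ∀ (Sigma : Matrix (Fin p) (Fin p) ℝ), Sigma.IsSymm →
        spectrum ℝ Sigma ⊆ Set.Icc κ (1 / κ) →
      ∀ (β : EuclideanSpace ℝ (Fin p)) (ν : Measure (EuclideanSpace ℝ (Fin n)))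
        [IsProbabilityMeasure ν], ν ≪ volume →
      Integrable (fun q => squaredError ρ g Sigma β (rowsMatrix q.1) (modelResponse β q))
        (modelLaw n Sigma ν) →
      ∫ q, squaredError ρ g Sigma β (rowsMatrix q.1) (modelResponse β q) ∂(modelLaw n Sigma ν) ≤ R →
      ∀ r : EuclideanSpace ℝ (Fin n) → ℝ, Measurable r →
        (∀ w, |r w - 1| ≤ |‖w‖ ^ 2 - n| / n) → ∀ t : ℝ,
      {j | υ < |(modelLaw n Sigma ν).real {q | modelPivot ρ g Sigma β j r q ≤ t}
        - stdNormalCDF t|}.ncard ≤ a := by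
  obtain ⟨C, hC⟩ := exists_regularization (R := R) (η := υ / 8) hγ (by positivity) hκ hτ hL hK
  obtain ⟨N, θ₀, n₀, hN, hθ₀, hunif⟩ := exists_uniform_error hυ hτ hκ hL
  refine ⟨⌈max (C / θ₀) (γ * n₀)⌉₊, ?_⟩
  intro n p hn hpn ρ hρ g hg Sigma hS hsp β ν _ hν hi hI r hrm hr t
  have hn' : (0 : ℝ) < n := by exact_mod_cast hn
  suffices h : ((({j | υ < |(modelLaw n Sigma ν).real {q | modelPivot ρ g Sigma β j r q ≤ t}
        - stdNormalCDF t|} : Set (Fin p)).ncard : ℕ) : ℝ) ≤ max (C / θ₀) (γ * n₀) by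
    exact_mod_cast h.trans (Nat.le_ceil _)
  rcases lt_or_ge (n : ℝ) n₀ with hnn | hnn
  · refine le_trans ?_ (le_max_right _ _)
    have h1 := Set.ncard_le_card ({j | υ < |(modelLaw n Sigma ν).real
      {q | modelPivot ρ g Sigma β j r q ≤ t} - stdNormalCDF t|} : Set (Fin p))
    rw [Nat.card_fin] at h1
    have h2 : (p : ℝ) ≤ γ * n := by rwa [div_le_iff₀ hn'] at hpn
    have h3 : γ * n ≤ γ * n₀ := by gcongr
    exact (Nat.cast_le.2 h1).trans (h2.trans h3)
  · refine le_trans ?_ (le_max_left _ _)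
    obtain ⟨s, hs, hη, hVi, hVC⟩ := hC n p hn hpn ρ hρ g hg Sigma hS hsp β ν hν hi hI
    obtain ⟨hVj, hsum⟩ := integral_coordinate_energy hρ hg hτ hL hn hs hVi
    rw [le_div_iff₀ hθ₀]
    refine le_trans ?_ hVC
    rw [← hsum]
    have hpos : ∀ j, 0 ≤ ∫ q, n * modelErr ρ g β q j ^ 2 / (‖modelPsi ρ g β q‖ ^ 2 + s)
        ∂(modelLaw n Sigma ν) := fun j => integral_nonneg fun q => by positivity
    refine card_mul_le_sum hpos fun j hj => ?_
    by_contra hlt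
    rw [Set.mem_ofPred_eq] at hj
    have hω := omega_pos hκ hS hsp j
    have hcκ : (√(omega Sigma j))⁻¹ ^ 2 ≤ 1 / κ := by
      rw [inv_pow, Real.sq_sqrt hω.le, ← one_div]
      exact one_div_le_one_div_of_le hκ (le_omega hκ hS hsp j)
    obtain ⟨hq, herr⟩ := hunif n hn' hnn _ (inv_nonneg.2 (Real.sqrt_nonneg _)) hcκ
    have hRp : 0 < √(8 * n / υ) := Real.sqrt_pos.2 (by positivity)
    have h1 := abs_modelLaw_real_sub_le hκ hS hsp hρ hg hτ hL hn j hν hs hRp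
      (l := υ / 8) (by positivity) hN hq (hVj j) hr
      (measurable_modelPivot hρ hg hτ hL hn j hrm) t
    have h2 := herr _ (hpos j) (not_le.1 hlt).le
    have h3 : (stdGaussian (EuclideanSpace ℝ (Fin n))).real {w | √(8 * n / υ) ≤ ‖w‖} ≤ υ / 8 := by
      have h4 := measureReal_le_integral_div (fun w => sq_nonneg ‖w‖)
        (integrable_norm_sq_stdGaussian (ι := Fin n)) (c := 8 * n / υ) (by positivity)
      have e1 : {w : EuclideanSpace ℝ (Fin n) | √(8 * n / υ) ≤ ‖w‖}
          = {w | 8 * n / υ ≤ ‖w‖ ^ 2} := by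
        ext w
        exact Real.sqrt_le_left (norm_nonneg w)
      rw [e1]
      refine h4.trans (le_of_eq ?_)
      rw [integral_norm_sq_stdGaussian]; field_simp
    -- The budget: υ/8 for the shift l, υ/8 for the cutoff, υ/8 for small scores and 3υ/8 for
    -- `approxError`, below υ in total.
    linarith

lemma sqrt_omega_mul_xi {j : Fin p} (hω : 0 < omega Sigma j)
    (q : (Fin n → EuclideanSpace ℝ (Fin p)) × EuclideanSpace ℝ (Fin n)) :
    √(omega Sigma j) * xi ρ g Sigma β (rowsMatrix q.1) (modelResponse β q) j
      = modelPivot ρ g Sigma β j (fun w => ‖w‖ ^ 2 / n) q := by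
  have h0 : √(omega Sigma j) ≠ 0 := (Real.sqrt_pos.2 hω).ne'
  simp only [xi, modelPivot, modelPsi, modelErr, inner_smul_right, norm_smul, PiLp.sub_apply,
    Real.norm_of_nonneg (Real.sqrt_nonneg _)]
  field_simp
  ring

lemma sqrt_omega_mul_xiPrime {j : Fin p} (hω : 0 < omega Sigma j)
    (q : (Fin n → EuclideanSpace ℝ (Fin p)) × EuclideanSpace ℝ (Fin n)) :
    √(omega Sigma j) * xiPrime ρ g Sigma β (rowsMatrix q.1) (modelResponse β q) j
      = modelPivot ρ g Sigma β j (fun _ => 1) q := by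
  have h0 : √(omega Sigma j) ≠ 0 := (Real.sqrt_pos.2 hω).ne'
  have h1 : (omega Sigma j)⁻¹ = (√(omega Sigma j))⁻¹ * (√(omega Sigma j))⁻¹ := by
    rw [← mul_inv, Real.mul_self_sqrt hω.le]
  simp only [xiPrime, modelPivot, modelPsi, modelErr, inner_smul_right, PiLp.sub_apply, h1]
  field_simp
  ring

end Model

/-! ### Transfer to the given probability space -/

section Transfer

variable {S : Type*} [MeasurableSpace S] {P : Measure S} [IsProbabilityMeasure P] {n p : ℕ}
  {X : S → Matrix (Fin n) (Fin p) ℝ} {ε : S → EuclideanSpace ℝ (Fin n)}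
  {Sigma : Matrix (Fin p) (Fin p) ℝ} {κ : ℝ}

/-- The rows of the design and the noise. -/
noncomputable def rowsNoise (X : S → Matrix (Fin n) (Fin p) ℝ)
    (ε : S → EuclideanSpace ℝ (Fin n)) (ω : S) :
    (Fin n → EuclideanSpace ℝ (Fin p)) × EuclideanSpace ℝ (Fin n) :=
  (fun i => WithLp.toLp 2 (X ω i), ε ω)

lemma IsGaussianDesign.aemeasurable_rowsNoise (h : IsGaussianDesign P X ε Sigma κ) :
    AEMeasurable (rowsNoise X ε) P :=
  (aemeasurable_pi_lambda _ fun i => (h.rows_law i).aemeasurable).prodMk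
    h.noise_density.aemeasurable

lemma IsGaussianDesign.map_rowsNoise (h : IsGaussianDesign P X ε Sigma κ) :
    P.map (rowsNoise X ε) = modelLaw n Sigma (P.map ε) := by
  have hr : AEMeasurable (fun ω (i : Fin n) => WithLp.toLp 2 (X ω i)) P :=
    aemeasurable_pi_lambda _ fun i => (h.rows_law i).aemeasurable
  have hε : AEMeasurable ε P := h.noise_density.aemeasurable
  have hind : IndepFun (fun ω (i : Fin n) => WithLp.toLp 2 (X ω i)) ε P := by
    have hm : Measurable fun (m : Fin n → Fin p → ℝ) (i : Fin n) => WithLp.toLp 2 (m i) := by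
      fun_prop
    exact (h.noise_indep.comp measurable_id hm).symm
  have h1 := (indepFun_iff_map_prod_eq_prod_map_map hr hε).1 hind
  have h2 := (iIndepFun_iff_map_fun_eq_pi_map fun i => (h.rows_law i).aemeasurable).1 h.rows_indep
  change P.map (fun ω => ((fun (i : Fin n) => WithLp.toLp 2 (X ω i)), ε ω)) = _
  rw [h1, h2, modelLaw, designLaw]
  simp only [(h.rows_law _).map_eq]

end Transfer

end RobustM

theorem corollary1 (υ τ R γ κ L K t : ℝ) (hυ : 0 < υ) (hτ : 0 < τ) (hR : 0 < R) (hγ : 0 < γ)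
    (hκ : 0 < κ) (hκ1 : κ < 1) (hL : 0 < L) (hK : 0 < K) :
    ∃ a : ℕ, ∀ (n p : ℕ), 0 < n → (p : ℝ) / n ≤ γ →
      ∀ (ρ : ℝ → ℝ), RobustM.IsRobustLoss ρ L K →
      ∀ (g : EuclideanSpace ℝ (Fin p) → ℝ), RobustM.IsStronglyConvexPenalty g τ →
      ∀ (Sigma : Matrix (Fin p) (Fin p) ℝ) (β : EuclideanSpace ℝ (Fin p))
        (S : Type*) [MeasurableSpace S] (P : Measure S) [IsProbabilityMeasure P]
        (X : S → Matrix (Fin n) (Fin p) ℝ) (ε : S → EuclideanSpace ℝ (Fin n)),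
      RobustM.IsGaussianDesign P X ε Sigma κ →
      ∀ (y : S → EuclideanSpace ℝ (Fin n)), (∀ ω, y ω = RobustM.response (X ω) β (ε ω)) →
      Integrable (fun ω => RobustM.squaredError ρ g Sigma β (X ω) (y ω)) P →
      ∫ ω, RobustM.squaredError ρ g Sigma β (X ω) (y ω) ∂P ≤ R →
      (RobustM.exceptionalSet P Sigma
          (fun j ω => RobustM.xi ρ g Sigma β (X ω) (y ω) j) υ t).ncard ≤ a ∧
      (RobustM.exceptionalSet P Sigma
          (fun j ω => RobustM.xiPrime ρ g Sigma β (X ω) (y ω) j) υ t).ncard ≤ a := by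
  obtain ⟨a, ha⟩ := RobustM.exists_exceptional_bound (R := R) hυ hγ hκ hτ hL hK
  refine ⟨a, ?_⟩
  intro n p hn hpn ρ hρ g hg Sigma β S _ P _ X ε hX y hy hi hI
  have hn' : (0 : ℝ) < n := by exact_mod_cast hn
  -- All quantities are now functions of the rows and the noise, so hypotheses and conclusions
  -- depend only on the joint law, which is `modelLaw`.
  obtain rfl : y = fun ω => RobustM.modelResponse β (RobustM.rowsNoise X ε ω) := funext hy
  have hm := hX.aemeasurable_rowsNoise
  have hlaw := hX.map_rowsNoise
  have hεm : AEMeasurable ε P := hX.noise_density.aemeasurable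
  have : IsProbabilityMeasure (P.map ε) := Measure.isProbabilityMeasure_map hεm
  have hν : P.map ε ≪ volume := hX.noise_density.absolutelyContinuous
  have hsq : Continuous fun q : (Fin n → EuclideanSpace ℝ (Fin p)) × EuclideanSpace ℝ (Fin n) =>
      RobustM.squaredError ρ g Sigma β (RobustM.rowsMatrix q.1) (RobustM.modelResponse β q) := by
    have hE := RobustM.continuous_modelErr (n := n) (β := β) hρ hg hτ hL hn
    have hf : Continuous fun v : EuclideanSpace ℝ (Fin p) => v.ofLp ⬝ᵥ (Sigma *ᵥ v.ofLp) := by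
      fun_prop
    have h := hf.comp hE
    exact h
  have hi' : Integrable (fun q => RobustM.squaredError ρ g Sigma β (RobustM.rowsMatrix q.1)
      (RobustM.modelResponse β q)) (RobustM.modelLaw n Sigma (P.map ε)) := by
    rw [← hlaw, integrable_map_measure hsq.aestronglyMeasurable hm]
    exact hi
  have hI' : ∫ q, RobustM.squaredError ρ g Sigma β (RobustM.rowsMatrix q.1)
      (RobustM.modelResponse β q) ∂(RobustM.modelLaw n Sigma (P.map ε)) ≤ R := by
    rw [← hlaw, integral_map hm hsq.aestronglyMeasurable]
    exact hI
  have key := ha n p hn hpn ρ hρ g hg Sigma hX.symm hX.eigenvalues β (P.map ε) hν hi' hI'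
  have hprob : ∀ (j : Fin p) (r : EuclideanSpace ℝ (Fin n) → ℝ), Measurable r →
      P.real {ω | RobustM.modelPivot ρ g Sigma β j r (RobustM.rowsNoise X ε ω) ≤ t}
      = (RobustM.modelLaw n Sigma (P.map ε)).real
        {q | RobustM.modelPivot ρ g Sigma β j r q ≤ t} := by
    intro j r hr
    have hpm := RobustM.measurable_modelPivot (Sigma := Sigma) (β := β) hρ hg hτ hL hn j hr
    rw [← hlaw, Measure.real, Measure.real,
      Measure.map_apply_of_aemeasurable hm (measurableSet_le hpm measurable_const)]
    rfl
  have hω := fun j => RobustM.omega_pos hκ hX.symm hX.eigenvalues j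
  constructor
  · have hr : Measurable fun w : EuclideanSpace ℝ (Fin n) => ‖w‖ ^ 2 / (n : ℝ) := by fun_prop
    -- Since w = Ω_jj^(1/2) z_j, the ratio of ‖z_j‖²/n to Ω_jj⁻¹ is ‖w‖²/n, for which the condition
    -- on r is an equality.
    convert! key (fun w => ‖w‖ ^ 2 / n) hr (fun w => le_of_eq ?_) t using 2
    · ext j
      rw [Set.mem_ofPred_eq, ← hprob j _ hr]
      have e : ∀ ω, √(RobustM.omega Sigma j) * RobustM.xi ρ g Sigma β (X ω)
          (RobustM.modelResponse β (RobustM.rowsNoise X ε ω)) j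
          = RobustM.modelPivot ρ g Sigma β j (fun w => ‖w‖ ^ 2 / n) (RobustM.rowsNoise X ε ω) :=
        fun ω => RobustM.sqrt_omega_mul_xi (hω j) (RobustM.rowsNoise X ε ω)
      simp only [RobustM.exceptionalSet, e, Set.mem_ofPred_eq]
    · rw [div_sub_one hn'.ne', abs_div, abs_of_pos hn']
  · convert! key (fun _ => 1) measurable_const (fun w => ?_) t using 2
    · ext j
      rw [Set.mem_ofPred_eq, ← hprob j _ measurable_const]
      have e : ∀ ω, √(RobustM.omega Sigma j) * RobustM.xiPrime ρ g Sigma β (X ω)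
          (RobustM.modelResponse β (RobustM.rowsNoise X ε ω)) j
          = RobustM.modelPivot ρ g Sigma β j (fun _ => 1) (RobustM.rowsNoise X ε ω) :=
        fun ω => RobustM.sqrt_omega_mul_xiPrime (hω j) (RobustM.rowsNoise X ε ω)
      simp only [RobustM.exceptionalSet, e, Set.mem_ofPred_eq]
    · rw [sub_self, abs_zero]; positivity
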